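/- Let $N\ge 1$, $p>1$, and let $G\in C^1(\mathbb R)$ satisfy $G(0)=0$ and $G(s)\ge a|s|^p$ for all $s\in\mathbb R$, for some $a>0$. Put $$\gamma_S(N,p)=2+(N+1)p-(N-1)p^2,\qquad p_S(N)=\sup\{q>1:\gamma_S(N,q)>0\}\in(1,\infty],$$ $$\Gamma_S(N,p)=\Bigl(1+\frac1p\Bigr)\frac1{p-1}-\frac{N-1}2=\frac{\gamma_S(N,p)}{2p(p-1)},$$ and suppose $\Gamma_S(N,p)\ge 0$ (that is, $1<p\le p_S(N)$). Let $f,g\in C_c^\infty(\mathbb R^N)$ be real-valued with $\int_{\mathbb R^N}g\,dx>0$, and let $r_0=\sup\{|x|:x\in\operatorname{supp}f\cup\operatorname{supp}g\}$. For $\varepsilon>0$ and $T\in(0,\infty]$, a weak solution in $(0,T)$ of $$\partial_t^2u-\Delta u=G(u),\qquad u(0)=\varepsilon f,\qquad \partial_tu(0)=\varepsilon g$$ is a real-valued function $u\in C([0,T);H^1(\mathbb R^N))\cap C^1([0,T);L^2(\mathbb R^N))$ with $G(u)\in L^1(0,T;L^1(\mathbb R^N))$, $u(0)=\varepsilon f$,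 $\partial_tu(0)=\varepsilon g$ and, for every $\Psi\in C_c^\infty(\mathbb R^N\times[0,T))$, $$\varepsilon\int_{\mathbb R^N}g(x)\Psi(x,0)\,dx+\int_0^T\!\!\int_{\mathbb R^N}G(u)\Psi\,dx\,dt=\int_0^T\!\!\int_{\mathbb R^N}\bigl(-\partial_tu\,\partial_t\Psi+\nabla u\cdot\nabla\Psi\bigr)\,dx\,dt.$$ Then there are constants $\varepsilon_0>0$ and $C>0$, independent of $\varepsilon$, $T$ and $u$, such that for every $\varepsilon\in(0,\varepsilon_0]$, every $T\in(0,\infty]$ and every weak solution $u$ in $(0,T)$ with $\operatorname{supp}u\subset\{(x,t):|x|\le r_0+t\}$, $$T\le\begin{cases} C\varepsilon^{-\frac{p-1}{2}} & \text{if } N=1,\ 1<p<\infty,\\ C\varepsilon^{-\frac{p-1}{3-p}} & \text{if } N=2,\ 1<p\le 2,\\ C\varepsilon^{-\Gamma_S(2,p)^{-1}} & \text{if } N=2,\ 2<p<p_S(2),\\ C\varepsilon^{-\Gamma_S(N,p)^{-1}} & \text{if } N\ge 3,\ 1<p<p_S(N),\\ \exp\bigl(C\varepsilon^{-p(p-1)}\bigr)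 & \text{if } N\ge 2,\ p=p_S(N). \end{cases}$$ In particular $T<\infty$. -/

import Mathlib

open MeasureTheory Set
open scoped ContDiff

noncomputable section

/-- `γ_S(N,p) = 2 + (N+1)p - (N-1)p²`. -/
def gammaS (N : ℕ) (p : ℝ) : ℝ :=
  2 + ((N : ℝ) + 1) * p - ((N : ℝ) - 1) * p ^ 2

/-- The Strauss exponent `p_S(N) = sup {p > 1 ; γ_S(N,p) > 0}`, an extended real number
(it is infinite for `N = 1`). -/
def straussExponent (N : ℕ) : EReal :=
  sSup ((fun q : ℝ => (q : EReal)) '' {q : ℝ | 1 < q ∧ 0 < gammaS N q})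

/-- `Γ_S(N,p) = (1 + 1/p)(p-1)⁻¹ - (N-1)/2`. -/
def GammaS (N : ℕ) (p : ℝ) : ℝ :=
  (1 + 1 / p) * (p - 1)⁻¹ - ((N : ℝ) - 1) / 2

/-- The half-open time interval `[0,T)`, where `T` may be infinite. -/
def timeInterval (T : EReal) : Set ℝ :=
  {t : ℝ | 0 ≤ t ∧ (t : EReal) < T}

/-- Test functions on `ℝ^N × [0,T)`: restrictions to `t ≥ 0` of smooth functions on `ℝ^N × ℝ` with
compact support in `ℝ^N × (-∞,T)`. They need not vanish at `t = 0`. -/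
structure IsTestFunction {N : ℕ} (T : EReal) (ψ : EuclideanSpace ℝ (Fin N) → ℝ → ℝ) : Prop where
  smooth : ContDiff ℝ ∞ (Function.uncurry ψ)
  compact : HasCompactSupport (Function.uncurry ψ)
  before : ∀ z ∈ tsupport (Function.uncurry ψ), (z.2 : EReal) < T

/-- `w ∈ L²(ℝ^N; ℝ^N)` is the weak gradient of `v ∈ L²(ℝ^N)`; in particular `v ∈ H¹(ℝ^N)`. -/
def IsWeakGradient {N : ℕ}
    (v : Lp ℝ 2 (volume : Measure (EuclideanSpace ℝ (Fin N))))
    (w : Lp (EuclideanSpace ℝ (Fin N)) 2 (volume : Measure (EuclideanSpace ℝ (Fin N)))) : Prop :=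
  ∀ φ : EuclideanSpace ℝ (Fin N) → ℝ, ContDiff ℝ ∞ φ → HasCompactSupport φ →
    ∫ x, v x • gradient φ x = -∫ x, φ x • w x

/-- `u` is a weak solution in `(0,T)` of `∂ₜ²u - Δu = G(u)`, `u(0) = ε f`, `∂ₜu(0) = ε g`.

Here `U` is `u` as a curve in `L²(ℝ^N)`, `V` is its time derivative and `W` its weak gradient in
space. Continuity of `U` and `W` in `L²` is `u ∈ C([0,T); H¹)`; continuity of `V` in `L²` is
`u ∈ C¹([0,T); L²)`. The condition `G(u) ∈ L¹(0,T; L¹)` is integrability over `ℝ^N × [0,T)`. -/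
def IsWeakSolution {N : ℕ} (G : ℝ → ℝ) (f g : EuclideanSpace ℝ (Fin N) → ℝ) (ε : ℝ) (T : EReal)
    (u : EuclideanSpace ℝ (Fin N) → ℝ → ℝ) : Prop :=
  AEStronglyMeasurable (Function.uncurry u) (volume.restrict (univ ×ˢ timeInterval T)) ∧
  IntegrableOn (fun z : EuclideanSpace ℝ (Fin N) × ℝ => G (u z.1 z.2))
    (univ ×ˢ timeInterval T) ∧
  ∃ (U V : ℝ → Lp ℝ 2 (volume : Measure (EuclideanSpace ℝ (Fin N))))
    (W : ℝ → Lp (EuclideanSpace ℝ (Fin N)) 2 (volume : Measure (EuclideanSpace ℝ (Fin N)))),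
    (∀ t ∈ timeInterval T, ∀ᵐ x, u x t = U t x) ∧
    ContinuousOn U (timeInterval T) ∧
    ContinuousOn V (timeInterval T) ∧
    ContinuousOn W (timeInterval T) ∧
    (∀ t ∈ timeInterval T, HasDerivWithinAt U (V t) (timeInterval T) t) ∧
    (∀ t ∈ timeInterval T, IsWeakGradient (U t) (W t)) ∧
    (∀ᵐ x, U 0 x = ε * f x) ∧
    (∀ᵐ x, V 0 x = ε * g x) ∧
    ∀ ψ : EuclideanSpace ℝ (Fin N) → ℝ → ℝ, IsTestFunction T ψ →
      ε * (∫ x, g x * ψ x 0) + ∫ t in timeInterval T, ∫ x, G (u x t) * ψ x t =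
        ∫ t in timeInterval T, ∫ x,
          (-(V t x * deriv (fun s => ψ x s) t)
            + inner ℝ (W t x) (gradient (fun y => ψ y t) x))

/-- `r₀ = sup {|x| ; x ∈ supp (f,g)}`. -/
def dataRadius {N : ℕ} (f g : EuclideanSpace ℝ (Fin N) → ℝ) : ℝ :=
  sSup ((fun x => ‖x‖) '' (tsupport f ∪ tsupport g))

/-- `supp u ⊆ {(x,t) ; |x| ≤ r + t}`, the support being that of an `L²`-valued function of `t`. -/
def SupportedInCone {N : ℕ} (r : ℝ) (T : EReal) (u : EuclideanSpace ℝ (Fin N) → ℝ → ℝ) : Prop :=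
  ∀ t ∈ timeInterval T, ∀ᵐ x, r + t < ‖x‖ → u x t = 0

end

noncomputable section

/-! The proof is a test function argument. For a unit vector θ and c ≥ r₀ + 2, the plane wave (t + c
- x·θ)^(-α) is a positive solution of the free wave equation on the cone |x| ≤ r₀ + t. Its mean W_α
over all directions θ (`waveMean`) plays the role of the self-similar solutions of hypergeometric
type. Write m = (N-1)/2 and let q be the conjugate exponent of p. If A > m, then W_A(x,t) is at most
a constant times τ^(-m) (τ - |x|)^(m - A) with τ = t + c (`exists_lintegral_phase_rpow_le`).

Testing the equation with η_R(t) W_α, where η_R is a time cut-off at scale R, gives ε J |S| + a ∫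
|u|^p η_R W_α ≤ ∫ |u| (|η_R''| W_α + 2α |η_R'| W_{α+1}). Here |S| is the total mass of
`sphereMeasure`, and J > 0 because ∫ g > 0 dominates the contribution of f once c is large
(`exists_initial_plane_wave_pos`). The right side lives in the slab R/2 < t ≤ R. As η_R' and η_R''
are controlled by η_R^(1/p), Hölder's inequality bounds it by the mass I_R of |u|^p η_R in the slab
to the power 1/p, times the L^q norm of an explicit weight (`IsBlowupSetting.waveMean_le_slabMass`).

Three values of α give everything. (i) For α = 0 the mean is constant, and absorption yields ε ≤ K
R^(N+1-2q) and I_R ≤ K R^(N+1-2q) (`IsBlowupSetting.exists_time_test_bound`). The first bound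
settles N = 1, and N = 2 with p ≤ 2. (ii) For α = (N+1)/2 the weight has no loss from the boundary
of the cone, and I_R ≥ k ε^p R^(N - mp) (`IsBlowupSetting.exists_le_slabMass`). Against the upper
bound in (i) this reads ε^p ≤ K R^(-pΓ_S), the subcritical life span. (iii) If γ_S = 0, then α = β =
m - 1/p = N - mp makes the weight diverge only logarithmically. With A_j = 2^(-jβ) I_{2^j} this
gives (A_1 + … + A_n)^p ≤ K n^(p-1) A_n, while (ii) says A_n ≥ k ε^p. Such a discrete differential
inequality lasts at most C ε^(-p(p-1)) + 1 steps (`exists_length_le_of_recursion`). Since R is about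
2^n, the bound is exponential. -/

/-! ### The Strauss exponent and its polynomial -/

theorem GammaS_eq_gammaS_div (N : ℕ) {p : ℝ} (hp : 1 < p) :
    GammaS N p = gammaS N p / (2 * p * (p - 1)) := by
  have h1 : p - 1 ≠ 0 := by linarith
  have h2 : p ≠ 0 := by linarith
  unfold GammaS gammaS
  field_simp
  ring

/-- The quotient γ_S(N,s)/s = 2/s + (N+1) - (N-1)s is decreasing in s > 0, so positivity at some q >
p passes down to p. -/
theorem gammaS_pos_of_lt_straussExponent (N : ℕ) (hN : 1 ≤ N) {p : ℝ} (hp : 1 < p)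
    (h : (p : EReal) < straussExponent N) : 0 < gammaS N p := by
  obtain ⟨_, ⟨q, ⟨hq1, hq2⟩, rfl⟩, hpq⟩ := lt_sSup_iff.1 h
  have hpq' : p < q := EReal.coe_lt_coe_iff.1 hpq
  unfold gammaS at *
  have hN' : (1 : ℝ) ≤ N := by exact_mod_cast hN
  by_contra hcon
  push Not at hcon
  nlinarith [mul_nonneg (sub_nonneg.2 hN') (mul_nonneg (by linarith : 0 ≤ p)
    (mul_nonneg (by linarith : 0 ≤ q) (sub_nonneg.2 hpq'.le))),
    mul_pos (by linarith : 0 < p) hq2, mul_nonneg (by linarith : 0 ≤ q) (sub_nonneg.2 hcon)]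

theorem GammaS_pos_of_lt_straussExponent (N : ℕ) (hN : 1 ≤ N) {p : ℝ} (hp : 1 < p)
    (h : (p : EReal) < straussExponent N) : 0 < GammaS N p := by
  rw [GammaS_eq_gammaS_div N hp]
  have := gammaS_pos_of_lt_straussExponent N hN hp h
  have : 0 < p - 1 := by linarith
  positivity

/-- If γ_S were positive at p, continuity would keep it positive slightly to the right of p, and p
would not be the supremum. -/
theorem gammaS_eq_zero_of_eq_straussExponent (N : ℕ) {p : ℝ} (hp : 1 < p)
    (hΓ : 0 ≤ GammaS N p) (h : (p : EReal) = straussExponent N) : gammaS N p = 0 := by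
  have h0 : 0 ≤ gammaS N p := by
    rw [GammaS_eq_gammaS_div N hp] at hΓ
    have : 0 < 2 * p * (p - 1) := by
      have : 0 < p - 1 := by linarith
      positivity
    by_contra hcon
    exact absurd hΓ (not_le.2 (div_neg_of_neg_of_pos (not_le.1 hcon) this))
  by_contra hne
  have hpos : 0 < gammaS N p := lt_of_le_of_ne h0 (Ne.symm hne)
  have hcont : Continuous (gammaS N) := by unfold gammaS; fun_prop
  obtain ⟨q, hq, hpq⟩ := ((hcont.continuousAt.eventually (lt_mem_nhds hpos)).filter_mono
    nhdsWithin_le_nhds |>.and (self_mem_nhdsWithin (s := Ioi p))).exists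
  have : (q : EReal) ≤ straussExponent N :=
    le_sSup ⟨q, ⟨hp.trans hpq, hq⟩, rfl⟩
  rw [← h] at this
  exact absurd (EReal.coe_le_coe_iff.1 this) (not_le.2 hpq)

/-! ### Measure on the sphere and decay of spherical means of plane waves -/

/-- The cone measure on the unit sphere, as a measure on the whole space: the image of the Lebesgue
measure on the unit ball under the radial projection. -/
def sphereMeasure (N : ℕ) : Measure (EuclideanSpace ℝ (Fin N)) :=
  (volume.restrict (Metric.ball 0 1)).map (fun x => ‖x‖⁻¹ • x)

theorem measurable_radialProjection (N : ℕ) :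
    Measurable (fun x : EuclideanSpace ℝ (Fin N) => ‖x‖⁻¹ • x) := by fun_prop

theorem sphereMeasure_univ (N : ℕ) :
    sphereMeasure N univ = volume (Metric.ball (0 : EuclideanSpace ℝ (Fin N)) 1) := by
  rw [sphereMeasure, Measure.map_apply (measurable_radialProjection N) MeasurableSet.univ]
  simp

instance isFiniteMeasure_sphereMeasure (N : ℕ) : IsFiniteMeasure (sphereMeasure N) :=
  ⟨by rw [sphereMeasure_univ]; exact measure_ball_lt_top⟩

theorem sphereMeasure_univ_pos (N : ℕ) : 0 < sphereMeasure N univ := by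
  rw [sphereMeasure_univ]; exact Metric.measure_ball_pos _ _ one_pos

theorem ae_norm_eq_one_sphereMeasure (N : ℕ) [NeZero N] :
    ∀ᵐ θ ∂(sphereMeasure N), ‖θ‖ = 1 := by
  rw [sphereMeasure, ae_map_iff (measurable_radialProjection N).aemeasurable
    (measurableSet_eq_fun measurable_norm measurable_const)]
  have h0 : ∀ᵐ x : EuclideanSpace ℝ (Fin N), x ≠ 0 := by
    simp [ae_iff, measure_singleton]
  filter_upwards [ae_restrict_of_ae h0] with x hx
  rw [norm_smul, norm_inv, norm_norm, inv_mul_cancel₀ (norm_ne_zero_iff.2 hx)]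

/-- A point y of the cone over the cap lies within ρ of ‖y‖e, and ‖y‖e lies within ρ‖e‖ of the grid
point kρe with k = ⌊‖y‖/ρ⌋. The number of balls is of order 1/ρ, which turns volumes ρ^N into cap
measures ρ^(N-1). -/
theorem radialProjection_preimage_subset {N : ℕ} {e : EuclideanSpace ℝ (Fin N)} {ρ : ℝ}
    (hρ : 0 < ρ) :
    (fun x => ‖x‖⁻¹ • x) ⁻¹' Metric.closedBall e ρ ∩ Metric.ball 0 1 ⊆
      ⋃ k ∈ Finset.range (⌊1 / ρ⌋₊ + 1), Metric.closedBall (((k : ℝ) * ρ) • e) (2 * ρ * max 1 ‖e‖)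
      := by
  rintro y ⟨hy, hy1⟩
  rw [mem_ball_zero_iff] at hy1
  simp only [mem_preimage, Metric.mem_closedBall, dist_eq_norm] at hy
  simp only [mem_iUnion, Finset.mem_range, Metric.mem_closedBall, dist_eq_norm, exists_prop]
  refine ⟨⌊‖y‖ / ρ⌋₊, Nat.lt_succ_of_le (Nat.floor_le_floor (by gcongr)), ?_⟩
  have hfl := Nat.floor_le (div_nonneg (norm_nonneg y) hρ.le)
  have hfl2 := Nat.lt_floor_add_one (‖y‖ / ρ)
  set k : ℝ := (⌊‖y‖ / ρ⌋₊ : ℝ)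
  rw [le_div_iff₀ hρ] at hfl
  rw [div_lt_iff₀ hρ] at hfl2
  have h1 : ‖y - ‖y‖ • e‖ ≤ ρ := by
    rcases eq_or_ne y 0 with rfl | hne
    · simpa using hρ.le
    have hn : ‖y‖ ≠ 0 := norm_ne_zero_iff.2 hne
    have : y - ‖y‖ • e = ‖y‖ • (‖y‖⁻¹ • y - e) := by
      rw [smul_sub, smul_smul, mul_inv_cancel₀ hn, one_smul]
    rw [this, norm_smul, norm_norm]
    calc ‖y‖ * _ ≤ 1 * ρ := by gcongr
      _ = ρ := one_mul ρ
  have h2 : ‖‖y‖ • e - (k * ρ) • e‖ ≤ ρ * ‖e‖ := by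
    rw [← sub_smul, norm_smul, Real.norm_eq_abs, abs_of_nonneg (by linarith)]
    gcongr
    linarith
  calc ‖y - (k * ρ) • e‖ ≤ ‖y - ‖y‖ • e‖ + ‖‖y‖ • e - (k * ρ) • e‖ := norm_sub_le_norm_sub_add_norm_sub _ _ _
    _ ≤ ρ + ρ * ‖e‖ := add_le_add h1 h2
    _ ≤ 2 * ρ * max 1 ‖e‖ := by
      nlinarith [le_max_left 1 ‖e‖, le_max_right 1 ‖e‖]

theorem exists_sphereMeasure_closedBall_le (N : ℕ) [NeZero N] :
    ∃ C : ℝ, 0 < C ∧ ∀ (e : EuclideanSpace ℝ (Fin N)) (ρ : ℝ), ‖e‖ = 1 → 0 < ρ →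
      sphereMeasure N (Metric.closedBall e ρ) ≤ ENNReal.ofReal (C * ρ ^ (N - 1)) := by
  set V : ℝ := volume.real (Metric.ball (0 : EuclideanSpace ℝ (Fin N)) 1)
  have hV : 0 < V := ENNReal.toReal_pos (Metric.measure_ball_pos _ _ one_pos).ne'
    measure_ball_lt_top.ne
  have hV' : volume (Metric.ball (0 : EuclideanSpace ℝ (Fin N)) 1) = ENNReal.ofReal V :=
    (ENNReal.ofReal_toReal measure_ball_lt_top.ne).symm
  refine ⟨2 * 2 ^ N * V, by positivity, fun e ρ he hρ => ?_⟩
  have hN : N - 1 + 1 = N := Nat.succ_pred_eq_of_pos (NeZero.pos N)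
  -- For ρ ≥ 1 the total mass suffices. For ρ < 1 there are at most 2/ρ balls in the covering, each
  -- of radius 2ρ.
  rcases le_or_gt 1 ρ with h1 | h1
  · calc sphereMeasure N (Metric.closedBall e ρ) ≤ sphereMeasure N univ := measure_mono (subset_univ _)
      _ = ENNReal.ofReal V := by rw [sphereMeasure_univ, hV']
      _ ≤ _ := by
        apply ENNReal.ofReal_le_ofReal
        have a1 : (1 : ℝ) ≤ 2 ^ N := one_le_pow₀ (by norm_num)
        have a2 : 1 ≤ ρ ^ (N - 1) := one_le_pow₀ h1
        have a3 : 1 ≤ 2 ^ N * ρ ^ (N - 1) := one_le_mul_of_one_le_of_one_le a1 a2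
        nlinarith
  · rw [sphereMeasure, Measure.map_apply (measurable_radialProjection N) Metric.isClosed_closedBall.measurableSet,
      Measure.restrict_apply (measurable_radialProjection N Metric.isClosed_closedBall.measurableSet)]
    refine (measure_mono (radialProjection_preimage_subset hρ)).trans
      ((measure_biUnion_finset_le _ _).trans ?_)
    have hball : ∀ k : ℕ, volume (Metric.closedBall (((k : ℝ) * ρ) • e) (2 * ρ * max 1 ‖e‖)) =
        ENNReal.ofReal ((2 * ρ) ^ N * V) := by
      intro k
      rw [he, max_self, mul_one, Measure.addHaar_closedBall _ _ (by positivity), hV',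
        finrank_euclideanSpace_fin, ← ENNReal.ofReal_mul (by positivity)]
    simp only [hball, Finset.sum_const, Finset.card_range, nsmul_eq_mul]
    rw [← ENNReal.ofReal_natCast, ← ENNReal.ofReal_mul (by positivity)]
    apply ENNReal.ofReal_le_ofReal
    have hfl : ((⌊1 / ρ⌋₊ + 1 : ℕ) : ℝ) * ρ ≤ 2 := by
      have := Nat.floor_le (by positivity : 0 ≤ 1 / ρ)
      rw [le_div_iff₀ hρ] at this
      push_cast
      linarith
    calc ((⌊1 / ρ⌋₊ + 1 : ℕ) : ℝ) * ((2 * ρ) ^ N * V)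
        = (((⌊1 / ρ⌋₊ + 1 : ℕ) : ℝ) * ρ) * (2 ^ N * V * ρ ^ (N - 1)) := by
          conv_lhs => rw [mul_pow, ← hN, pow_succ ρ, hN]
          ring
      _ ≤ 2 * (2 ^ N * V * ρ ^ (N - 1)) := by gcongr
      _ = _ := by ring

/-- The sublevel sets of the phase `θ ↦ τ - ⟪x, θ⟫` on the unit sphere. -/
theorem exists_sphereMeasure_phase_lt_le (N : ℕ) [NeZero N] :
    ∃ C : ℝ, 0 < C ∧ ∀ (x : EuclideanSpace ℝ (Fin N)) (τ s : ℝ), ‖x‖ < τ → 0 < s →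
      sphereMeasure N {θ | τ - inner ℝ x θ < s} ≤
        ENNReal.ofReal (C * (s / τ) ^ (((N : ℝ) - 1) / 2)) := by
  obtain ⟨C, hC, hcap⟩ := exists_sphereMeasure_closedBall_le N
  set m : ℝ := ((N : ℝ) - 1) / 2 with hm
  have hN1 : 1 ≤ N := NeZero.one_le
  have hm0 : 0 ≤ m := by
    have : (1 : ℝ) ≤ N := by exact_mod_cast hN1
    rw [hm]; linarith
  set V : ℝ := (sphereMeasure N).real univ
  have hV : 0 ≤ V := measureReal_nonneg
  refine ⟨C * 2 ^ (N - 1) + V * 2 ^ m, by positivity, fun x τ s hx hs => ?_⟩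
  have hτ : 0 < τ := (norm_nonneg x).trans_lt hx
  have hpow : 0 ≤ (s / τ) ^ m := by positivity
  -- If ‖x‖ ≤ τ/2 the phase is at least τ/2 almost everywhere. The sublevel set is then null, or s/τ
  -- > 1/2 and the total mass is an admissible bound.
  rcases le_or_gt ‖x‖ (τ / 2) with h | h
  · rcases le_or_gt s (τ / 2) with h2 | h2
    · have : sphereMeasure N {θ | τ - inner ℝ x θ < s} = 0 := by
        have := ae_norm_eq_one_sphereMeasure N
        refine measure_mono_null (fun θ hθ => ?_) this
        simp only [mem_ofPred_eq, mem_compl_iff] at hθ ⊢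
        intro h1
        have := real_inner_le_norm x θ
        rw [h1] at this
        linarith
      rw [this]; exact zero_le
    · calc _ ≤ sphereMeasure N univ := measure_mono (subset_univ _)
        _ = ENNReal.ofReal V := (ENNReal.ofReal_toReal (measure_ne_top _ _)).symm
        _ ≤ _ := by
          apply ENNReal.ofReal_le_ofReal
          have h3 : 1 ≤ 2 ^ m * (s / τ) ^ m := by
            rw [← Real.mul_rpow (by norm_num) (by positivity)]
            apply Real.one_le_rpow _ hm0
            rw [← mul_div_assoc, le_div_iff₀ hτ]
            linarith
          have : 0 ≤ C * 2 ^ (N - 1) * (s / τ) ^ m := by positivity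
          nlinarith
  · have hxpos : 0 < ‖x‖ := by linarith
    set e := ‖x‖⁻¹ • x with he
    have he1 : ‖e‖ = 1 := by
      rw [he, norm_smul, norm_inv, norm_norm, inv_mul_cancel₀ hxpos.ne']
    have hxe : x = ‖x‖ • e := by rw [he, smul_smul, mul_inv_cancel₀ hxpos.ne', one_smul]
    -- Here ‖x‖ > τ/2, so s > τ - ‖x‖⟪e,θ⟫ forces 1 - ⟪e,θ⟫ ≤ 2s/τ. As ‖θ - e‖² = 2(1 - ⟪e,θ⟫), the
    -- sublevel set lies in the cap of radius 2√(s/τ).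
    have hρ : 0 < 2 * √(s / τ) := by positivity
    calc _ ≤ sphereMeasure N (Metric.closedBall e (2 * √(s / τ))) := by
          refine measure_mono_ae ?_
          filter_upwards [ae_norm_eq_one_sphereMeasure N] with θ hθ hlt
          change τ - inner ℝ x θ < s at hlt
          change dist θ e ≤ _
          rw [dist_eq_norm]
          have h5 : ‖θ - e‖ ^ 2 = 2 - 2 * inner ℝ e θ := by
            rw [@norm_sub_sq_real, hθ, he1, real_inner_comm]; ring
          rw [hxe, real_inner_smul_left] at hlt
          have h6 : ‖θ - e‖ ^ 2 ≤ 4 * (s / τ) := by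
            rw [← mul_div_assoc, le_div_iff₀ hτ, h5]
            have : inner ℝ e θ ≤ 1 := by
              have := real_inner_le_norm e θ
              rwa [hθ, he1, one_mul] at this
            nlinarith
          have h7 : (2 * √(s / τ)) ^ 2 = 4 * (s / τ) := by
            rw [mul_pow, Real.sq_sqrt (by positivity)]; norm_num
          rw [← h7] at h6
          exact le_of_sq_le_sq h6 hρ.le
      _ ≤ _ := hcap e _ he1 hρ
      _ ≤ _ := by
          apply ENNReal.ofReal_le_ofReal
          have h8 : (√(s / τ)) ^ (N - 1) = (s / τ) ^ m := by
            rw [Real.sqrt_eq_rpow, ← Real.rpow_natCast, ← Real.rpow_mul (by positivity), hm,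
              Nat.cast_sub hN1]
            congr 1; push_cast; ring
          rw [mul_pow, h8]
          have : 0 ≤ V * 2 ^ m * (s / τ) ^ m := by positivity
          nlinarith

theorem lintegral_Ioo_rpow_le {b r : ℝ} (hb : 0 ≤ b) (hr : -1 < r) :
    ∫⁻ s in Ioo 0 b, ENNReal.ofReal (s ^ r) ≤ ENNReal.ofReal (b ^ (r + 1) / (r + 1)) := by
  have hint : IntervalIntegrable (fun x : ℝ => x ^ r) volume 0 b :=
    intervalIntegral.intervalIntegrable_rpow' hr
  have h1 : ∫ x in (0 : ℝ)..b, x ^ r = b ^ (r + 1) / (r + 1) := by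
    rw [integral_rpow (Or.inl hr), Real.zero_rpow (by linarith), sub_zero]
  rw [← h1, intervalIntegral.integral_of_le hb, ofReal_integral_eq_lintegral_ofReal
    ((intervalIntegrable_iff_integrableOn_Ioc_of_le hb).1 hint)]
  · exact lintegral_mono_set Ioo_subset_Ioc_self
  · refine (ae_restrict_iff' measurableSet_Ioc).2 (Filter.Eventually.of_forall fun x hx => ?_)
    exact Real.rpow_nonneg hx.1.le _

/-- Decay of the spherical mean of the plane waves `(τ - ⟪x, θ⟫)^{-α}`. -/
theorem exists_lintegral_phase_rpow_le (N : ℕ) [NeZero N] {α : ℝ}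
    (hα : ((N : ℝ) - 1) / 2 < α) :
    ∃ C : ℝ, 0 < C ∧ ∀ (x : EuclideanSpace ℝ (Fin N)) (τ : ℝ), ‖x‖ < τ →
      ∫⁻ θ, ENNReal.ofReal ((τ - inner ℝ x θ) ^ (-α)) ∂(sphereMeasure N) ≤
        ENNReal.ofReal (C * (τ ^ (-(((N : ℝ) - 1) / 2)) *
          (τ - ‖x‖) ^ (((N : ℝ) - 1) / 2 - α))) := by
  obtain ⟨C, hC, hph⟩ := exists_sphereMeasure_phase_lt_le N
  set m : ℝ := ((N : ℝ) - 1) / 2 with hm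
  have hm0 : 0 ≤ m := by
    have : (1 : ℝ) ≤ N := by exact_mod_cast (NeZero.one_le : 1 ≤ N)
    rw [hm]; linarith
  have hα0 : 0 < α := hm0.trans_lt hα
  have hr : -1 < -(m / α) := by
    have := (div_lt_one hα0).2 hα
    linarith
  have hr1 : 0 < -(m / α) + 1 := by linarith
  refine ⟨C / (-(m / α) + 1), by positivity, fun x τ hx => ?_⟩
  have hτ : 0 < τ := (norm_nonneg x).trans_lt hx
  set d : ℝ := τ - ‖x‖ with hd
  have hd0 : 0 < d := by rw [hd]; linarith
  have hlow : ∀ᵐ θ ∂(sphereMeasure N), d ≤ τ - inner ℝ x θ := by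
    filter_upwards [ae_norm_eq_one_sphereMeasure N] with θ hθ
    have := real_inner_le_norm x θ
    rw [hθ, mul_one] at this
    rw [hd]; linarith
  -- Layer cake formula. The set where phase^(-α) > s is the set where phase < s^(-1/α), of measure
  -- at most a constant times τ^(-m) s^(-m/α), and it is null for s ≥ d^(-α). The power s^(-m/α) is
  -- integrable at 0 because α > m.
  rw [lintegral_eq_lintegral_meas_lt]
  rotate_left
  · filter_upwards [hlow] with θ hθ
    exact Real.rpow_nonneg (hd0.le.trans hθ) _
  · fun_prop
  have hbound : ∀ s ∈ Ioi (0 : ℝ),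
      sphereMeasure N {θ | s < (τ - inner ℝ x θ) ^ (-α)} ≤
        (Ioo 0 (d ^ (-α))).indicator
          (fun s => ENNReal.ofReal (C * τ ^ (-m)) * ENNReal.ofReal (s ^ (-(m / α)))) s := by
    intro s hs
    have hs0 : (0 : ℝ) < s := hs
    rcases le_or_gt (d ^ (-α)) s with h | h
    · have : sphereMeasure N {θ | s < (τ - inner ℝ x θ) ^ (-α)} = 0 := by
        refine measure_mono_null (fun θ hθ => ?_) hlow
        simp only [mem_ofPred_eq, mem_compl_iff, not_le] at hθ ⊢
        by_contra hcon
        push Not at hcon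
        have := Real.rpow_le_rpow_of_nonpos hd0 hcon (by linarith : -α ≤ 0)
        linarith
      rw [this]; exact zero_le
    · rw [indicator_of_mem (show s ∈ Ioo 0 (d ^ (-α)) from ⟨hs0, h⟩)]
      have hsub : sphereMeasure N {θ | s < (τ - inner ℝ x θ) ^ (-α)} ≤
          sphereMeasure N {θ | τ - inner ℝ x θ < s ^ (-(1 / α))} := by
        refine measure_mono_ae ?_
        filter_upwards [hlow] with θ hθ hlt
        change s < (τ - inner ℝ x θ) ^ (-α) at hlt
        change τ - inner ℝ x θ < s ^ (-(1 / α))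
        have hpos : 0 < τ - inner ℝ x θ := hd0.trans_le hθ
        have h1 := Real.rpow_lt_rpow_of_neg hs0 hlt (by
          have : 0 < 1 / α := by positivity
          linarith : -(1 / α) < 0)
        rw [← Real.rpow_mul hpos.le] at h1
        have : -α * -(1 / α) = 1 := by field_simp
        rwa [this, Real.rpow_one] at h1
      refine hsub.trans ((hph x τ _ hx (by positivity)).trans ?_)
      rw [← ENNReal.ofReal_mul (by positivity)]
      apply ENNReal.ofReal_le_ofReal
      rw [Real.div_rpow (by positivity) hτ.le, ← Real.rpow_mul hs0.le, Real.rpow_neg hτ.le]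
      have : -(1 / α) * m = -(m / α) := by ring
      rw [this]
      exact le_of_eq (by ring)
  refine (setLIntegral_mono' measurableSet_Ioi hbound).trans ?_
  rw [setLIntegral_indicator measurableSet_Ioo]
  refine (lintegral_mono_set inter_subset_left).trans ?_
  rw [lintegral_const_mul' _ _ ENNReal.ofReal_ne_top]
  refine (mul_le_mul_right (lintegral_Ioo_rpow_le (by positivity) hr) _).trans ?_
  rw [← ENNReal.ofReal_mul (by positivity)]
  apply ENNReal.ofReal_le_ofReal
  rw [← Real.rpow_mul hd0.le]
  have : -α * (-(m / α) + 1) = m - α := by field_simp; ring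
  rw [this]
  exact le_of_eq (by ring)

/-- Radial integrals over a ball with a weight that is singular just outside the ball. -/
theorem exists_lintegral_closedBall_rpow_le (N : ℕ) [NeZero N] :
    ∃ C : ℝ, 0 < C ∧ ∀ (κ τ : ℝ), 1 ≤ τ →
      ∫⁻ x in Metric.closedBall (0 : EuclideanSpace ℝ (Fin N)) (τ - 1),
        ENNReal.ofReal ((τ - ‖x‖) ^ (-κ)) ≤
        ENNReal.ofReal (C * (τ ^ ((N : ℝ) - 1) * ∫ s in (1 : ℝ)..τ, s ^ (-κ))) := by
  set V : ℝ := volume.real (Metric.ball (0 : EuclideanSpace ℝ (Fin N)) 1)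
  have hV : 0 < V := ENNReal.toReal_pos (Metric.measure_ball_pos _ _ one_pos).ne'
    measure_ball_lt_top.ne
  have hN1 : 1 ≤ N := NeZero.one_le
  have hN0 : (0 : ℝ) < N := by exact_mod_cast hN1
  refine ⟨N * V, by positivity, fun κ τ hτ => ?_⟩
  -- The radial profile is cut at τ - 1, away from its singularity at r = τ, so that polar
  -- coordinates apply to a function on the whole space.
  set f : ℝ → ℝ := (Iic (τ - 1)).indicator fun r => (τ - r) ^ (-κ)
  have hcont : ContinuousOn (fun r : ℝ => (τ - r) ^ (-κ)) (Icc 0 (τ - 1)) := by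
    intro r hr
    refine ContinuousAt.continuousWithinAt (ContinuousAt.rpow_const (by fun_prop) (Or.inl ?_))
    have := hr.2
    linarith
  have hfi : IntegrableOn (fun y : ℝ => y ^ (N - 1) • f y) (Ioi 0) := by
    have h1 : IntegrableOn (fun y : ℝ => y ^ (N - 1) • (τ - y) ^ (-κ)) (Icc 0 (τ - 1)) :=
      (ContinuousOn.smul (continuous_pow (N - 1)).continuousOn hcont).integrableOn_Icc
    have h2 : (fun y : ℝ => y ^ (N - 1) • f y) =
        (Iic (τ - 1)).indicator (fun y : ℝ => y ^ (N - 1) • (τ - y) ^ (-κ)) := by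
      ext y; by_cases hy : y ∈ Iic (τ - 1) <;> simp [f, hy]
    rw [h2, integrableOn_indicator_iff measurableSet_Iic]
    exact h1.mono_set (fun y hy => ⟨(le_of_lt hy.2), hy.1⟩)
  have hfi' : Integrable (fun x : EuclideanSpace ℝ (Fin N) => f ‖x‖) := by
    rw [integrable_fun_norm_addHaar, finrank_euclideanSpace_fin]
    exact hfi
  have hf0 : ∀ r, 0 ≤ f r := by
    intro r
    refine indicator_nonneg (fun r hr => Real.rpow_nonneg ?_ _) r
    have : r ≤ τ - 1 := hr
    linarith
  have heq : ∫⁻ x in Metric.closedBall (0 : EuclideanSpace ℝ (Fin N)) (τ - 1),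
        ENNReal.ofReal ((τ - ‖x‖) ^ (-κ)) = ∫⁻ x : EuclideanSpace ℝ (Fin N), ENNReal.ofReal (f ‖x‖) := by
    rw [← lintegral_indicator Metric.isClosed_closedBall.measurableSet]
    congr 1; ext x
    by_cases hx : ‖x‖ ≤ τ - 1
    · rw [indicator_of_mem (mem_closedBall_zero_iff.2 hx)]
      simp only [f]
      rw [indicator_of_mem (show ‖x‖ ∈ Iic (τ - 1) from hx)]
    · rw [indicator_of_notMem (fun h => hx (mem_closedBall_zero_iff.1 h))]
      simp only [f]
      rw [indicator_of_notMem (show ‖x‖ ∉ Iic (τ - 1) from hx), ENNReal.ofReal_zero]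
  rw [heq, ← ofReal_integral_eq_lintegral_ofReal hfi' (Filter.Eventually.of_forall fun x => hf0 _),
    integral_fun_norm_addHaar, finrank_euclideanSpace_fin]
  apply ENNReal.ofReal_le_ofReal
  rw [nsmul_eq_mul, smul_eq_mul, ← mul_assoc]
  refine mul_le_mul_of_nonneg_left ?_ (by positivity)
  -- The variable s = τ - r is the distance to the singular sphere. The Jacobian r^(N-1) is bounded
  -- by τ^(N-1) below.
  have hsub : ∫ s in (1 : ℝ)..τ, s ^ (-κ) = ∫ y in (0 : ℝ)..(τ - 1), (τ - y) ^ (-κ) := by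
    rw [intervalIntegral.integral_comp_sub_left (fun s => s ^ (-κ)) τ]
    congr 1 <;> ring
  rw [hsub, intervalIntegral.integral_of_le (by linarith), ← integral_const_mul,
    ← integral_indicator measurableSet_Ioi, ← integral_indicator measurableSet_Ioc]
  apply integral_mono
  · exact (integrable_indicator_iff measurableSet_Ioi).2 hfi
  · refine (integrable_indicator_iff measurableSet_Ioc).2 ?_
    exact (hcont.integrableOn_Icc.mono_set Ioc_subset_Icc_self).const_mul _
  · intro y
    by_cases hy : y ∈ Ioc 0 (τ - 1)
    · rw [indicator_of_mem hy, indicator_of_mem (show y ∈ Ioi 0 from hy.1)]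
      simp only [f]
      rw [indicator_of_mem (show y ∈ Iic (τ - 1) from hy.2), smul_eq_mul]
      refine mul_le_mul_of_nonneg_right ?_ (Real.rpow_nonneg (by linarith [hy.2]) _)
      rw [← Real.rpow_natCast, Nat.cast_sub hN1, Nat.cast_one]
      refine Real.rpow_le_rpow hy.1.le (by linarith [hy.2]) ?_
      have : (1 : ℝ) ≤ N := by exact_mod_cast hN1
      linarith
    · rw [indicator_of_notMem hy]
      by_cases hy0 : y ∈ Ioi (0 : ℝ)
      · rw [indicator_of_mem hy0]
        simp only [f]
        rw [indicator_of_notMem (fun h : y ∈ Iic (τ - 1) => hy ⟨hy0, h⟩)]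
        simp
      · rw [indicator_of_notMem hy0]

/-! ### Test functions as curves in L² and the weak formulation with all derivatives on the test
function -/

theorem HasCompactSupport.comp_prodMk_right {X : Type*} [TopologicalSpace X] [T2Space X]
    {Ψ : X × ℝ → ℝ}
    (hc : HasCompactSupport Ψ) (t : ℝ) : HasCompactSupport (fun x => Ψ (x, t)) := by
  refine HasCompactSupport.intro (hc.isCompact.image continuous_fst) (fun x hx => ?_)
  by_contra h
  exact hx ⟨(x, t), subset_tsupport _ h, rfl⟩

theorem memLp_slice {N : ℕ} {Ψ : EuclideanSpace ℝ (Fin N) × ℝ → ℝ} (hΨ : Continuous Ψ)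
    (hc : HasCompactSupport Ψ) (t : ℝ) : MemLp (fun x => Ψ (x, t)) 2 volume :=
  Continuous.memLp_of_hasCompactSupport (by fun_prop) (hc.comp_prodMk_right t)

/-- The time slices of a continuous compactly supported function, as a curve in `L²`. -/
def sliceLp {N : ℕ} {Ψ : EuclideanSpace ℝ (Fin N) × ℝ → ℝ} (hΨ : Continuous Ψ)
    (hc : HasCompactSupport Ψ) (t : ℝ) :
    Lp ℝ 2 (volume : Measure (EuclideanSpace ℝ (Fin N))) :=
  (memLp_slice hΨ hc t).toLp _

theorem norm_toLp_le_of_abs_le_of_eq_zero {X : Type*} [MeasurableSpace X] {μ : Measure X}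
    {f : X → ℝ} (hf : MemLp f 2 μ) {K : Set X} (hμ : μ K ≠ ⊤) {M : ℝ}
    (hM : ∀ x, |f x| ≤ M) (h0 : ∀ x, x ∉ K → f x = 0) (hM0 : 0 ≤ M) :
    ‖hf.toLp f‖ ≤ M * (μ K ^ (1 / (2 : ENNReal).toReal)).toReal := by
  rw [Lp.norm_toLp]
  have h1 : eLpNorm f 2 μ ≤ eLpNorm (K.indicator fun _ => M) 2 μ := by
    refine eLpNorm_mono fun x => ?_
    by_cases hx : x ∈ K
    · rw [indicator_of_mem hx, Real.norm_eq_abs, Real.norm_eq_abs, abs_of_nonneg hM0]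
      exact hM x
    · rw [h0 x hx, norm_zero]; exact norm_nonneg _
  have h2 := h1.trans (eLpNorm_indicator_const_le (μ := μ) (s := K) M 2)
  refine (ENNReal.toReal_mono ?_ h2).trans (le_of_eq ?_)
  · exact ENNReal.mul_ne_top enorm_ne_top (ENNReal.rpow_ne_top_of_nonneg (by simp) hμ)
  · rw [ENNReal.toReal_mul, toReal_enorm, Real.norm_eq_abs, abs_of_nonneg hM0]

theorem contDiff_fderiv_apply {E : Type*} [NormedAddCommGroup E] [NormedSpace ℝ E]
    {Ψ : E → ℝ} (hΨ : ContDiff ℝ ∞ Ψ) (v : E) : ContDiff ℝ ∞ (fun z => fderiv ℝ Ψ z v) :=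
  (hΨ.fderiv_right (m := ∞) (by exact_mod_cast le_rfl)).clm_apply contDiff_const

theorem hasDerivAt_slice_time {E : Type*} [NormedAddCommGroup E] [NormedSpace ℝ E]
    {Ψ : E × ℝ → ℝ} (hΨ : ContDiff ℝ ∞ Ψ) (x : E) (t : ℝ) :
    HasDerivAt (fun s => Ψ (x, s)) (fderiv ℝ Ψ (x, t) (0, 1)) t := by
  have h1 : HasFDerivAt Ψ (fderiv ℝ Ψ (x, t)) (x, t) :=
    (hΨ.differentiable (by simp) _).hasFDerivAt
  have h2 : HasDerivAt (fun s : ℝ => (x, s)) ((0 : E), (1 : ℝ)) t :=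
    (hasDerivAt_const t x).prodMk (hasDerivAt_id t)
  exact h1.comp_hasDerivAt t h2

/-- The mean value inequality is applied twice, first to the time derivative and then to the
remainder. The bound is uniform in x, as differentiability of the slices in L² requires. -/
theorem abs_taylor_time_le {E : Type*} [NormedAddCommGroup E] [NormedSpace ℝ E]
    {Ψ : E × ℝ → ℝ} (hΨ : ContDiff ℝ ∞ Ψ) {M : ℝ}
    (hM : ∀ z, ‖fderiv ℝ (fun z => fderiv ℝ Ψ z (0, 1)) z (0, 1)‖ ≤ M) (x : E) (s t : ℝ) :
    |Ψ (x, s) - Ψ (x, t) - (s - t) * fderiv ℝ Ψ (x, t) (0, 1)| ≤ M * ‖s - t‖ ^ 2 := by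
  have hΨ1 := contDiff_fderiv_apply hΨ ((0 : E), (1 : ℝ))
  have hM0 : 0 ≤ M := (norm_nonneg _).trans (hM (x, t))
  have h1 : ∀ r, ‖fderiv ℝ Ψ (x, r) (0, 1) - fderiv ℝ Ψ (x, t) (0, 1)‖ ≤ M * ‖r - t‖ := by
    intro r
    exact convex_univ.norm_image_sub_le_of_norm_hasDerivWithin_le
      (fun r _ => (hasDerivAt_slice_time hΨ1 x r).hasDerivWithinAt) (fun r _ => hM _)
      (mem_univ t) (mem_univ r)
  have h2 := (convex_closedBall t ‖s - t‖).norm_image_sub_le_of_norm_hasDerivWithin_le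
    (f := fun r => Ψ (x, r) - (r - t) * fderiv ℝ Ψ (x, t) (0, 1))
    (f' := fun r => fderiv ℝ Ψ (x, r) (0, 1) - fderiv ℝ Ψ (x, t) (0, 1))
    (C := M * ‖s - t‖) (x := t) (y := s)
    (fun r _ => by
      have := (hasDerivAt_slice_time hΨ x r).fun_sub
        (((hasDerivAt_id r).sub_const t).mul_const (fderiv ℝ Ψ (x, t) (0, 1)))
      simpa using this.hasDerivWithinAt)
    (fun r hr => (h1 r).trans (by
      rw [Metric.mem_closedBall, dist_eq_norm] at hr
      gcongr))
    (Metric.mem_closedBall_self (norm_nonneg _))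
    (by rw [Metric.mem_closedBall, dist_eq_norm])
  rw [← Real.norm_eq_abs]
  calc _ = _ := by
        congr 1
        simp only [sub_self, zero_mul, sub_zero]
        ring
    _ ≤ _ := h2
    _ = _ := by ring

/-- The Taylor remainder is O((s - t)²) uniformly in x and vanishes off a fixed compact set, hence
it is O((s - t)²) in L². -/
theorem hasDerivAt_sliceLp {N : ℕ} {Ψ : EuclideanSpace ℝ (Fin N) × ℝ → ℝ}
    (hΨ : ContDiff ℝ ∞ Ψ) (hc : HasCompactSupport Ψ) (t : ℝ) :
    HasDerivAt (sliceLp hΨ.continuous hc)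
      (sliceLp (contDiff_fderiv_apply hΨ (0, 1)).continuous (hc.fderiv_apply ℝ (0, 1)) t) t := by
  have hΨ1 := contDiff_fderiv_apply hΨ ((0 : EuclideanSpace ℝ (Fin N)), (1 : ℝ))
  have hc1 := hc.fderiv_apply ℝ ((0 : EuclideanSpace ℝ (Fin N)), (1 : ℝ))
  have hΨ2 := contDiff_fderiv_apply hΨ1 ((0 : EuclideanSpace ℝ (Fin N)), (1 : ℝ))
  have hc2 := hc1.fderiv_apply ℝ ((0 : EuclideanSpace ℝ (Fin N)), (1 : ℝ))
  obtain ⟨M, hM⟩ := hc2.exists_bound_of_continuous hΨ2.continuous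
  have hM0 : 0 ≤ M := (norm_nonneg _).trans (hM 0)
  set K : Set (EuclideanSpace ℝ (Fin N)) := Prod.fst '' tsupport Ψ
  have hK : volume K ≠ ⊤ := (hc.isCompact.image continuous_fst).measure_lt_top.ne
  have hoff : ∀ x ∉ K, ∀ s, Ψ (x, s) = 0 ∧ fderiv ℝ Ψ (x, s) (0, 1) = 0 := by
    intro x hx s
    have hn : (x, s) ∉ tsupport Ψ := fun h => hx ⟨_, h, rfl⟩
    refine ⟨image_eq_zero_of_notMem_tsupport hn, ?_⟩
    rw [fderiv_of_notMem_tsupport ℝ hn]; rfl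
  rw [hasDerivAt_iff_isLittleO]
  refine Asymptotics.IsBigO.trans_isLittleO (g := fun s => ‖s - t‖ ^ 2) ?_
    (Asymptotics.isLittleO_pow_sub_sub t one_lt_two)
  refine Asymptotics.IsBigO.of_bound (M * (volume K ^ (1 / (2 : ENNReal).toReal)).toReal)
    (Filter.Eventually.of_forall fun s => ?_)
  have hrw : sliceLp hΨ.continuous hc s - sliceLp hΨ.continuous hc t -
      (s - t) • sliceLp hΨ1.continuous hc1 t =
      (((memLp_slice hΨ.continuous hc s).sub (memLp_slice hΨ.continuous hc t)).sub
        ((memLp_slice hΨ1.continuous hc1 t).const_smul (s - t))).toLp _ := rfl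
  rw [hrw]
  refine (norm_toLp_le_of_abs_le_of_eq_zero _ hK (M := M * ‖s - t‖ ^ 2)
    (fun x => abs_taylor_time_le hΨ hM x s t) (fun x hx => ?_) (by positivity)).trans
    (le_of_eq ?_)
  · simp [hoff x hx]
  · rw [norm_pow, norm_norm]; ring

theorem integral_mul_slice {N : ℕ} {Ψ : EuclideanSpace ℝ (Fin N) × ℝ → ℝ} (hΨ : Continuous Ψ)
    (hc : HasCompactSupport Ψ) (t : ℝ) (v : Lp ℝ 2 (volume : Measure (EuclideanSpace ℝ (Fin N)))) :
    Integrable (fun x => v x * Ψ (x, t)) ∧ ∫ x, v x * Ψ (x, t) = inner ℝ v (sliceLp hΨ hc t) := by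
  have hae : (fun x => inner ℝ (v x) (sliceLp hΨ hc t x)) =ᵐ[volume] fun x => v x * Ψ (x, t) := by
    filter_upwards [(memLp_slice hΨ hc t).coeFn_toLp] with x hx
    rw [sliceLp, hx]; simp [mul_comm]
  refine ⟨(L2.integrable_inner v (sliceLp hΨ hc t)).congr hae, ?_⟩
  rw [L2.inner_def]
  exact (integral_congr_ae hae).symm

/-- Integration by parts in space: the weak gradient against the gradient of a test function. -/
theorem IsWeakGradient.integral_inner_gradient {N : ℕ}
    {v : Lp ℝ 2 (volume : Measure (EuclideanSpace ℝ (Fin N)))}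
    {w : Lp (EuclideanSpace ℝ (Fin N)) 2 (volume : Measure (EuclideanSpace ℝ (Fin N)))}
    (h : IsWeakGradient v w) {φ : EuclideanSpace ℝ (Fin N) → ℝ} (hφ : ContDiff ℝ ∞ φ)
    (hc : HasCompactSupport φ) :
    Integrable (fun x => inner ℝ (w x) (gradient φ x)) ∧
    ∫ x, inner ℝ (w x) (gradient φ x) = -∫ x, v x * ∑ i, fderiv ℝ
      (fun y => fderiv ℝ φ y (EuclideanSpace.single i 1)) x (EuclideanSpace.single i 1) := by
  set d : Fin N → EuclideanSpace ℝ (Fin N) → ℝ :=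
    fun i y => fderiv ℝ φ y (EuclideanSpace.single i 1) with hd
  have hdC : ∀ i, ContDiff ℝ ∞ (d i) := fun i => contDiff_fderiv_apply hφ _
  have hdc : ∀ i, HasCompactSupport (d i) := fun i => hc.fderiv_apply ℝ _
  have hcoord : ∀ (ξ : EuclideanSpace ℝ (Fin N) → ℝ) x i,
      gradient ξ x i = fderiv ℝ ξ x (EuclideanSpace.single i 1) := by
    intro ξ x i
    rw [← inner_gradient_left, EuclideanSpace.inner_single_right]
    simp
  have hdw : ∀ i, Integrable (fun x => d i x • w x) := fun i =>
    memLp_one_iff_integrable.1 ((Lp.memLp w).smul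
      ((hdC i).continuous.memLp_of_hasCompactSupport (p := 2) (hdc i)))
  have hgr : ∀ i, Integrable (fun x => v x • gradient (d i) x) := by
    intro i
    have hcont : Continuous (gradient (d i)) :=
      (InnerProductSpace.toDual ℝ _).symm.continuous.comp
        ((hdC i).continuous_fderiv (by simp))
    have hcs : HasCompactSupport (gradient (d i)) :=
      ((hdc i).fderiv ℝ).comp_left (g := (InnerProductSpace.toDual ℝ _).symm) (map_zero _)
    exact memLp_one_iff_integrable.1
      ((hcont.memLp_of_hasCompactSupport (p := 2) hcs).smul (Lp.memLp v))
  have hproj1 : ∀ i, Integrable (fun x => d i x * w x i) := fun i =>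
    ((EuclideanSpace.proj i : EuclideanSpace ℝ (Fin N) →L[ℝ] ℝ).integrable_comp (hdw i))
  have hproj2 : ∀ i, Integrable (fun x => v x * fderiv ℝ (d i) x (EuclideanSpace.single i 1)) := by
    intro i
    refine ((EuclideanSpace.proj i : EuclideanSpace ℝ (Fin N) →L[ℝ] ℝ).integrable_comp
      (hgr i)).congr (Filter.Eventually.of_forall fun x => ?_)
    change v x * gradient (d i) x i = _
    rw [hcoord]
  -- The i-th component of the weak gradient identity, tested with ∂ᵢφ. Summing over i produces the
  -- Laplacian.
  have hkey : ∀ i, ∫ x, v x * fderiv ℝ (d i) x (EuclideanSpace.single i 1) =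
      -∫ x, d i x * w x i := by
    intro i
    have h1 := congrArg (EuclideanSpace.proj i : EuclideanSpace ℝ (Fin N) →L[ℝ] ℝ)
      (h (d i) (hdC i) (hdc i))
    rw [map_neg, ← ContinuousLinearMap.integral_comp_comm _ (hgr i),
      ← ContinuousLinearMap.integral_comp_comm _ (hdw i)] at h1
    calc _ = ∫ x, (EuclideanSpace.proj i : EuclideanSpace ℝ (Fin N) →L[ℝ] ℝ)
          (v x • gradient (d i) x) := by
          congr 1; ext x
          change _ = v x * gradient (d i) x i
          rw [hcoord]
      _ = _ := h1
  have hinner : ∀ x, inner ℝ (w x) (gradient φ x) = ∑ i, d i x * w x i := by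
    intro x
    rw [PiLp.inner_apply]
    refine Finset.sum_congr rfl fun i _ => ?_
    rw [hcoord]; simp [hd]
  simp only [hinner]
  refine ⟨integrable_finsetSum _ fun i _ => hproj1 i, ?_⟩
  rw [integral_finsetSum _ fun i _ => hproj1 i]
  simp only [Finset.mul_sum]
  rw [integral_finsetSum _ fun i _ => hproj2 i, ← Finset.sum_neg_distrib]
  refine Finset.sum_congr rfl fun i _ => ?_
  rw [hkey, neg_neg]

theorem measurableSet_timeInterval (T : EReal) : MeasurableSet (timeInterval T) :=
  (measurableSet_le measurable_const measurable_id).inter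
    (measurableSet_lt measurable_coe_real_ereal measurable_const)

theorem Icc_subset_timeInterval {T : EReal} {R : ℝ} (hR : (R : EReal) < T) :
    Icc 0 R ⊆ timeInterval T := fun _ ht =>
  ⟨ht.1, (EReal.coe_le_coe_iff.2 ht.2).trans_lt hR⟩

/-- A function on `[0,T)` that vanishes after time `R < T`. -/
theorem setIntegral_timeInterval_eq_intervalIntegral {T : EReal} {R : ℝ} (h0 : 0 ≤ R)
    (hR : (R : EReal) < T)
    {F : ℝ → ℝ} (hF : ∀ t, R < t → F t = 0) :
    ∫ t in timeInterval T, F t = ∫ t in (0 : ℝ)..R, F t := by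
  rw [intervalIntegral.integral_of_le h0, ← integral_Icc_eq_integral_Ioc]
  refine (setIntegral_eq_of_subset_of_forall_sdiff_eq_zero (measurableSet_timeInterval T)
    (Icc_subset_timeInterval hR) fun t ht => hF t ?_)
  by_contra hcon
  exact ht.2 ⟨ht.1.1, not_lt.1 hcon⟩

/-- Integration by parts in time. -/
theorem integral_inner_deriv_eq_neg {H : Type*} [NormedAddCommGroup H] [InnerProductSpace ℝ H]
    {T : EReal} {R : ℝ} (h0 : 0 ≤ R) (hR : (R : EReal) < T) {U V P P' : ℝ → H}
    (hV : ContinuousOn V (timeInterval T))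
    (hU : ∀ t ∈ timeInterval T, HasDerivWithinAt U (V t) (timeInterval T) t)
    (hP : ∀ t, HasDerivAt P (P' t) t) (hP' : Continuous P') (hPR : P R = 0) :
    ∫ t in (0 : ℝ)..R, (inner ℝ (U t) (P' t) + inner ℝ (V t) (P t)) = -inner ℝ (U 0) (P 0) := by
  have hsub := Icc_subset_timeInterval hR
  have hder : ∀ t ∈ timeInterval T, HasDerivWithinAt (fun t => (inner ℝ (U t) (P t) : ℝ))
      (inner ℝ (U t) (P' t) + inner ℝ (V t) (P t)) (timeInterval T) t := fun t ht =>
    (hU t ht).inner ℝ (hP t).hasDerivWithinAt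
  have hPc : Continuous P := continuous_iff_continuousAt.2 fun t => (hP t).continuousAt
  have hUc : ContinuousOn U (timeInterval T) := fun t ht => (hU t ht).continuousWithinAt
  have hcont : ContinuousOn (fun t => (inner ℝ (U t) (P' t) + inner ℝ (V t) (P t) : ℝ))
      (Icc 0 R) :=
    ((hUc.mono hsub).inner hP'.continuousOn).add ((hV.mono hsub).inner hPc.continuousOn)
  rw [intervalIntegral.integral_eq_sub_of_hasDeriv_right_of_le h0
    (f := fun t => (inner ℝ (U t) (P t) : ℝ))
    (fun t ht => ((hder t (hsub ht)).mono hsub).continuousWithinAt) (fun t ht => ?_)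
    (hcont.intervalIntegrable_of_Icc h0)]
  · simp [hPR]
  · have hnhds : Icc 0 R ∈ nhdsWithin t (Ioi t) :=
      mem_nhdsWithin_of_mem_nhds (Icc_mem_nhds ht.1 ht.2)
    exact ((hder t (hsub (Ioo_subset_Icc_self ht))).mono hsub).mono_of_mem_nhdsWithin hnhds

theorem continuous_sliceLp {N : ℕ} {Ψ : EuclideanSpace ℝ (Fin N) × ℝ → ℝ}
    (hΨ : ContDiff ℝ ∞ Ψ) (hc : HasCompactSupport Ψ) : Continuous (sliceLp hΨ.continuous hc) :=
  continuous_iff_continuousAt.2 fun t => (hasDerivAt_sliceLp hΨ hc t).continuousAt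

theorem sliceLp_eq_zero {N : ℕ} {Ψ : EuclideanSpace ℝ (Fin N) × ℝ → ℝ}
    (hΨ : Continuous Ψ) (hc : HasCompactSupport Ψ) {t : ℝ} (h : ∀ x, Ψ (x, t) = 0) :
    sliceLp hΨ hc t = 0 := by
  have : (memLp_slice hΨ hc t).toLp (fun x => Ψ (x, t)) =
      (memLp_slice hΨ hc t).toLp (fun x => Ψ (x, t)) - (memLp_slice hΨ hc t).toLp (fun x => Ψ (x, t)) := by
    rw [← MemLp.toLp_sub]
    refine MemLp.toLp_congr _ _ (Filter.Eventually.of_forall fun x => ?_)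
    simp [h x]
  rw [sliceLp, this, sub_self]

/-- The second derivative in space-time in the direction `v`. -/
def secondDeriv {E : Type*} [NormedAddCommGroup E] [NormedSpace ℝ E] (Ψ : E → ℝ) (v z : E) : ℝ :=
  fderiv ℝ (fun z => fderiv ℝ Ψ z v) z v

/-- The wave operator `∂ₜ² - Δ`. -/
def waveOp {N : ℕ} (Ψ : EuclideanSpace ℝ (Fin N) × ℝ → ℝ)
    (z : EuclideanSpace ℝ (Fin N) × ℝ) : ℝ :=
  secondDeriv Ψ (0, 1) z - ∑ i, secondDeriv Ψ (EuclideanSpace.single i 1, 0) z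

theorem contDiff_secondDeriv {E : Type*} [NormedAddCommGroup E] [NormedSpace ℝ E] {Ψ : E → ℝ}
    (hΨ : ContDiff ℝ ∞ Ψ) (v : E) : ContDiff ℝ ∞ (secondDeriv Ψ v) :=
  contDiff_fderiv_apply (contDiff_fderiv_apply hΨ v) v

theorem hasCompactSupport_secondDeriv {E : Type*} [NormedAddCommGroup E] [NormedSpace ℝ E]
    {Ψ : E → ℝ} (hc : HasCompactSupport Ψ) (v : E) : HasCompactSupport (secondDeriv Ψ v) :=
  (hc.fderiv_apply ℝ v).fderiv_apply ℝ v

theorem fderiv_slice_space {N : ℕ} {Ψ : EuclideanSpace ℝ (Fin N) × ℝ → ℝ}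
    (hΨ : ContDiff ℝ ∞ Ψ) (x v : EuclideanSpace ℝ (Fin N)) (t : ℝ) :
    fderiv ℝ (fun y => Ψ (y, t)) x v = fderiv ℝ Ψ (x, t) (v, 0) := by
  have h1 : HasFDerivAt Ψ (fderiv ℝ Ψ (x, t)) (x, t) :=
    (hΨ.differentiable (by simp) _).hasFDerivAt
  have h2 : HasFDerivAt (fun y => (y, t)) _ x := (hasFDerivAt_id (𝕜 := ℝ) x).prodMk (hasFDerivAt_const t x)
  have h3 : HasFDerivAt (fun y => Ψ (y, t)) _ x := h1.comp x h2
  rw [h3.fderiv]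
  rfl

/-- The weak formulation with all derivatives on the test function. -/
theorem IsWeakSolution.integral_waveOp {N : ℕ} {G : ℝ → ℝ} {f g : EuclideanSpace ℝ (Fin N) → ℝ}
    {ε : ℝ} {T : EReal} {u : EuclideanSpace ℝ (Fin N) → ℝ → ℝ} (h : IsWeakSolution G f g ε T u)
    {Ψ : EuclideanSpace ℝ (Fin N) × ℝ → ℝ} (hΨ : ContDiff ℝ ∞ Ψ) (hc : HasCompactSupport Ψ)
    {R : ℝ} (h0 : 0 ≤ R) (hR : (R : EReal) < T) (hs : ∀ z : EuclideanSpace ℝ (Fin N) × ℝ,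
      R ≤ z.2 → Ψ z = 0) :
    ε * (∫ x, g x * Ψ (x, 0)) - ε * (∫ x, f x * fderiv ℝ Ψ (x, 0) (0, 1)) +
        ∫ t in timeInterval T, ∫ x, G (u x t) * Ψ (x, t) =
      ∫ t in timeInterval T, ∫ x, u x t * waveOp Ψ (x, t) := by
  obtain ⟨-, -, U, V, W, huU, hUc, hVc, hWc, hUV, hUW, hU0, hV0, hweak⟩ := h
  have hts : ∀ z ∈ tsupport Ψ, z.2 ≤ R := by
    have hsub : Function.support Ψ ⊆ {z | z.2 ≤ R} := by
      intro z hz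
      by_contra hcon
      exact hz (hs z (le_of_lt (not_le.1 hcon)))
    exact closure_minimal hsub (isClosed_le continuous_snd continuous_const)
  have htest : IsTestFunction T (fun x t => Ψ (x, t)) :=
    ⟨hΨ, hc, fun z hz => (EReal.coe_le_coe_iff.2 (hts z hz)).trans_lt hR⟩
  have hw := hweak _ htest
  set vt : EuclideanSpace ℝ (Fin N) × ℝ := (0, 1) with hvt
  have hΨ1 := contDiff_fderiv_apply hΨ vt
  have hc1 := hc.fderiv_apply ℝ vt
  have hΨ2 := contDiff_secondDeriv hΨ vt
  have hc2 := hasCompactSupport_secondDeriv hc vt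
  set Q : EuclideanSpace ℝ (Fin N) × ℝ → ℝ := fun z =>
    ∑ i, secondDeriv Ψ (EuclideanSpace.single i 1, 0) z with hQ
  have hQC : ContDiff ℝ ∞ Q := ContDiff.sum fun i _ => contDiff_secondDeriv hΨ _
  have hQc : HasCompactSupport Q := by
    refine HasCompactSupport.intro hc.isCompact fun z hz => ?_
    refine Finset.sum_eq_zero fun i _ => ?_
    refine image_eq_zero_of_notMem_tsupport fun h => hz ?_
    exact (tsupport_fderiv_apply_subset ℝ _).trans (tsupport_fderiv_apply_subset ℝ _) h
  -- vanishing at and after time `R`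
  have hzero1 : ∀ z : EuclideanSpace ℝ (Fin N) × ℝ, R < z.2 → z ∉ tsupport Ψ := fun z hz h =>
    absurd (hts z h) (not_le.2 hz)
  have hd1 : ∀ v z, R < z.2 → fderiv ℝ Ψ z v = 0 := fun v z hz =>
    image_eq_zero_of_notMem_tsupport (f := fun z => fderiv ℝ Ψ z v) fun h =>
      hzero1 z hz (tsupport_fderiv_apply_subset ℝ v h)
  -- The integration by parts in time has a boundary term at R itself, where the derivative vanishes
  -- by continuity from the right.
  have hd1R : ∀ x, fderiv ℝ Ψ (x, R) vt = 0 := by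
    intro x
    have hcl : IsClosed {t : ℝ | fderiv ℝ Ψ (x, t) vt = 0} :=
      isClosed_eq (hΨ1.continuous.comp (by fun_prop)) continuous_const
    have : Ioi R ⊆ {t : ℝ | fderiv ℝ Ψ (x, t) vt = 0} := fun t ht => hd1 _ _ ht
    have h2 := closure_minimal this hcl
    rw [closure_Ioi] at h2
    exact h2 self_mem_Ici
  have hd2 : ∀ v z, R < z.2 → secondDeriv Ψ v z = 0 := fun v z hz =>
    image_eq_zero_of_notMem_tsupport fun h => hzero1 z hz
      ((tsupport_fderiv_apply_subset ℝ _).trans (tsupport_fderiv_apply_subset ℝ _) h)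
  -- At fixed time the gradient term becomes minus the pairing of u with the Laplacian of Ψ, and
  -- every space integral becomes an inner product in L².
  have hspace : ∀ t ∈ timeInterval T, ∫ x, (-(V t x * deriv (fun s => Ψ (x, s)) t)
      + inner ℝ (W t x) (gradient (fun y => Ψ (y, t)) x)) =
      -inner ℝ (V t) (sliceLp hΨ1.continuous hc1 t) - inner ℝ (U t) (sliceLp hQC.continuous hQc t) := by
    intro t ht
    have h1 := integral_mul_slice hΨ1.continuous hc1 t (V t)
    have h2 := (hUW t ht).integral_inner_gradient (φ := fun y => Ψ (y, t))
      (hΨ.comp (by fun_prop : ContDiff ℝ ∞ fun y : EuclideanSpace ℝ (Fin N) => (y, t)))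
      (hc.comp_prodMk_right t)
    have h3 := integral_mul_slice hQC.continuous hQc t (U t)
    have hder : ∀ x, deriv (fun s => Ψ (x, s)) t = fderiv ℝ Ψ (x, t) vt := fun x =>
      (hasDerivAt_slice_time hΨ x t).deriv
    have hlap : ∀ x, ∑ i, fderiv ℝ (fun y => fderiv ℝ (fun y => Ψ (y, t)) y
        (EuclideanSpace.single i 1)) x (EuclideanSpace.single i 1) = Q (x, t) := by
      intro x
      refine Finset.sum_congr rfl fun i _ => ?_
      have : (fun y => fderiv ℝ (fun y => Ψ (y, t)) y (EuclideanSpace.single i 1)) =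
          fun y => (fun z => fderiv ℝ Ψ z (EuclideanSpace.single i 1, 0)) (y, t) := by
        ext y; exact fderiv_slice_space hΨ y _ t
      rw [this, fderiv_slice_space (contDiff_fderiv_apply hΨ _)]
      rfl
    simp only [hlap] at h2
    simp only [hder]
    rw [integral_add (f := fun x => -(V t x * fderiv ℝ Ψ (x, t) vt)) h1.1.neg h2.1, integral_neg, h1.2, h2.2, h3.2]
    ring
  rw [setIntegral_congr_fun (measurableSet_timeInterval T) hspace] at hw
  -- Moving the time derivative from `V` to `∂ₜΨ` leaves the boundary term at t = 0, the source of
  -- the f-term in the identity.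
  have hparts : ∫ t in (0 : ℝ)..R, ((inner ℝ (U t) (sliceLp hΨ2.continuous hc2 t) : ℝ) +
      inner ℝ (V t) (sliceLp hΨ1.continuous hc1 t)) =
      -inner ℝ (U 0) (sliceLp hΨ1.continuous hc1 0) := integral_inner_deriv_eq_neg h0 hR hVc hUV (hasDerivAt_sliceLp hΨ1 hc1)
    (continuous_sliceLp hΨ2 hc2) (sliceLp_eq_zero hΨ1.continuous hc1 hd1R)
  have hsub := Icc_subset_timeInterval hR
  have hi1 : IntervalIntegrable (fun t => (inner ℝ (U t) (sliceLp hΨ2.continuous hc2 t) : ℝ))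
      volume 0 R :=
    ((hUc.mono hsub).inner (continuous_sliceLp hΨ2 hc2).continuousOn).intervalIntegrable_of_Icc h0
  have hi2 : IntervalIntegrable (fun t => (inner ℝ (V t) (sliceLp hΨ1.continuous hc1 t) : ℝ))
      volume 0 R :=
    ((hVc.mono hsub).inner (continuous_sliceLp hΨ1 hc1).continuousOn).intervalIntegrable_of_Icc h0
  have hi3 : IntervalIntegrable (fun t => (inner ℝ (U t) (sliceLp hQC.continuous hQc t) : ℝ))
      volume 0 R :=
    ((hUc.mono hsub).inner (continuous_sliceLp hQC hQc).continuousOn).intervalIntegrable_of_Icc h0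
  have hQ0 : ∀ z, R < z.2 → Q z = 0 := fun z hz => Finset.sum_eq_zero fun i _ => hd2 _ z hz
  rw [setIntegral_timeInterval_eq_intervalIntegral h0 hR (F := fun t =>
      -inner ℝ (V t) (sliceLp hΨ1.continuous hc1 t) - inner ℝ (U t) (sliceLp hQC.continuous hQc t))
    (fun t ht => by
      rw [sliceLp_eq_zero hΨ1.continuous hc1 (fun x => hd1 vt (x, t) ht),
        sliceLp_eq_zero hQC.continuous hQc (fun x => hQ0 (x, t) ht)]
      simp), intervalIntegral.integral_sub
      (f := fun t => -(inner ℝ (V t) (sliceLp hΨ1.continuous hc1 t) : ℝ)) hi2.neg hi3, intervalIntegral.integral_neg] at hw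
  rw [intervalIntegral.integral_add hi1 hi2] at hparts
  have hT0 : (0 : ℝ) ∈ timeInterval T := hsub ⟨le_rfl, h0⟩
  have hinit : (inner ℝ (U 0) (sliceLp hΨ1.continuous hc1 0) : ℝ) =
      ε * ∫ x, f x * fderiv ℝ Ψ (x, 0) vt := by
    rw [← (integral_mul_slice hΨ1.continuous hc1 0 (U 0)).2, ← integral_const_mul]
    refine integral_congr_ae ?_
    filter_upwards [hU0] with x hx
    rw [hx]; ring
  have hrhs : ∫ t in timeInterval T, ∫ x, u x t * waveOp Ψ (x, t) =
      ∫ t in (0 : ℝ)..R, ((inner ℝ (U t) (sliceLp hΨ2.continuous hc2 t) : ℝ) -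
        inner ℝ (U t) (sliceLp hQC.continuous hQc t)) := by
    rw [← setIntegral_timeInterval_eq_intervalIntegral h0 hR (F := fun t =>
      ((inner ℝ (U t) (sliceLp hΨ2.continuous hc2 t) : ℝ) -
        inner ℝ (U t) (sliceLp hQC.continuous hQc t))) (fun t ht => by
        rw [sliceLp_eq_zero hΨ2.continuous hc2 (fun x => hd2 vt (x, t) ht),
          sliceLp_eq_zero hQC.continuous hQc (fun x => hQ0 (x, t) ht)]
        simp)]
    refine setIntegral_congr_fun (measurableSet_timeInterval T) fun t ht => ?_
    have h1 := integral_mul_slice hΨ2.continuous hc2 t (U t)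
    have h3 := integral_mul_slice hQC.continuous hQc t (U t)
    change _ = (inner ℝ (U t) (sliceLp hΨ2.continuous hc2 t) : ℝ) -
        inner ℝ (U t) (sliceLp hQC.continuous hQc t)
    rw [← h1.2, ← h3.2, ← integral_sub h1.1 h3.1]
    refine integral_congr_ae ?_
    filter_upwards [huU t ht] with x hx
    rw [hx, waveOp, mul_sub]
  rw [hrhs, intervalIntegral.integral_sub hi1 hi3]
  rw [hinit] at hparts
  linarith

/-! ### Testing the equation with cut-off plane waves -/

/-- The modulated plane wave `a(t) b(t - ⟪x, θ⟫)`. -/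
def planeWave {N : ℕ} (a b : ℝ → ℝ) (θ : EuclideanSpace ℝ (Fin N))
    (z : EuclideanSpace ℝ (Fin N) × ℝ) : ℝ :=
  a z.2 * b (z.2 - inner ℝ z.1 θ)

theorem contDiff_planeWave {N : ℕ} {a b : ℝ → ℝ} (ha : ContDiff ℝ ∞ a) (hb : ContDiff ℝ ∞ b)
    (θ : EuclideanSpace ℝ (Fin N)) : ContDiff ℝ ∞ (planeWave a b θ) :=
  (ha.comp contDiff_snd).mul
    (hb.comp (contDiff_snd.sub (contDiff_fst.inner ℝ contDiff_const)))

/-- Both sides are the derivative at 0 of the wave along the line s ↦ z + s v, which reduces the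
claim to one-variable calculus. -/
theorem fderiv_planeWave {N : ℕ} {a b : ℝ → ℝ} (ha : ContDiff ℝ ∞ a) (hb : ContDiff ℝ ∞ b)
    (θ : EuclideanSpace ℝ (Fin N)) (z v : EuclideanSpace ℝ (Fin N) × ℝ) :
    fderiv ℝ (planeWave a b θ) z v = v.2 * planeWave (deriv a) b θ z +
      (v.2 - inner ℝ v.1 θ) * planeWave a (deriv b) θ z := by
  have h1 : HasDerivAt a (deriv a z.2) z.2 := (ha.differentiable (by simp) _).hasDerivAt
  have h2 : HasDerivAt b (deriv b (z.2 - inner ℝ z.1 θ)) (z.2 - inner ℝ z.1 θ) :=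
    (hb.differentiable (by simp) _).hasDerivAt
  have hl : HasDerivAt (fun s : ℝ => z + s • v) v 0 := by
    simpa using ((hasDerivAt_id (0 : ℝ)).smul_const v).const_add z
  have hs : HasDerivAt (fun s : ℝ => (z + s • v).2) v.2 0 := by
    simpa using ((hasDerivAt_id (0 : ℝ)).mul_const v.2).const_add z.2
  have hp : HasDerivAt (fun s : ℝ => (z + s • v).2 - inner ℝ (z + s • v).1 θ)
      (v.2 - inner ℝ v.1 θ) 0 := by
    refine hs.sub ?_
    have : (fun s : ℝ => (inner ℝ (z + s • v).1 θ : ℝ)) =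
        fun s : ℝ => inner ℝ z.1 θ + s * inner ℝ v.1 θ := by
      ext s; simp [inner_add_left, real_inner_smul_left]
    rw [this]
    simpa using ((hasDerivAt_id (0 : ℝ)).mul_const (inner ℝ v.1 θ : ℝ)).const_add (inner ℝ z.1 θ : ℝ)
  have hz : z + (0 : ℝ) • v = z := by simp
  have hA : HasDerivAt (fun s : ℝ => planeWave a b θ (z + s • v))
      (deriv a z.2 * v.2 * b (z.2 - inner ℝ z.1 θ) +
        a z.2 * (deriv b (z.2 - inner ℝ z.1 θ) * (v.2 - inner ℝ v.1 θ))) 0 := by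
    have e1 := HasDerivAt.comp (0 : ℝ) (h₂ := a) (by rw [hz]; exact h1) hs
    have e2 := HasDerivAt.comp (0 : ℝ) (h₂ := b) (by rw [hz]; exact h2) hp
    have := e1.mul e2
    simp only [Function.comp, hz] at this
    exact this
  have hB : HasDerivAt (fun s : ℝ => planeWave a b θ (z + s • v))
      (fderiv ℝ (planeWave a b θ) z v) 0 := by
    have h3 : HasFDerivAt (planeWave a b θ) (fderiv ℝ (planeWave a b θ) z) (z + (0 : ℝ) • v) := by
      rw [hz]
      exact ((contDiff_planeWave ha hb θ).differentiable (by simp) _).hasFDerivAt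
    exact h3.comp_hasDerivAt (0 : ℝ) hl
  rw [hB.unique hA]
  simp only [planeWave]
  ring

theorem contDiff_deriv {a : ℝ → ℝ} (ha : ContDiff ℝ ∞ a) : ContDiff ℝ ∞ (deriv a) :=
  ((contDiff_succ_iff_deriv (n := ∞)).1 (by exact_mod_cast ha)).2.2

theorem secondDeriv_planeWave {N : ℕ} {a b : ℝ → ℝ} (ha : ContDiff ℝ ∞ a) (hb : ContDiff ℝ ∞ b)
    (θ : EuclideanSpace ℝ (Fin N)) (v z : EuclideanSpace ℝ (Fin N) × ℝ) :
    secondDeriv (planeWave a b θ) v z = v.2 ^ 2 * planeWave (deriv (deriv a)) b θ z +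
      2 * (v.2 * (v.2 - inner ℝ v.1 θ)) * planeWave (deriv a) (deriv b) θ z +
      (v.2 - inner ℝ v.1 θ) ^ 2 * planeWave a (deriv (deriv b)) θ z := by
  have ha' := contDiff_deriv ha
  have hb' := contDiff_deriv hb
  unfold secondDeriv
  have h1 : (fun z => fderiv ℝ (planeWave a b θ) z v) = fun z =>
      v.2 * planeWave (deriv a) b θ z + (v.2 - inner ℝ v.1 θ) * planeWave a (deriv b) θ z := by
    ext z; exact fderiv_planeWave ha hb θ z v
  have d1 := (contDiff_planeWave ha' hb θ).differentiable (by simp) z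
  have d2 := (contDiff_planeWave ha hb' θ).differentiable (by simp) z
  rw [h1, fderiv_fun_add (d1.const_mul _) (d2.const_mul _), fderiv_const_mul d1,
    fderiv_const_mul d2]
  simp only [add_apply, smul_apply, smul_eq_mul]
  rw [fderiv_planeWave ha' hb, fderiv_planeWave ha hb']
  ring

/-- For ‖θ‖ = 1 the function b(t - ⟪x,θ⟫) solves the wave equation, so the two terms with b'' cancel
and only terms with a derivative on the amplitude survive. -/
theorem waveOp_planeWave {N : ℕ} {a b : ℝ → ℝ} (ha : ContDiff ℝ ∞ a) (hb : ContDiff ℝ ∞ b)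
    {θ : EuclideanSpace ℝ (Fin N)} (hθ : ‖θ‖ = 1) (z : EuclideanSpace ℝ (Fin N) × ℝ) :
    waveOp (planeWave a b θ) z = planeWave (deriv (deriv a)) b θ z +
      2 * planeWave (deriv a) (deriv b) θ z := by
  have hsum : ∑ i, (θ i) ^ 2 = 1 := by
    rw [← EuclideanSpace.real_norm_sq_eq, hθ, one_pow]
  simp only [waveOp, secondDeriv_planeWave ha hb]
  have : ∀ i : Fin N, ((0 : ℝ) - inner ℝ (EuclideanSpace.single i (1 : ℝ)) θ) ^ 2 = θ i ^ 2 := by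
    intro i; rw [EuclideanSpace.inner_single_left]; simp
  simp only [this]
  simp only [zero_pow two_ne_zero, zero_mul, mul_zero, zero_add, inner_zero_left, ← Finset.sum_mul,
    hsum]
  ring

theorem secondDeriv_congr {E : Type*} [NormedAddCommGroup E] [NormedSpace ℝ E] {Ψ Φ : E → ℝ}
    {z : E} (h : Ψ =ᶠ[nhds z] Φ) (v : E) : secondDeriv Ψ v z = secondDeriv Φ v z := by
  unfold secondDeriv
  have : (fun z => fderiv ℝ Ψ z v) =ᶠ[nhds z] fun z => fderiv ℝ Φ z v :=
    (h.fderiv (𝕜 := ℝ)).fun_comp (fun L => L v)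
  rw [this.fderiv_eq]

theorem waveOp_congr {N : ℕ} {Ψ Φ : EuclideanSpace ℝ (Fin N) × ℝ → ℝ}
    {z : EuclideanSpace ℝ (Fin N) × ℝ} (h : Ψ =ᶠ[nhds z] Φ) : waveOp Ψ z = waveOp Φ z := by
  simp only [waveOp, secondDeriv_congr h]

theorem le_dataRadius {N : ℕ} {f g : EuclideanSpace ℝ (Fin N) → ℝ} (hf : HasCompactSupport f)
    (hg : HasCompactSupport g) {x : EuclideanSpace ℝ (Fin N)} (hx : x ∈ tsupport f ∪ tsupport g) :
    ‖x‖ ≤ dataRadius f g :=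
  le_csSup ((hf.isCompact.union hg.isCompact).image continuous_norm).bddAbove ⟨x, hx, rfl⟩

theorem dataRadius_nonneg {N : ℕ} (f g : EuclideanSpace ℝ (Fin N) → ℝ) : 0 ≤ dataRadius f g :=
  Real.sSup_nonneg (by rintro _ ⟨x, -, rfl⟩; exact norm_nonneg x)

theorem eq_zero_of_dataRadius_lt {N : ℕ} {f g : EuclideanSpace ℝ (Fin N) → ℝ}
    (hf : HasCompactSupport f) (hg : HasCompactSupport g) {x : EuclideanSpace ℝ (Fin N)}
    (hx : dataRadius f g < ‖x‖) : f x = 0 ∧ g x = 0 :=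
  ⟨image_eq_zero_of_notMem_tsupport fun h => absurd (le_dataRadius hf hg (Or.inl h)) (not_le.2 hx),
    image_eq_zero_of_notMem_tsupport fun h => absurd (le_dataRadius hf hg (Or.inr h)) (not_le.2 hx)⟩

/-- The part of the forward light cone over the ball of radius `r` lying in `[0,T)`. -/
def coneRegion (N : ℕ) (r : ℝ) (T : EReal) : Set (EuclideanSpace ℝ (Fin N) × ℝ) :=
  {z | z.2 ∈ timeInterval T ∧ ‖z.1‖ ≤ r + z.2}

theorem measurableSet_coneRegion (N : ℕ) (r : ℝ) (T : EReal) :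
    MeasurableSet (coneRegion N r T) :=
  (measurable_snd (measurableSet_timeInterval T)).inter
    (measurableSet_le measurable_fst.norm (measurable_snd.const_add r))

theorem coneRegion_subset (N : ℕ) (r : ℝ) (T : EReal) :
    coneRegion N r T ⊆ univ ×ˢ timeInterval T := fun _ hz => ⟨mem_univ _, hz.1⟩

/-- The weak formulation tested with a plane wave, as an inequality between integrals over the
light cone. -/
theorem IsWeakSolution.planeWave_le {N : ℕ} {G : ℝ → ℝ} (hG : ∀ s, 0 ≤ G s)
    {f g : EuclideanSpace ℝ (Fin N) → ℝ} (hf : HasCompactSupport f) (hg : HasCompactSupport g)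
    {ε : ℝ} {T : EReal} {u : EuclideanSpace ℝ (Fin N) → ℝ → ℝ} (h : IsWeakSolution G f g ε T u)
    (hsupp : SupportedInCone (dataRadius f g) T u) {a b : ℝ → ℝ}
    (ha : ContDiff ℝ ∞ a) (hb : ContDiff ℝ ∞ b) (hac : HasCompactSupport a)
    (ha0 : ∀ t, 0 ≤ a t) (hb0 : ∀ s, 0 ≤ b s) {R : ℝ} (h0 : 0 ≤ R) (hR : (R : EReal) < T)
    (haR : ∀ t, R ≤ t → a t = 0) (ha1 : a 0 = 1) (ha1' : deriv a 0 = 0)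
    {θ : EuclideanSpace ℝ (Fin N)} (hθ : ‖θ‖ = 1)
    (hJ : 0 ≤ ε * (∫ x, g x * b (-inner ℝ x θ)) - ε * ∫ x, f x * deriv b (-inner ℝ x θ)) :
    ENNReal.ofReal (ε * (∫ x, g x * b (-inner ℝ x θ)) - ε * ∫ x, f x * deriv b (-inner ℝ x θ)) +
      ∫⁻ z in coneRegion N (dataRadius f g) T,
        ENNReal.ofReal (G (u z.1 z.2)) * ENNReal.ofReal (planeWave a b θ z) ≤
    ∫⁻ z in coneRegion N (dataRadius f g) T, ‖u z.1 z.2‖ₑ *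
      ‖planeWave (deriv (deriv a)) b θ z + 2 * planeWave (deriv a) (deriv b) θ z‖ₑ := by
  set r := dataRadius f g with hr
  have hr0 : 0 ≤ r := dataRadius_nonneg f g
  -- The plane wave is not compactly supported in x. The bump equals 1 on the cone up to time R with
  -- a margin of 1, so it makes the test function admissible and is invisible to derivatives taken
  -- on the cone.
  let χ : ContDiffBump (0 : EuclideanSpace ℝ (Fin N)) := ⟨r + R + 1, r + R + 2, by linarith, by linarith⟩
  have hχ1 : ∀ x : EuclideanSpace ℝ (Fin N), ‖x‖ ≤ r + R + 1 → χ x = 1 := fun x hx =>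
    χ.one_of_mem_closedBall (mem_closedBall_zero_iff.2 hx)
  set Ψ : EuclideanSpace ℝ (Fin N) × ℝ → ℝ := fun z => χ z.1 * planeWave a b θ z with hΨdef
  have hΨ : ContDiff ℝ ∞ Ψ := (χ.contDiff.comp contDiff_fst).mul (contDiff_planeWave ha hb θ)
  have hΨ0 : ∀ z, 0 ≤ Ψ z := fun z => mul_nonneg χ.nonneg (mul_nonneg (ha0 _) (hb0 _))
  have hΨc : HasCompactSupport Ψ := by
    refine HasCompactSupport.intro (χ.hasCompactSupport.isCompact.prod hac.isCompact) fun z hz => ?_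
    by_contra hne
    refine hz ⟨subset_tsupport _ fun h0 => hne ?_, subset_tsupport _ fun h0 => hne ?_⟩
    · simp [hΨdef, h0]
    · simp [hΨdef, planeWave, h0]
  have hΨR : ∀ z : EuclideanSpace ℝ (Fin N) × ℝ, R ≤ z.2 → Ψ z = 0 := fun z hz => by
    simp [hΨdef, planeWave, haR _ hz]
  have hloc : ∀ z : EuclideanSpace ℝ (Fin N) × ℝ, ‖z.1‖ < r + R + 1 →
      Ψ =ᶠ[nhds z] planeWave a b θ := by
    intro z hz
    have : {z : EuclideanSpace ℝ (Fin N) × ℝ | ‖z.1‖ < r + R + 1} ∈ nhds z :=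
      (isOpen_lt (by fun_prop) continuous_const).mem_nhds hz
    filter_upwards [this] with y hy
    have hy' : ‖y.1‖ < r + R + 1 := hy
    simp [hΨdef, hχ1 y.1 hy'.le]
  have hid := h.integral_waveOp hΨ hΨc h0 hR hΨR
  -- the initial data
  have hg1 : ∫ x, g x * Ψ (x, 0) = ∫ x, g x * b (-inner ℝ x θ) := by
    congr 1; ext x
    by_cases hx : ‖x‖ ≤ r
    · simp [hΨdef, planeWave, hχ1 x (by linarith), ha1]
    · simp [(eq_zero_of_dataRadius_lt hf hg (not_le.1 hx)).2]
  have hf1 : ∫ x, f x * fderiv ℝ Ψ (x, 0) (0, 1) = ∫ x, f x * deriv b (-inner ℝ x θ) := by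
    congr 1; ext x
    by_cases hx : ‖x‖ ≤ r
    · rw [(hloc (x, 0) (by change ‖x‖ < _; linarith)).fderiv_eq, fderiv_planeWave ha hb]
      simp [planeWave, ha1, ha1']
    · simp [(eq_zero_of_dataRadius_lt hf hg (not_le.1 hx)).1]
  rw [hg1, hf1] at hid
  -- the nonlinear term
  have hGint := h.2.1
  have hmeas := h.1
  have hprod : (volume : Measure (EuclideanSpace ℝ (Fin N) × ℝ)).restrict
      (univ ×ˢ timeInterval T) = (volume : Measure (EuclideanSpace ℝ (Fin N))).prod
        (volume.restrict (timeInterval T)) := by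
    rw [Measure.volume_eq_prod, ← Measure.prod_restrict, Measure.restrict_univ]
  obtain ⟨M, hM⟩ := hΨc.exists_bound_of_continuous hΨ.continuous
  have hGΨ : Integrable (fun z : EuclideanSpace ℝ (Fin N) × ℝ => G (u z.1 z.2) * Ψ z)
      (volume.restrict (univ ×ˢ timeInterval T)) :=
    Integrable.mul_bdd (c := M) hGint hΨ.continuous.aestronglyMeasurable
      (Filter.Eventually.of_forall hM)
  have hB : ENNReal.ofReal (∫ t in timeInterval T, ∫ x, G (u x t) * Ψ (x, t)) =
      ∫⁻ z in univ ×ˢ timeInterval T, ENNReal.ofReal (G (u z.1 z.2) * Ψ z) := by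
    rw [← ofReal_integral_eq_lintegral_ofReal hGΨ
      (Filter.Eventually.of_forall fun z => mul_nonneg (hG _) (hΨ0 z))]
    rw [hprod] at hGΨ ⊢
    rw [integral_prod_symm _ hGΨ]
  have hB0 : 0 ≤ ∫ t in timeInterval T, ∫ x, G (u x t) * Ψ (x, t) :=
    integral_nonneg fun t => integral_nonneg fun x => mul_nonneg (hG _) (hΨ0 _)
  -- The part of the nonlinear term outside the cone is nonnegative and is dropped.
  have hBlow : ∫⁻ z in coneRegion N r T,
        ENNReal.ofReal (G (u z.1 z.2)) * ENNReal.ofReal (planeWave a b θ z) ≤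
      ENNReal.ofReal (∫ t in timeInterval T, ∫ x, G (u x t) * Ψ (x, t)) := by
    rw [hB]
    refine le_trans ?_ (lintegral_mono_set (coneRegion_subset N r T))
    refine setLIntegral_mono' (measurableSet_coneRegion N r T) fun z hz => ?_
    rw [← ENNReal.ofReal_mul (hG _)]
    refine ENNReal.ofReal_le_ofReal (le_of_eq ?_)
    congr 1
    rcases le_or_gt R z.2 with ht | ht
    · rw [hΨR z ht]; simp [planeWave, haR _ ht]
    · have := hz.2
      rw [hΨdef]
      simp only
      rw [hχ1 z.1 (by linarith), one_mul]
  -- the linear term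
  set F : EuclideanSpace ℝ (Fin N) × ℝ → ℝ := fun z =>
    planeWave (deriv (deriv a)) b θ z + 2 * planeWave (deriv a) (deriv b) θ z with hF
  have hFc : Continuous F := by
    have h1 := (contDiff_planeWave (contDiff_deriv (contDiff_deriv ha)) hb θ).continuous
    have h2 := (contDiff_planeWave (contDiff_deriv ha) (contDiff_deriv hb) θ).continuous
    exact h1.add (continuous_const.mul h2)
  -- Up to time R the bump is locally constant. After time R both sides vanish because the amplitude
  -- does.
  have hwave : ∀ z ∈ coneRegion N r T, waveOp Ψ z = F z := by
    intro z hz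
    have hz2 := hz.2
    rcases le_or_gt z.2 R with ht | ht
    · rw [waveOp_congr (hloc z (by linarith)), waveOp_planeWave ha hb hθ]
    · have hopen : ∀ᶠ s in nhds z.2, s ∈ Ioi R := isOpen_Ioi.mem_nhds ht
      have ha2 : a =ᶠ[nhds z.2] fun _ => 0 := by
        filter_upwards [hopen] with s hs
        exact haR s (le_of_lt hs)
      have hd1 : deriv a =ᶠ[nhds z.2] fun _ => 0 := by
        simpa using ha2.deriv
      have hd2 : deriv (deriv a) z.2 = 0 := by
        rw [hd1.deriv_eq]; simp
      have hΨz : Ψ =ᶠ[nhds z] planeWave (fun _ => 0) b θ := by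
        filter_upwards [continuousAt_snd.eventually hopen] with y hy
        rw [hΨR y (le_of_lt hy)]; simp [planeWave]
      rw [waveOp_congr hΨz, waveOp_planeWave contDiff_const hb hθ, hF]
      simp [planeWave, hd2, hd1.self_of_nhds]
  -- Passing to extended norms before exchanging integrals requires only measurability, not joint
  -- integrability of u times the wave operator of Ψ. The support condition is used at each fixed
  -- time, in the order of the iterated integral.
  have hlin : ‖∫ t in timeInterval T, ∫ x, u x t * waveOp Ψ (x, t)‖ₑ ≤
      ∫⁻ z in coneRegion N r T, ‖u z.1 z.2‖ₑ * ‖F z‖ₑ := by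
    have hae : AEMeasurable (fun z : EuclideanSpace ℝ (Fin N) × ℝ =>
        (coneRegion N r T).indicator (fun z => ‖u z.1 z.2‖ₑ * ‖F z‖ₑ) z)
        (volume.restrict (univ ×ˢ timeInterval T)) :=
      (hmeas.enorm.mul hFc.measurable.enorm.aemeasurable).indicator (measurableSet_coneRegion N r T)
    calc ‖∫ t in timeInterval T, ∫ x, u x t * waveOp Ψ (x, t)‖ₑ
        ≤ ∫⁻ t in timeInterval T, ‖∫ x, u x t * waveOp Ψ (x, t)‖ₑ :=
          enorm_integral_le_lintegral_enorm _
      _ ≤ ∫⁻ t in timeInterval T, ∫⁻ x,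
            (coneRegion N r T).indicator (fun z => ‖u z.1 z.2‖ₑ * ‖F z‖ₑ) (x, t) := by
          refine setLIntegral_mono' (measurableSet_timeInterval T) fun t ht => ?_
          refine (enorm_integral_le_lintegral_enorm _).trans (lintegral_mono_ae ?_)
          filter_upwards [hsupp t ht] with x hx
          by_cases hxr : ‖x‖ ≤ r + t
          · have hz : (x, t) ∈ coneRegion N r T := ⟨ht, hxr⟩
            rw [indicator_of_mem hz, hwave _ hz, enorm_mul]
          · rw [hx (not_le.1 hxr), zero_mul, enorm_zero]; exact zero_le
      _ = ∫⁻ z in univ ×ˢ timeInterval T,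
            (coneRegion N r T).indicator (fun z => ‖u z.1 z.2‖ₑ * ‖F z‖ₑ) z := by
          rw [hprod] at hae ⊢
          rw [lintegral_prod_symm _ hae]
      _ = _ := by
          rw [setLIntegral_indicator (measurableSet_coneRegion N r T),
            inter_eq_left.2 (coneRegion_subset N r T)]
  calc _ ≤ ENNReal.ofReal (ε * (∫ x, g x * b (-inner ℝ x θ)) -
          ε * ∫ x, f x * deriv b (-inner ℝ x θ)) +
        ENNReal.ofReal (∫ t in timeInterval T, ∫ x, G (u x t) * Ψ (x, t)) :=
          add_le_add le_rfl hBlow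
    _ = ENNReal.ofReal (∫ t in timeInterval T, ∫ x, u x t * waveOp Ψ (x, t)) := by
        rw [← ENNReal.ofReal_add hJ hB0, hid]
    _ ≤ _ := (Real.ofReal_le_enorm _) |>.trans hlin

/-! ### Regularised powers, positivity of the data term, and time cut-offs -/

/-- A smooth positive function on the line that agrees with `s ^ (-α)` for `s ≥ 1`. -/
def regPow (α s : ℝ) : ℝ := (1 + Real.smoothTransition s * (s - 1)) ^ (-α)

theorem regPow_base_pos (s : ℝ) : 0 < 1 + Real.smoothTransition s * (s - 1) := by
  rcases le_or_gt s 0 with h | h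
  · rw [Real.smoothTransition.zero_of_nonpos h]; norm_num
  · rcases le_or_gt 1 s with h1 | h1
    · have := mul_nonneg (Real.smoothTransition.nonneg s) (sub_nonneg.2 h1)
      linarith
    · have h2 := Real.smoothTransition.le_one s
      nlinarith

theorem contDiff_regPow (α : ℝ) : ContDiff ℝ ∞ (regPow α) :=
  ContDiff.rpow_const_of_ne
    (contDiff_const.add (Real.smoothTransition.contDiff.mul (contDiff_id.sub contDiff_const)))
    fun s => (regPow_base_pos s).ne'

theorem regPow_nonneg (α s : ℝ) : 0 ≤ regPow α s := Real.rpow_nonneg (regPow_base_pos s).le _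

theorem regPow_of_one_le (α : ℝ) {s : ℝ} (hs : 1 ≤ s) : regPow α s = s ^ (-α) := by
  rw [regPow, Real.smoothTransition.one_of_one_le hs]; congr 1; ring

theorem deriv_regPow_of_one_lt (α : ℝ) {s : ℝ} (hs : 1 < s) :
    deriv (regPow α) s = -α * s ^ (-(α + 1)) := by
  have : regPow α =ᶠ[nhds s] fun s => s ^ (-α) := by
    filter_upwards [isOpen_Ioi.mem_nhds hs] with y hy
    exact regPow_of_one_le α (le_of_lt hy)
  rw [this.deriv_eq, Real.deriv_rpow_const]
  congr 2; ring

/-- Positivity of the initial data tested with the plane waves `(t + c - ⟪x, θ⟫)^{-α}`,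
uniformly in the direction, for large `c`. -/
theorem exists_initial_plane_wave_pos {N : ℕ} {f g : EuclideanSpace ℝ (Fin N) → ℝ}
    (hf : Continuous f) (hfc : HasCompactSupport f) (hg : Continuous g)
    (hgc : HasCompactSupport g) (hI : 0 < ∫ x, g x) {α : ℝ} (hα : 0 ≤ α) :
    ∃ c : ℝ, dataRadius f g + 2 ≤ c ∧ ∃ J > (0 : ℝ), ∀ θ : EuclideanSpace ℝ (Fin N), ‖θ‖ = 1 →
      J ≤ (∫ x, g x * regPow α (-inner ℝ x θ + c)) -
        ∫ x, f x * deriv (fun s => regPow α (s + c)) (-inner ℝ x θ) := by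
  set r := dataRadius f g with hr
  have hr0 : 0 ≤ r := dataRadius_nonneg f g
  set I := ∫ x, g x
  have hgi : Integrable g := hg.integrable_of_hasCompactSupport hgc
  have hfi : Integrable f := hf.integrable_of_hasCompactSupport hfc
  set A := ∫ x, |g x|
  set B := ∫ x, |f x|
  have hA : 0 ≤ A := integral_nonneg fun _ => abs_nonneg _
  have hB : 0 ≤ B := integral_nonneg fun _ => abs_nonneg _
  -- These tolerances make the error from g and the contribution of f at most I/4 each, which leaves
  -- I/2 for J after the factor c^(-α) is taken out.
  set ε₁ := I / (4 * (1 + A)) with hε₁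
  set ε₂ := I / (4 * (1 + B)) with hε₂
  have hε₁0 : 0 < ε₁ := by positivity
  have hε₂0 : 0 < ε₂ := by positivity
  have hcont : ContinuousAt (fun y : ℝ => (1 - y) ^ (-α)) 0 :=
    ContinuousAt.rpow_const (by fun_prop) (Or.inl (by norm_num))
  obtain ⟨δ, hδ, hδ'⟩ := Metric.continuousAt_iff.1 hcont ε₁ hε₁0
  -- The four lower bounds on c keep the phase at least 2 on the cone, make |⟪x,θ⟫|/c at most 1/2 on
  -- the data, bring (1 - ⟪x,θ⟫/c)^(-α) within ε₁ of 1, and make the f-term small, since its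
  -- derivative carries an extra factor α/c.
  set c := max (max (r + 2) (2 * r + 1)) (max (r / δ + 1) (α * 2 ^ (α + 1) / ε₂ + 1)) with hc
  have c1 : r + 2 ≤ c := (le_max_left _ _).trans (le_max_left _ _)
  have c2 : 2 * r + 1 ≤ c := (le_max_right _ _).trans (le_max_left _ _)
  have c3 : r / δ + 1 ≤ c := (le_max_left _ _).trans (le_max_right _ _)
  have c4 : α * 2 ^ (α + 1) / ε₂ + 1 ≤ c := (le_max_right _ _).trans (le_max_right _ _)
  have hc0 : 0 < c := by linarith
  refine ⟨c, c1, c ^ (-α) * (I / 2), by positivity, fun θ hθ => ?_⟩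
  have hy : ∀ x : EuclideanSpace ℝ (Fin N), ‖x‖ ≤ r → |(inner ℝ x θ : ℝ)| ≤ r := by
    intro x hx
    have := abs_real_inner_le_norm x θ
    rw [hθ, mul_one] at this
    exact this.trans hx
  have hfac : ∀ (x : EuclideanSpace ℝ (Fin N)) (β : ℝ), ‖x‖ ≤ r →
      (-inner ℝ x θ + c) ^ (-β) = c ^ (-β) * (1 - inner ℝ x θ / c) ^ (-β) := by
    intro x β hx
    have h1 := abs_le.1 (hy x hx)
    rw [← Real.mul_rpow hc0.le]
    · congr 1; field_simp; ring
    · rw [sub_nonneg, div_le_one hc0]; linarith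
  have hg1 : ∀ x, c ^ (-α) * (g x - ε₁ * |g x|) ≤ g x * regPow α (-inner ℝ x θ + c) := by
    intro x
    by_cases hx : ‖x‖ ≤ r
    · have h1 := abs_le.1 (hy x hx)
      rw [regPow_of_one_le α (by linarith), hfac x α hx]
      have h2 : |(1 - inner ℝ x θ / c) ^ (-α) - 1| ≤ ε₁ := by
        have := @hδ' (inner ℝ x θ / c) (by
          rw [Real.dist_eq, sub_zero, abs_div, abs_of_pos hc0, div_lt_iff₀ hc0]
          have : r / δ < c := by linarith
          rw [div_lt_iff₀ hδ] at this
          linarith [hy x hx])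
        rw [Real.dist_eq] at this
        simpa using this.le
      have h3 : -(ε₁ * |g x|) ≤ g x * ((1 - inner ℝ x θ / c) ^ (-α) - 1) := by
        have h4 := neg_abs_le (g x * ((1 - inner ℝ x θ / c) ^ (-α) - 1))
        rw [abs_mul] at h4
        nlinarith [abs_nonneg (g x)]
      have h5 : 0 ≤ c ^ (-α) := by positivity
      nlinarith
    · simp [(eq_zero_of_dataRadius_lt hfc hgc (not_le.1 hx)).2]
  have hf1 : ∀ x, f x * deriv (fun s => regPow α (s + c)) (-inner ℝ x θ) ≤
      c ^ (-α) * (ε₂ * |f x|) := by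
    intro x
    by_cases hx : ‖x‖ ≤ r
    · have h1 := abs_le.1 (hy x hx)
      rw [deriv_comp_add_const, deriv_regPow_of_one_lt α (by linarith), hfac x _ hx]
      have h2 : (1 - inner ℝ x θ / c) ^ (-(α + 1)) ≤ 2 ^ (α + 1) := by
        rw [Real.rpow_neg (by rw [sub_nonneg, div_le_one hc0]; linarith),
          ← Real.inv_rpow (by rw [sub_nonneg, div_le_one hc0]; linarith)]
        refine Real.rpow_le_rpow (inv_nonneg.2 (by rw [sub_nonneg, div_le_one hc0]; linarith)) ?_
          (by linarith)
        rw [inv_le_comm₀ (by rw [sub_pos, div_lt_one hc0]; linarith) two_pos]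
        have : inner ℝ x θ / c ≤ 1 / 2 := by rw [div_le_iff₀ hc0]; linarith
        linarith
      have h2' : 0 ≤ (1 - inner ℝ x θ / c) ^ (-(α + 1)) :=
        Real.rpow_nonneg (by rw [sub_nonneg, div_le_one hc0]; linarith) _
      have h3 : c ^ (-(α + 1)) = c ^ (-α) * c⁻¹ := by
        rw [neg_add, Real.rpow_add hc0, Real.rpow_neg_one]
      have h6 : α * 2 ^ (α + 1) * c⁻¹ ≤ ε₂ := by
        rw [← div_eq_mul_inv, div_le_iff₀ hc0]
        have : α * 2 ^ (α + 1) / ε₂ ≤ c := by linarith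
        rw [div_le_iff₀ hε₂0] at this
        linarith
      have h7 : α * c⁻¹ * (1 - inner ℝ x θ / c) ^ (-(α + 1)) ≤ ε₂ :=
        le_trans (by
          calc α * c⁻¹ * (1 - inner ℝ x θ / c) ^ (-(α + 1)) ≤ α * c⁻¹ * 2 ^ (α + 1) := by gcongr
            _ = _ := by ring) h6
      have h7' : 0 ≤ α * c⁻¹ * (1 - inner ℝ x θ / c) ^ (-(α + 1)) := by positivity
      have h5 : 0 ≤ c ^ (-α) := by positivity
      rw [h3]
      calc f x * (-α * (c ^ (-α) * c⁻¹ * (1 - inner ℝ x θ / c) ^ (-(α + 1))))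
          = c ^ (-α) * (-f x * (α * c⁻¹ * (1 - inner ℝ x θ / c) ^ (-(α + 1)))) := by ring
        _ ≤ c ^ (-α) * (|f x| * ε₂) := by
          have := neg_le_abs (f x)
          gcongr
        _ = _ := by ring
    · simp [(eq_zero_of_dataRadius_lt hfc hgc (not_le.1 hx)).1]
  have hbC : ContDiff ℝ ∞ (fun s => regPow α (s + c)) :=
    (contDiff_regPow α).comp (contDiff_id.add contDiff_const)
  have hcg : Continuous fun x : EuclideanSpace ℝ (Fin N) => regPow α (-inner ℝ x θ + c) :=
    (contDiff_regPow α).continuous.comp (by fun_prop)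
  have hcf : Continuous fun x : EuclideanSpace ℝ (Fin N) =>
      deriv (fun s => regPow α (s + c)) (-inner ℝ x θ) :=
    (contDiff_deriv hbC).continuous.comp (by fun_prop)
  have hG : c ^ (-α) * (I - ε₁ * A) ≤ ∫ x, g x * regPow α (-inner ℝ x θ + c) := by
    rw [← integral_const_mul, ← integral_sub hgi (hgi.abs.const_mul _), ← integral_const_mul]
    exact integral_mono ((hgi.sub (hgi.abs.const_mul _)).const_mul _)
      ((hg.mul hcg).integrable_of_hasCompactSupport hgc.mul_right) hg1
  have hF : ∫ x, f x * deriv (fun s => regPow α (s + c)) (-inner ℝ x θ) ≤ c ^ (-α) * (ε₂ * B) := by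
    rw [← integral_const_mul, ← integral_const_mul]
    exact integral_mono ((hf.mul hcf).integrable_of_hasCompactSupport hfc.mul_right)
      ((hfi.abs.const_mul _).const_mul _) hf1
  have e1 : ε₁ * A ≤ I / 4 := by
    rw [hε₁, div_mul_eq_mul_div, div_le_div_iff₀ (by positivity) (by norm_num)]
    nlinarith
  have e2 : ε₂ * B ≤ I / 4 := by
    rw [hε₂, div_mul_eq_mul_div, div_le_div_iff₀ (by positivity) (by norm_num)]
    nlinarith
  have h5 : 0 ≤ c ^ (-α) := by positivity
  nlinarith

/-- Cut-off functions in time at scale `R` whose derivatives are controlled by a fractional power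
of the function itself. -/
structure IsTimeCutoff (p C R : ℝ) (η : ℝ → ℝ) : Prop where
  smooth : ContDiff ℝ ∞ η
  compact : HasCompactSupport η
  nonneg : ∀ t, 0 ≤ η t
  le_one : ∀ t, η t ≤ 1
  eq_zero : ∀ t, R ≤ t → η t = 0
  eq_one : ∀ t, |t| ≤ R / 2 → η t = 1
  deriv_eq_zero : ∀ t, |t| ≤ R / 2 → deriv η t = 0 ∧ deriv (deriv η) t = 0
  abs_deriv_le : ∀ t, |deriv η t| ≤ C * R⁻¹ * η t ^ (1 / p)
  abs_deriv2_le : ∀ t, |deriv (deriv η) t| ≤ C * R⁻¹ ^ 2 * η t ^ (1 / p)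

/-- A high power ζ^(j+2) of a bump keeps a factor ζ^j after two derivatives, and ζ^j ≤
(ζ^(j+2))^(1/p) as soon as (j+2)/p ≤ j, that is j ≥ 2/(p-1). Rescaling time by R gives the factors
R⁻¹ and R⁻². -/
theorem exists_isTimeCutoff {p : ℝ} (hp : 1 < p) :
    ∃ C : ℝ, 0 < C ∧ ∃ η : ℝ → ℝ → ℝ, ∀ R > 0, IsTimeCutoff p C R (η R) := by
  -- The inner radius 3/4 exceeds 1/2, so the derivatives vanish on |t| ≤ R/2 including its
  -- endpoints.
  let ζ : ContDiffBump (0 : ℝ) := ⟨3 / 4, 1, by norm_num, by norm_num⟩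
  have hζC : ContDiff ℝ ∞ (ζ : ℝ → ℝ) := ζ.contDiff
  have hζ1C := contDiff_deriv hζC
  have hζ2C := contDiff_deriv hζ1C
  obtain ⟨M₁, hM₁⟩ := ζ.hasCompactSupport.deriv.exists_bound_of_continuous hζ1C.continuous
  obtain ⟨M₂, hM₂⟩ := ζ.hasCompactSupport.deriv.deriv.exists_bound_of_continuous hζ2C.continuous
  have hM₁0 : 0 ≤ M₁ := (norm_nonneg _).trans (hM₁ 0)
  have hM₂0 : 0 ≤ M₂ := (norm_nonneg _).trans (hM₂ 0)
  have hp1 : 0 < p - 1 := by linarith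
  have hp0 : 0 < p := by linarith
  -- The added 1 ensures j ≥ 1, so that ζ^j vanishes where ζ does.
  obtain ⟨j, hj⟩ := exists_nat_ge (2 / (p - 1) + 1)
  have hj1 : (1 : ℝ) ≤ j := by
    have : 0 < 2 / (p - 1) := by positivity
    linarith
  have hjp : ((j + 2 : ℕ) : ℝ) * (1 / p) ≤ j := by
    have h1 : 2 / (p - 1) ≤ j := by linarith
    rw [div_le_iff₀ hp1] at h1
    rw [mul_one_div, div_le_iff₀ hp0]
    push_cast
    linarith
  set κ : ℝ → ℝ := fun s => ζ s ^ (j + 2) with hκ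
  have hκC : ContDiff ℝ ∞ κ := hζC.pow _
  have hd : ∀ s, HasDerivAt (ζ : ℝ → ℝ) (deriv ζ s) s := fun s =>
    (hζC.differentiable (by simp) s).hasDerivAt
  have hd1 : ∀ s, HasDerivAt (deriv ζ) (deriv (deriv ζ) s) s := fun s =>
    (hζ1C.differentiable (by simp) s).hasDerivAt
  have hκ1 : deriv κ = fun s => ((j : ℝ) + 2) * ζ s ^ (j + 1) * deriv ζ s := by
    ext s
    have := ((hd s).pow (j + 2)).deriv
    rw [show κ = (ζ : ℝ → ℝ) ^ (j + 2) from rfl, this]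
    push_cast
    rfl
  have hκ2 : deriv (deriv κ) = fun s => ((j : ℝ) + 2) *
      ((((j : ℝ) + 1) * ζ s ^ j * deriv ζ s) * deriv ζ s + ζ s ^ (j + 1) * deriv (deriv ζ) s) := by
    rw [hκ1]
    ext s
    have h1 := ((hd s).fun_pow (j + 1)).fun_mul (hd1 s)
    have h2 := (h1.const_mul ((j : ℝ) + 2)).deriv
    rw [show (fun s => ((j : ℝ) + 2) * ζ s ^ (j + 1) * deriv ζ s) =
      fun s => ((j : ℝ) + 2) * (ζ s ^ (j + 1) * deriv ζ s) by ext; ring, h2]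
    push_cast
    rfl
  set C : ℝ := ((j : ℝ) + 2) * M₁ + ((j : ℝ) + 2) * (((j : ℝ) + 1) * M₁ * M₁ + M₂) + 1 with hC
  have hpow : ∀ s, ζ s ^ j ≤ κ s ^ (1 / p) := by
    intro s
    rcases eq_or_lt_of_le (ζ.nonneg (x := s)) with h | h
    · have : j ≠ 0 := by rintro rfl; norm_num at hj1
      rw [← h, zero_pow this]
      exact Real.rpow_nonneg (pow_nonneg ζ.nonneg _) _
    · rw [hκ]
      simp only
      rw [← Real.rpow_natCast, ← Real.rpow_natCast (ζ s) (j + 2), ← Real.rpow_mul ζ.nonneg]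
      exact Real.rpow_le_rpow_of_exponent_ge h ζ.le_one hjp
  have hsucc : ∀ s, ζ s ^ (j + 1) ≤ ζ s ^ j := fun s =>
    pow_le_pow_of_le_one ζ.nonneg ζ.le_one (Nat.le_succ j)
  have hb1 : ∀ s, |deriv κ s| ≤ C * κ s ^ (1 / p) := by
    intro s
    have h0 : 0 ≤ ζ s ^ j := pow_nonneg ζ.nonneg _
    have h0' : 0 ≤ ζ s ^ (j + 1) := pow_nonneg ζ.nonneg _
    have hm : |deriv ζ s| ≤ M₁ := hM₁ s
    calc |deriv κ s| = ((j : ℝ) + 2) * ζ s ^ (j + 1) * |deriv ζ s| := by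
          rw [hκ1, abs_mul, abs_of_nonneg (by positivity)]
      _ ≤ ((j : ℝ) + 2) * ζ s ^ j * M₁ := by
          gcongr ?_ * ?_ * ?_
          exact hsucc s
      _ = (((j : ℝ) + 2) * M₁) * ζ s ^ j := by ring
      _ ≤ C * ζ s ^ j := by
          gcongr
          have : 0 ≤ ((j : ℝ) + 2) * (((j : ℝ) + 1) * M₁ * M₁ + M₂) := by positivity
          rw [hC]; linarith
      _ ≤ _ := by
          have : 0 ≤ C := by rw [hC]; positivity
          gcongr
          exact hpow s
  have hb2 : ∀ s, |deriv (deriv κ) s| ≤ C * κ s ^ (1 / p) := by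
    intro s
    have h0 : 0 ≤ ζ s ^ j := pow_nonneg ζ.nonneg _
    have h0' : 0 ≤ ζ s ^ (j + 1) := pow_nonneg ζ.nonneg _
    have hm : |deriv ζ s| ≤ M₁ := hM₁ s
    have hm2 : |deriv (deriv ζ) s| ≤ M₂ := hM₂ s
    calc |deriv (deriv κ) s| ≤ ((j : ℝ) + 2) * ((((j : ℝ) + 1) * ζ s ^ j * |deriv ζ s|) *
            |deriv ζ s| + ζ s ^ (j + 1) * |deriv (deriv ζ) s|) := by
          rw [hκ2, abs_mul, abs_of_nonneg (by positivity : (0 : ℝ) ≤ (j : ℝ) + 2)]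
          gcongr
          refine (abs_add_le _ _).trans (le_of_eq ?_)
          rw [abs_mul, abs_mul, abs_mul (ζ s ^ (j + 1)), abs_of_nonneg h0',
            abs_of_nonneg (by positivity : 0 ≤ ((j : ℝ) + 1) * ζ s ^ j)]
      _ ≤ ((j : ℝ) + 2) * ((((j : ℝ) + 1) * ζ s ^ j * M₁) * M₁ + ζ s ^ j * M₂) := by
          gcongr ?_ * (?_ * ?_ * ?_ * ?_ + ?_ * ?_)
          exact hsucc s
      _ = (((j : ℝ) + 2) * (((j : ℝ) + 1) * M₁ * M₁ + M₂)) * ζ s ^ j := by ring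
      _ ≤ C * ζ s ^ j := by
          gcongr
          have : 0 ≤ ((j : ℝ) + 2) * M₁ := by positivity
          rw [hC]; linarith
      _ ≤ _ := by
          have : 0 ≤ C := by rw [hC]; positivity
          gcongr
          exact hpow s
  refine ⟨C, by rw [hC]; positivity, fun R t => κ (R⁻¹ * t), fun R hR => ?_⟩
  have hRi : 0 < R⁻¹ := inv_pos.2 hR
  have hder1 : deriv (fun t => κ (R⁻¹ * t)) = fun t => R⁻¹ * deriv κ (R⁻¹ * t) := by
    ext t; exact deriv_comp_mul_left R⁻¹ κ t
  have hder2 : deriv (deriv (fun t => κ (R⁻¹ * t))) =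
      fun t => R⁻¹ ^ 2 * deriv (deriv κ) (R⁻¹ * t) := by
    rw [hder1]
    ext t
    rw [deriv_const_mul_field, deriv_comp_mul_left R⁻¹ (deriv κ) t, smul_eq_mul]
    ring
  have hκone : ∀ s, |s| ≤ 3 / 4 → κ s = 1 := by
    intro s hs
    have : ζ s = 1 := ζ.one_of_mem_closedBall (by
      rw [mem_closedBall_zero_iff, Real.norm_eq_abs]; exact hs)
    simp [hκ, this]
  have hκzero : ∀ s, 1 ≤ |s| → κ s = 0 := by
    intro s hs
    have : ζ s = 0 := ζ.zero_of_le_dist (by rw [dist_zero_right, Real.norm_eq_abs]; exact hs)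
    simp [hκ, this]
  have hscale : ∀ t, |t| ≤ R / 2 → |R⁻¹ * t| ≤ 1 / 2 := by
    intro t ht
    rw [abs_mul, abs_of_pos hRi, inv_mul_le_iff₀ hR]
    linarith
  have hloc : ∀ s, |s| ≤ 1 / 2 → κ =ᶠ[nhds s] fun _ => 1 := by
    intro s hs
    have : {s : ℝ | |s| < 3 / 4} ∈ nhds s :=
      (isOpen_lt continuous_abs continuous_const).mem_nhds (by
        change |s| < 3 / 4; linarith)
    filter_upwards [this] with y hy
    exact hκone y (le_of_lt hy)
  refine ⟨hκC.comp (contDiff_const.mul contDiff_id), ?_, fun t => pow_nonneg ζ.nonneg _,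
    fun t => pow_le_one₀ ζ.nonneg ζ.le_one, fun t ht => ?_, fun t ht => ?_, fun t ht => ?_,
    fun t => ?_, fun t => ?_⟩
  · refine HasCompactSupport.intro (isCompact_closedBall (0 : ℝ) R) fun t ht => hκzero _ ?_
    rw [mem_closedBall_zero_iff, not_le, Real.norm_eq_abs] at ht
    rw [abs_mul, abs_of_pos hRi, ← div_eq_inv_mul, le_div_iff₀ hR]
    linarith
  · refine hκzero _ ?_
    rw [abs_mul, abs_of_pos hRi, ← div_eq_inv_mul, le_div_iff₀ hR, one_mul]
    exact ht.trans (le_abs_self t)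
  · exact hκone _ ((hscale t ht).trans (by norm_num))
  · rw [hder2, hder1]
    have h1 := hloc _ (hscale t ht)
    have h2 : deriv κ =ᶠ[nhds (R⁻¹ * t)] fun _ => 0 := by simpa using h1.deriv
    have h3 := h2.deriv_eq
    simp only [deriv_const] at h3
    simp [h2.self_of_nhds, h3]
  · rw [hder1]
    simp only
    rw [abs_mul, abs_of_pos hRi]
    calc R⁻¹ * |deriv κ (R⁻¹ * t)| ≤ R⁻¹ * (C * κ (R⁻¹ * t) ^ (1 / p)) := by
          gcongr
          exact hb1 _
      _ = _ := by ring
  · rw [hder2]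
    simp only
    rw [abs_mul, abs_of_pos (by positivity : 0 < R⁻¹ ^ 2)]
    calc R⁻¹ ^ 2 * |deriv (deriv κ) (R⁻¹ * t)| ≤ R⁻¹ ^ 2 * (C * κ (R⁻¹ * t) ^ (1 / p)) := by
          gcongr
          exact hb2 _
      _ = _ := by ring

/-! ### Averaging over directions and Hölder's inequality in a slab -/

/-- The spherical mean of the plane waves `(t + c - ⟪x, θ⟫)^{-α}`, a positive solution of the wave
equation in the cone `|x| < t + c`. -/
def waveMean (N : ℕ) (α c : ℝ) (z : EuclideanSpace ℝ (Fin N) × ℝ) : ENNReal :=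
  ∫⁻ θ, ENNReal.ofReal ((z.2 + c - inner ℝ z.1 θ) ^ (-α)) ∂(sphereMeasure N)

theorem measurable_phase_rpow (N : ℕ) (α c : ℝ) :
    Measurable fun y : EuclideanSpace ℝ (Fin N) × (EuclideanSpace ℝ (Fin N) × ℝ) =>
      ENNReal.ofReal ((y.2.2 + c - inner ℝ y.2.1 y.1) ^ (-α)) := by
  have h : Measurable fun y : EuclideanSpace ℝ (Fin N) × (EuclideanSpace ℝ (Fin N) × ℝ) =>
      y.2.2 + c - inner ℝ y.2.1 y.1 := by
    apply Continuous.measurable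
    fun_prop
  exact (h.pow_const _).ennreal_ofReal

theorem measurable_waveMean (N : ℕ) (α c : ℝ) : Measurable (waveMean N α c) :=
  (measurable_phase_rpow N α c).lintegral_prod_left'

theorem lintegral_sphere_mul_phase {N : ℕ} {μ : Measure (EuclideanSpace ℝ (Fin N) × ℝ)}
    [SFinite μ] {F : EuclideanSpace ℝ (Fin N) × ℝ → ENNReal} (hF : AEMeasurable F μ) (α c : ℝ) :
    ∫⁻ θ, ∫⁻ z, F z * ENNReal.ofReal ((z.2 + c - inner ℝ z.1 θ) ^ (-α)) ∂μ ∂(sphereMeasure N) =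
      ∫⁻ z, F z * waveMean N α c z ∂μ := by
  rw [lintegral_lintegral_swap (f := fun θ z =>
    F z * ENNReal.ofReal ((z.2 + c - inner ℝ z.1 θ) ^ (-α)))]
  · refine lintegral_congr fun z => ?_
    rw [waveMean, lintegral_const_mul]
    exact (measurable_phase_rpow N α c).comp measurable_prodMk_right
  · exact (hF.comp_snd).mul (measurable_phase_rpow N α c).aemeasurable

/-- Standing assumptions on the nonlinearity and the data. -/
structure IsBlowupSetting {N : ℕ} (p a : ℝ) (G : ℝ → ℝ) (f g : EuclideanSpace ℝ (Fin N) → ℝ) :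
    Prop where
  one_lt : 1 < p
  pos : 0 < a
  le_nonlinearity : ∀ s : ℝ, a * |s| ^ p ≤ G s
  continuous_f : Continuous f
  compact_f : HasCompactSupport f
  continuous_g : Continuous g
  compact_g : HasCompactSupport g
  integral_pos : 0 < ∫ x, g x

theorem IsBlowupSetting.nonlinearity_nonneg {N : ℕ} {p a : ℝ} {G : ℝ → ℝ}
    {f g : EuclideanSpace ℝ (Fin N) → ℝ} (S : IsBlowupSetting p a G f g) (s : ℝ) : 0 ≤ G s :=
  (mul_nonneg S.pos.le (Real.rpow_nonneg (abs_nonneg s) _)).trans (S.le_nonlinearity s)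

/-- The margin 2 lies beyond the threshold 1 of `regPow`, so on the cone both the regularised power
and its derivative are those of the pure power. -/
theorem phase_lower_bound {N : ℕ} {r c : ℝ} (hc : r + 2 ≤ c) {T : EReal}
    {z : EuclideanSpace ℝ (Fin N) × ℝ} (hz : z ∈ coneRegion N r T)
    {θ : EuclideanSpace ℝ (Fin N)} (hθ : ‖θ‖ = 1) : 2 ≤ z.2 + c - inner ℝ z.1 θ := by
  have h1 := real_inner_le_norm z.1 θ
  rw [hθ, mul_one] at h1
  have := hz.2
  linarith

theorem phase_upper_bound {N : ℕ} {r c : ℝ} {T : EReal}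
    {z : EuclideanSpace ℝ (Fin N) × ℝ} (hz : z ∈ coneRegion N r T)
    {θ : EuclideanSpace ℝ (Fin N)} (hθ : ‖θ‖ = 1) :
    z.2 + c - inner ℝ z.1 θ ≤ 2 * z.2 + c + r := by
  have h1 := neg_le_of_abs_le (abs_real_inner_le_norm z.1 θ)
  rw [hθ, mul_one] at h1
  have := hz.2
  linarith

theorem IsWeakSolution.aemeasurable_enorm {N : ℕ} {G : ℝ → ℝ}
    {f g : EuclideanSpace ℝ (Fin N) → ℝ} {ε : ℝ} {T : EReal}
    {u : EuclideanSpace ℝ (Fin N) → ℝ → ℝ} (h : IsWeakSolution G f g ε T u) (r : ℝ) :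
    AEMeasurable (fun z : EuclideanSpace ℝ (Fin N) × ℝ => ‖u z.1 z.2‖ₑ)
      (volume.restrict (coneRegion N r T)) :=
  (h.1.mono_measure (Measure.restrict_mono (coneRegion_subset N r T) le_rfl)).enorm

/-- The plane wave inequality holds for almost every direction with the same J. Its terms are
nonnegative, so Tonelli's theorem turns the integral over directions into the weights W_α and, from
the derivative of the power, α W_{α+1}. -/
theorem IsBlowupSetting.waveMean_le {N : ℕ} [NeZero N] {p a : ℝ} {G : ℝ → ℝ}
    {f g : EuclideanSpace ℝ (Fin N) → ℝ} (S : IsBlowupSetting p a G f g) {α c J : ℝ}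
    (hα : 0 ≤ α) (hc : dataRadius f g + 2 ≤ c) (hJ0 : 0 ≤ J)
    (hJ : ∀ θ : EuclideanSpace ℝ (Fin N), ‖θ‖ = 1 →
      J ≤ (∫ x, g x * regPow α (-inner ℝ x θ + c)) -
        ∫ x, f x * deriv (fun s => regPow α (s + c)) (-inner ℝ x θ))
    {C R : ℝ} {η : ℝ → ℝ} (hη : IsTimeCutoff p C R η) (hR0 : 0 < R) {ε : ℝ} (hε : 0 < ε)
    {T : EReal} (hR : (R : EReal) < T) {u : EuclideanSpace ℝ (Fin N) → ℝ → ℝ}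
    (h : IsWeakSolution G f g ε T u) (hsupp : SupportedInCone (dataRadius f g) T u) :
    ENNReal.ofReal (ε * J) * sphereMeasure N univ +
      ∫⁻ z in coneRegion N (dataRadius f g) T,
        ENNReal.ofReal (G (u z.1 z.2)) * ENNReal.ofReal (η z.2) * waveMean N α c z ≤
    ∫⁻ z in coneRegion N (dataRadius f g) T,
      (‖u z.1 z.2‖ₑ * ENNReal.ofReal |deriv (deriv η) z.2| * waveMean N α c z +
        ‖u z.1 z.2‖ₑ * ENNReal.ofReal (2 * α * |deriv η z.2|) * waveMean N (α + 1) c z) := by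
  set r := dataRadius f g
  set b : ℝ → ℝ := fun s => regPow α (s + c) with hb
  have hbC : ContDiff ℝ ∞ b := (contDiff_regPow α).comp (contDiff_id.add contDiff_const)
  have hum := IsWeakSolution.aemeasurable_enorm h r
  have hGm : AEMeasurable (fun z : EuclideanSpace ℝ (Fin N) × ℝ => ENNReal.ofReal (G (u z.1 z.2)))
      (volume.restrict (coneRegion N r T)) :=
    (h.2.1.aestronglyMeasurable.mono_measure
      (Measure.restrict_mono (coneRegion_subset N r T) le_rfl)).aemeasurable.ennreal_ofReal
  have hη0 : Measurable fun z : EuclideanSpace ℝ (Fin N) × ℝ => ENNReal.ofReal (η z.2) :=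
    (hη.smooth.continuous.measurable.comp measurable_snd).ennreal_ofReal
  have hη1 : Measurable fun z : EuclideanSpace ℝ (Fin N) × ℝ =>
      ENNReal.ofReal (2 * α * |deriv η z.2|) :=
    (((measurable_deriv η).comp measurable_snd).abs.const_mul _).ennreal_ofReal
  have hη2 : Measurable fun z : EuclideanSpace ℝ (Fin N) × ℝ =>
      ENNReal.ofReal |deriv (deriv η) z.2| :=
    ((measurable_deriv (deriv η)).comp measurable_snd).abs.ennreal_ofReal
  have hpoint : ∀ᵐ θ ∂(sphereMeasure N), ENNReal.ofReal (ε * J) +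
      ∫⁻ z in coneRegion N r T, ENNReal.ofReal (G (u z.1 z.2)) * ENNReal.ofReal (η z.2) *
        ENNReal.ofReal ((z.2 + c - inner ℝ z.1 θ) ^ (-α)) ≤
      ∫⁻ z in coneRegion N r T, (‖u z.1 z.2‖ₑ * ENNReal.ofReal |deriv (deriv η) z.2| *
          ENNReal.ofReal ((z.2 + c - inner ℝ z.1 θ) ^ (-α)) +
        ‖u z.1 z.2‖ₑ * ENNReal.ofReal (2 * α * |deriv η z.2|) *
          ENNReal.ofReal ((z.2 + c - inner ℝ z.1 θ) ^ (-(α + 1)))) := by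
    filter_upwards [ae_norm_eq_one_sphereMeasure N] with θ hθ
    have hJθ := hJ θ hθ
    have hJε : ε * J ≤ ε * (∫ x, g x * b (-inner ℝ x θ)) - ε * ∫ x, f x * deriv b (-inner ℝ x θ) := by
      rw [← mul_sub]; exact mul_le_mul_of_nonneg_left hJθ hε.le
    have key := h.planeWave_le S.nonlinearity_nonneg S.compact_f S.compact_g hsupp hη.smooth hbC
      hη.compact hη.nonneg (fun s => regPow_nonneg _ _) hR0.le hR hη.eq_zero
      (hη.eq_one 0 (by rw [abs_zero]; positivity))
      (hη.deriv_eq_zero 0 (by rw [abs_zero]; positivity)).1 hθ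
      ((mul_nonneg hε.le hJ0).trans hJε)
    refine le_trans (add_le_add (ENNReal.ofReal_le_ofReal hJε) ?_) (key.trans ?_)
    · refine setLIntegral_mono' (measurableSet_coneRegion N r T) fun z hz => ?_
      have hph := phase_lower_bound hc hz hθ
      rw [mul_assoc, ← ENNReal.ofReal_mul (hη.nonneg _)]
      refine mul_le_mul_right (ENNReal.ofReal_le_ofReal (le_of_eq ?_)) _
      simp only [planeWave, hb]
      rw [show z.2 - inner ℝ z.1 θ + c = z.2 + c - inner ℝ z.1 θ by ring,
        regPow_of_one_le α (by linarith)]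
    · refine setLIntegral_mono' (measurableSet_coneRegion N r T) fun z hz => ?_
      have hph := phase_lower_bound hc hz hθ
      have hph0 : 0 ≤ z.2 + c - inner ℝ z.1 θ := by linarith
      rw [mul_assoc, mul_assoc, ← mul_add]
      refine mul_le_mul_right ?_ _
      rw [← ENNReal.ofReal_mul (abs_nonneg _), ← ENNReal.ofReal_mul (by positivity),
        ← ENNReal.ofReal_add (by positivity) (by positivity), ← ofReal_norm]
      refine ENNReal.ofReal_le_ofReal ?_
      simp only [planeWave, hb, deriv_comp_add_const]
      rw [show z.2 - inner ℝ z.1 θ + c = z.2 + c - inner ℝ z.1 θ by ring,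
        regPow_of_one_le α (by linarith), deriv_regPow_of_one_lt α (by linarith)]
      refine (norm_add_le _ _).trans (le_of_eq ?_)
      simp only [norm_mul, Real.norm_eq_abs, abs_neg, abs_two]
      rw [abs_of_nonneg hα, abs_of_nonneg (Real.rpow_nonneg hph0 (-α)),
        abs_of_nonneg (Real.rpow_nonneg hph0 _)]
      ring
  have hint := lintegral_mono_ae hpoint
  have hL : ∫⁻ θ, (ENNReal.ofReal (ε * J) +
      ∫⁻ z in coneRegion N r T, ENNReal.ofReal (G (u z.1 z.2)) * ENNReal.ofReal (η z.2) *
        ENNReal.ofReal ((z.2 + c - inner ℝ z.1 θ) ^ (-α))) ∂(sphereMeasure N) =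
      ENNReal.ofReal (ε * J) * sphereMeasure N univ +
      ∫⁻ z in coneRegion N r T,
        ENNReal.ofReal (G (u z.1 z.2)) * ENNReal.ofReal (η z.2) * waveMean N α c z := by
    rw [lintegral_add_left measurable_const, lintegral_const,
      lintegral_sphere_mul_phase (F := fun z => ENNReal.ofReal (G (u z.1 z.2)) *
        ENNReal.ofReal (η z.2)) (hGm.mul hη0.aemeasurable)]
  rw [hL] at hint
  refine hint.trans (le_of_eq ?_)
  have hm1 : AEMeasurable (fun z : EuclideanSpace ℝ (Fin N) × ℝ =>
      ‖u z.1 z.2‖ₑ * ENNReal.ofReal |deriv (deriv η) z.2|)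
      (volume.restrict (coneRegion N r T)) := hum.mul hη2.aemeasurable
  have hm2 : AEMeasurable (fun z : EuclideanSpace ℝ (Fin N) × ℝ =>
      ‖u z.1 z.2‖ₑ * ENNReal.ofReal (2 * α * |deriv η z.2|))
      (volume.restrict (coneRegion N r T)) := hum.mul hη1.aemeasurable
  have hph : ∀ (β : ℝ) (θ : EuclideanSpace ℝ (Fin N)),
      Measurable fun z : EuclideanSpace ℝ (Fin N) × ℝ =>
        ENNReal.ofReal ((z.2 + c - inner ℝ z.1 θ) ^ (-β)) := fun β θ =>
    (measurable_phase_rpow N β c).comp measurable_prodMk_left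
  have hsplit : ∀ θ : EuclideanSpace ℝ (Fin N),
      ∫⁻ z in coneRegion N r T, (‖u z.1 z.2‖ₑ * ENNReal.ofReal |deriv (deriv η) z.2| *
          ENNReal.ofReal ((z.2 + c - inner ℝ z.1 θ) ^ (-α)) +
        ‖u z.1 z.2‖ₑ * ENNReal.ofReal (2 * α * |deriv η z.2|) *
          ENNReal.ofReal ((z.2 + c - inner ℝ z.1 θ) ^ (-(α + 1)))) =
      (∫⁻ z in coneRegion N r T, ‖u z.1 z.2‖ₑ * ENNReal.ofReal |deriv (deriv η) z.2| *
          ENNReal.ofReal ((z.2 + c - inner ℝ z.1 θ) ^ (-α))) +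
      ∫⁻ z in coneRegion N r T, ‖u z.1 z.2‖ₑ * ENNReal.ofReal (2 * α * |deriv η z.2|) *
          ENNReal.ofReal ((z.2 + c - inner ℝ z.1 θ) ^ (-(α + 1))) := fun θ =>
    lintegral_add_left' (hm1.mul (hph α θ).aemeasurable) _
  simp only [hsplit]
  rw [lintegral_add_left', lintegral_sphere_mul_phase hm1, lintegral_sphere_mul_phase hm2,
    lintegral_add_left' (f := fun z => ‖u z.1 z.2‖ₑ * ENNReal.ofReal |deriv (deriv η) z.2| *
      waveMean N α c z) (hm1.mul (measurable_waveMean N α c).aemeasurable)]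
  refine AEMeasurable.lintegral_prod_right' (f := fun y : EuclideanSpace ℝ (Fin N) ×
    (EuclideanSpace ℝ (Fin N) × ℝ) => ‖u y.2.1 y.2.2‖ₑ *
      ENNReal.ofReal |deriv (deriv η) y.2.2| *
          ENNReal.ofReal ((y.2.2 + c - inner ℝ y.2.1 y.1) ^ (-α))) ?_
  exact (hm1.comp_snd).mul (measurable_phase_rpow N α c).aemeasurable

/-- The part of the cone region with time in `(R/2, R]`. -/
def coneSlab (N : ℕ) (r : ℝ) (T : EReal) (R : ℝ) : Set (EuclideanSpace ℝ (Fin N) × ℝ) :=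
  coneRegion N r T ∩ {z | R / 2 < z.2 ∧ z.2 ≤ R}

theorem measurableSet_coneSlab (N : ℕ) (r : ℝ) (T : EReal) (R : ℝ) :
    MeasurableSet (coneSlab N r T R) :=
  (measurableSet_coneRegion N r T).inter
    ((measurableSet_lt measurable_const measurable_snd).inter
      (measurableSet_le measurable_snd measurable_const))

/-- The mass of `|u|^p` in the slab, with the cut-off as a weight. -/
def slabMass {N : ℕ} (p r : ℝ) (T : EReal) (R : ℝ) (η : ℝ → ℝ)
    (u : EuclideanSpace ℝ (Fin N) → ℝ → ℝ) : ENNReal :=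
  ∫⁻ z in coneSlab N r T R, ‖u z.1 z.2‖ₑ ^ p * ENNReal.ofReal (η z.2)

/-- The derivatives of the cut-off live in the slab and carry a factor η^(1/p). In Hölder's
inequality this factor joins |u|, which is why `slabMass` has the weight η to the first power. -/
theorem IsBlowupSetting.waveMean_le_slabMass {N : ℕ} [NeZero N] {p a : ℝ} {G : ℝ → ℝ}
    {f g : EuclideanSpace ℝ (Fin N) → ℝ} (S : IsBlowupSetting p a G f g) {α c J : ℝ}
    (hα : 0 ≤ α) (hc : dataRadius f g + 2 ≤ c) (hJ0 : 0 ≤ J)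
    (hJ : ∀ θ : EuclideanSpace ℝ (Fin N), ‖θ‖ = 1 →
      J ≤ (∫ x, g x * regPow α (-inner ℝ x θ + c)) -
        ∫ x, f x * deriv (fun s => regPow α (s + c)) (-inner ℝ x θ))
    {C R : ℝ} {η : ℝ → ℝ} (hη : IsTimeCutoff p C R η) (hR0 : 0 < R) {ε : ℝ}
    (hε : 0 < ε)
    {T : EReal} (hR : (R : EReal) < T) {u : EuclideanSpace ℝ (Fin N) → ℝ → ℝ}
    (h : IsWeakSolution G f g ε T u) (hsupp : SupportedInCone (dataRadius f g) T u) {q : ℝ}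
    (hq : p.HolderConjugate q) :
    ENNReal.ofReal (ε * J) * sphereMeasure N univ +
      ENNReal.ofReal a * ∫⁻ z in coneRegion N (dataRadius f g) T,
        ‖u z.1 z.2‖ₑ ^ p * ENNReal.ofReal (η z.2) * waveMean N α c z ≤
    slabMass p (dataRadius f g) T R η u ^ (1 / p) *
      (∫⁻ z in coneSlab N (dataRadius f g) T R,
        (ENNReal.ofReal (C * R⁻¹ ^ 2) * waveMean N α c z +
          ENNReal.ofReal (2 * α * (C * R⁻¹)) * waveMean N (α + 1) c z) ^ q) ^ (1 / q) := by
  have hp0 : 0 < p := by linarith [S.one_lt]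
  have hRi : 0 < R⁻¹ := inv_pos.2 hR0
  have hum := IsWeakSolution.aemeasurable_enorm h (dataRadius f g)
  have hηm : Measurable fun z : EuclideanSpace ℝ (Fin N) × ℝ => ENNReal.ofReal (η z.2) :=
    (hη.smooth.continuous.measurable.comp measurable_snd).ennreal_ofReal
  have hsub : coneSlab N (dataRadius f g) T R ⊆ coneRegion N (dataRadius f g) T := inter_subset_left
  set Ψ : EuclideanSpace ℝ (Fin N) × ℝ → ENNReal := fun z =>
    ENNReal.ofReal (C * R⁻¹ ^ 2) * waveMean N α c z +
          ENNReal.ofReal (2 * α * (C * R⁻¹)) * waveMean N (α + 1) c z with hΨ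
  have hΨm : Measurable Ψ := ((measurable_waveMean N α c).const_mul _).add
    ((measurable_waveMean N (α + 1) c).const_mul _)
  calc _ ≤ _ := by
        refine add_le_add le_rfl (d := ∫⁻ z in coneRegion N (dataRadius f g) T,
          ENNReal.ofReal (G (u z.1 z.2)) * ENNReal.ofReal (η z.2) * waveMean N α c z) ?_
        rw [← lintegral_const_mul' _ _ ENNReal.ofReal_ne_top]
        refine lintegral_mono fun z => ?_
        rw [← mul_assoc, ← mul_assoc]
        gcongr
        rw [← ofReal_norm, ENNReal.ofReal_rpow_of_nonneg (norm_nonneg _) hp0.le,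
          ← ENNReal.ofReal_mul S.pos.le]
        exact ENNReal.ofReal_le_ofReal (S.le_nonlinearity _)
    _ ≤ _ := S.waveMean_le hα hc hJ0 hJ hη hR0 hε hR h hsupp
    _ ≤ ∫⁻ z in coneRegion N (dataRadius f g) T, (coneSlab N (dataRadius f g) T R).indicator
          (fun z => (‖u z.1 z.2‖ₑ * ENNReal.ofReal (η z.2) ^ (1 / p)) * Ψ z) z := by
        refine setLIntegral_mono' (measurableSet_coneRegion N _ T) fun z hz => ?_
        have hz0 : 0 ≤ z.2 := hz.1.1
        by_cases hzs : z ∈ coneSlab N (dataRadius f g) T R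
        · rw [indicator_of_mem hzs, hΨ]
          simp only
          rw [ENNReal.ofReal_rpow_of_nonneg (hη.nonneg _) (by positivity), mul_add]
          have e1 : ENNReal.ofReal |deriv (deriv η) z.2| ≤
              ENNReal.ofReal (η z.2 ^ (1 / p)) * ENNReal.ofReal (C * R⁻¹ ^ 2) := by
            rw [← ENNReal.ofReal_mul (Real.rpow_nonneg (hη.nonneg _) _)]
            refine ENNReal.ofReal_le_ofReal ((hη.abs_deriv2_le _).trans (le_of_eq (by ring)))
          have e2 : ENNReal.ofReal (2 * α * |deriv η z.2|) ≤
              ENNReal.ofReal (η z.2 ^ (1 / p)) * ENNReal.ofReal (2 * α * (C * R⁻¹)) := by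
            rw [← ENNReal.ofReal_mul (Real.rpow_nonneg (hη.nonneg _) _)]
            refine ENNReal.ofReal_le_ofReal ?_
            calc 2 * α * |deriv η z.2| ≤ 2 * α * (C * R⁻¹ * η z.2 ^ (1 / p)) := by
                  gcongr
                  exact hη.abs_deriv_le _
              _ = _ := by ring
          calc _ ≤ ‖u z.1 z.2‖ₑ * (ENNReal.ofReal (η z.2 ^ (1 / p)) *
                  ENNReal.ofReal (C * R⁻¹ ^ 2)) * waveMean N α c z +
                ‖u z.1 z.2‖ₑ * (ENNReal.ofReal (η z.2 ^ (1 / p)) *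
                  ENNReal.ofReal (2 * α * (C * R⁻¹))) * waveMean N (α + 1) c z := by
                gcongr
            _ = _ := by ring
        · rw [indicator_of_notMem hzs]
          -- Past time R the derivative bounds themselves force zero, because η vanishes there.
          have hzero : deriv η z.2 = 0 ∧ deriv (deriv η) z.2 = 0 := by
            by_cases h1 : z.2 ≤ R / 2
            · exact hη.deriv_eq_zero _ (by rwa [abs_of_nonneg hz0])
            · have h2 : R < z.2 := by
                by_contra h3
                exact hzs ⟨hz, not_le.1 h1, not_lt.1 h3⟩
              have h3 := hη.abs_deriv_le z.2
              have h4 := hη.abs_deriv2_le z.2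
              rw [hη.eq_zero _ h2.le, Real.zero_rpow (by positivity), mul_zero] at h3 h4
              exact ⟨abs_nonpos_iff.1 h3, abs_nonpos_iff.1 h4⟩
          rw [hzero.1, hzero.2]
          simp
    _ = ∫⁻ z in coneSlab N (dataRadius f g) T R,
          (‖u z.1 z.2‖ₑ * ENNReal.ofReal (η z.2) ^ (1 / p)) * Ψ z := by
        rw [setLIntegral_indicator (measurableSet_coneSlab N _ T R), inter_eq_left.2 hsub]
    _ ≤ (∫⁻ z in coneSlab N (dataRadius f g) T R,
          (‖u z.1 z.2‖ₑ * ENNReal.ofReal (η z.2) ^ (1 / p)) ^ p) ^ (1 / p) *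
        (∫⁻ z in coneSlab N (dataRadius f g) T R, Ψ z ^ q) ^ (1 / q) :=
        ENNReal.lintegral_mul_le_Lp_mul_Lq _ hq
          (((hum.mono_measure (Measure.restrict_mono hsub le_rfl))).mul
            (hηm.pow_const _).aemeasurable) hΨm.aemeasurable
    _ = _ := by
        congr 2
        refine lintegral_congr fun z => ?_
        rw [ENNReal.mul_rpow_of_nonneg _ _ hp0.le, ← ENNReal.rpow_mul, one_div,
          inv_mul_cancel₀ hp0.ne', ENNReal.rpow_one]

/-! ### Size of the spherical means on slabs of the cone -/

theorem lintegral_coneSlab_le {N : ℕ} {r R : ℝ} (hR : 0 ≤ R) {T : EReal}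
    {Ψ : EuclideanSpace ℝ (Fin N) × ℝ → ENNReal} (hΨ : Measurable Ψ) {K : ENNReal}
    (hK : ∀ t, R / 2 < t → t ≤ R → ∫⁻ x in Metric.closedBall 0 (r + t), Ψ (x, t) ≤ K) :
    ∫⁻ z in coneSlab N r T R, Ψ z ≤ ENNReal.ofReal R * K := by
  have hm := measurableSet_coneSlab N r T R
  rw [← lintegral_indicator hm, Measure.volume_eq_prod,
    lintegral_prod_symm _ (hΨ.indicator hm).aemeasurable]
  calc _ ≤ ∫⁻ t, (Ioc (R / 2) R).indicator (fun _ => K) t := by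
        refine lintegral_mono fun t => ?_
        by_cases ht : t ∈ Ioc (R / 2) R
        · rw [indicator_of_mem ht]
          refine le_trans ?_ (hK t ht.1 ht.2)
          rw [← lintegral_indicator Metric.isClosed_closedBall.measurableSet]
          refine lintegral_mono fun x => ?_
          by_cases hx : (x, t) ∈ coneSlab N r T R
          · rw [indicator_of_mem hx, indicator_of_mem (mem_closedBall_zero_iff.2 hx.1.2)]
          · rw [indicator_of_notMem hx]; exact zero_le
        · rw [indicator_of_notMem ht]
          refine le_of_eq (lintegral_eq_zero_of_ae_eq_zero (Filter.Eventually.of_forall fun x => ?_))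
          exact indicator_of_notMem (fun h => ht h.2) _
    _ = K * ENNReal.ofReal (R - R / 2) := by
        rw [lintegral_indicator_const measurableSet_Ioc, Real.volume_Ioc]
    _ ≤ _ := by
        rw [mul_comm]
        gcongr
        linarith

theorem exists_volume_coneSlab_le (N : ℕ) {r : ℝ} (hr : 0 ≤ r) :
    ∃ C : ℝ, 0 < C ∧ ∀ (T : EReal) (R : ℝ), 1 ≤ R →
      volume (coneSlab N r T R) ≤ ENNReal.ofReal (C * R ^ ((N : ℝ) + 1)) := by
  set V : ℝ := volume.real (Metric.ball (0 : EuclideanSpace ℝ (Fin N)) 1)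
  have hV : 0 < V := ENNReal.toReal_pos (Metric.measure_ball_pos _ _ one_pos).ne'
    measure_ball_lt_top.ne
  have hV' : volume (Metric.ball (0 : EuclideanSpace ℝ (Fin N)) 1) = ENNReal.ofReal V :=
    (ENNReal.ofReal_toReal measure_ball_lt_top.ne).symm
  refine ⟨(r + 1) ^ N * V, by positivity, fun T R hR => ?_⟩
  have hR0 : 0 < R := by linarith
  have h := lintegral_coneSlab_le (N := N) (r := r) hR0.le (T := T) (Ψ := fun _ => 1)
    measurable_const (K := ENNReal.ofReal (((r + 1) * R) ^ N * V)) (fun t ht ht' => by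
      rw [setLIntegral_one, Measure.addHaar_closedBall _ _ (by linarith), hV',
        finrank_euclideanSpace_fin, ← ENNReal.ofReal_mul (by
          have : 0 ≤ r + t := by linarith
          positivity)]
      refine ENNReal.ofReal_le_ofReal ?_
      have : 0 ≤ r + t := by linarith
      gcongr
      nlinarith)
  rw [setLIntegral_one, ← ENNReal.ofReal_mul hR0.le] at h
  refine h.trans (ENNReal.ofReal_le_ofReal (le_of_eq ?_))
  rw [Real.rpow_add hR0, Real.rpow_natCast, Real.rpow_one, mul_pow]
  ring

/-- The constant contains both endpoint powers because the sign of the exponent is not fixed. -/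
theorem rpow_le_of_comparable {lo hi : ℝ} (hlo : 0 < lo) (hhi : 0 < hi) (e : ℝ) :
    ∃ C : ℝ, 0 < C ∧ ∀ R τ : ℝ, 0 < R → lo * R ≤ τ → τ ≤ hi * R → τ ^ e ≤ C * R ^ e := by
  refine ⟨lo ^ e + hi ^ e, by positivity, fun R τ hR h1 h2 => ?_⟩
  have hτ : 0 < τ := (mul_pos hlo hR).trans_le h1
  have p1 : 0 ≤ lo ^ e * R ^ e := by positivity
  have p2 : 0 ≤ hi ^ e * R ^ e := by positivity
  rcases le_total 0 e with he | he
  · have := Real.rpow_le_rpow hτ.le h2 he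
    rw [Real.mul_rpow hhi.le hR.le] at this
    linarith
  · have := Real.rpow_le_rpow_of_nonpos (mul_pos hlo hR) h1 he
    rw [Real.mul_rpow hlo.le hR.le] at this
    linarith

theorem integral_rpow_nonneg {τ : ℝ} (hτ : 1 ≤ τ) (e : ℝ) : 0 ≤ ∫ s in (1 : ℝ)..τ, s ^ e :=
  intervalIntegral.integral_nonneg hτ fun s hs => Real.rpow_nonneg (by linarith [hs.1]) _

theorem integral_rpow_mono {τ τ' : ℝ} (hτ : 1 ≤ τ) (h : τ ≤ τ') (e : ℝ) :
    ∫ s in (1 : ℝ)..τ, s ^ e ≤ ∫ s in (1 : ℝ)..τ', s ^ e := by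
  refine intervalIntegral.integral_mono_interval le_rfl hτ h ?_ ?_
  · refine (ae_restrict_iff' measurableSet_Ioc).2 (Filter.Eventually.of_forall fun s hs => ?_)
    exact Real.rpow_nonneg (by linarith [hs.1]) _
  · refine ContinuousOn.intervalIntegrable_of_Icc (hτ.trans h) fun s hs => ?_
    exact (ContinuousAt.rpow_const continuousAt_id
      (Or.inl (by have := hs.1; simp only [id]; linarith))).continuousWithinAt

/-- The `L^q` norm of the spherical mean of plane waves over a slab of the cone. -/
theorem exists_lintegral_coneSlab_waveMean_le (N : ℕ) [NeZero N] {A q c : ℝ}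
    (hA : ((N : ℝ) - 1) / 2 < A) (hq : 0 < q) (hc : 2 ≤ c) :
    ∃ C : ℝ, 0 < C ∧ ∀ (T : EReal) (r R : ℝ), r + 2 ≤ c → 1 ≤ R →
      ∫⁻ z in coneSlab N r T R, waveMean N A c z ^ q ≤
        ENNReal.ofReal (C * (R ^ ((N : ℝ) - ((N : ℝ) - 1) / 2 * q) *
          ∫ s in (1 : ℝ)..((1 + c) * R), s ^ (-((A - ((N : ℝ) - 1) / 2) * q)))) := by
  set m : ℝ := ((N : ℝ) - 1) / 2 with hm
  obtain ⟨C₁, hC₁, h₁⟩ := exists_lintegral_phase_rpow_le N hA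
  obtain ⟨C₂, hC₂, h₂⟩ := exists_lintegral_closedBall_rpow_le N
  -- For R/2 < t ≤ R and R ≥ 1 the shifted time τ = t + c lies between R/2 and (1+c)R.
  obtain ⟨C₃, hC₃, h₃⟩ := rpow_le_of_comparable (lo := 1 / 2) (hi := 1 + c) (by norm_num)
    (by linarith) (-(m * q) + ((N : ℝ) - 1))
  set κ := (A - m) * q with hκ
  refine ⟨C₁ ^ q * C₂ * C₃, by positivity, fun T r R hrc hR => ?_⟩
  have hR0 : 0 < R := by linarith
  have hL : 0 ≤ ∫ s in (1 : ℝ)..((1 + c) * R), s ^ (-κ) :=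
    integral_rpow_nonneg (by nlinarith) _
  refine (lintegral_coneSlab_le hR0.le ((measurable_waveMean N A c).pow_const q)
    (K := ENNReal.ofReal (C₁ ^ q * C₂ * C₃ * (R ^ (-(m * q) + ((N : ℝ) - 1)) *
      ∫ s in (1 : ℝ)..((1 + c) * R), s ^ (-κ)))) fun t ht ht' => ?_).trans ?_
  · set τ := t + c with hτ
    have hτ1 : 1 ≤ τ := by linarith
    have hτ0 : 0 < τ := by linarith
    calc ∫⁻ x in Metric.closedBall 0 (r + t), waveMean N A c (x, t) ^ q
        ≤ ∫⁻ x in Metric.closedBall (0 : EuclideanSpace ℝ (Fin N)) (τ - 1),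
            waveMean N A c (x, t) ^ q :=
          lintegral_mono_set (Metric.closedBall_subset_closedBall (by linarith))
      _ ≤ ∫⁻ x in Metric.closedBall (0 : EuclideanSpace ℝ (Fin N)) (τ - 1),
            ENNReal.ofReal (C₁ ^ q * τ ^ (-(m * q))) * ENNReal.ofReal ((τ - ‖x‖) ^ (-κ)) := by
          refine setLIntegral_mono' Metric.isClosed_closedBall.measurableSet fun x hx => ?_
          rw [mem_closedBall_zero_iff] at hx
          have hd : 0 < τ - ‖x‖ := by linarith
          have hle : waveMean N A c (x, t) ≤ _ := h₁ x τ (by linarith)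
          refine (ENNReal.rpow_le_rpow hle hq.le).trans (le_of_eq ?_)
          rw [ENNReal.ofReal_rpow_of_nonneg (by positivity) hq.le,
            ← ENNReal.ofReal_mul (by positivity), Real.mul_rpow hC₁.le (by positivity),
            Real.mul_rpow (by positivity) (by positivity), ← Real.rpow_mul hτ0.le,
            ← Real.rpow_mul hd.le, hκ]
          congr 1
          rw [show -m * q = -(m * q) by ring, show (m - A) * q = -((A - m) * q) by ring]
          ring
      _ = ENNReal.ofReal (C₁ ^ q * τ ^ (-(m * q))) *
            ∫⁻ x in Metric.closedBall (0 : EuclideanSpace ℝ (Fin N)) (τ - 1),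
              ENNReal.ofReal ((τ - ‖x‖) ^ (-κ)) := lintegral_const_mul' _ _ ENNReal.ofReal_ne_top
      _ ≤ ENNReal.ofReal (C₁ ^ q * τ ^ (-(m * q))) *
            ENNReal.ofReal (C₂ * (τ ^ ((N : ℝ) - 1) * ∫ s in (1 : ℝ)..τ, s ^ (-κ))) := by
          gcongr
          exact h₂ κ τ hτ1
      _ ≤ _ := by
          rw [← ENNReal.ofReal_mul (by positivity)]
          refine ENNReal.ofReal_le_ofReal ?_
          have e1 : τ ^ (-(m * q)) * τ ^ ((N : ℝ) - 1) ≤ C₃ * R ^ (-(m * q) + ((N : ℝ) - 1)) := by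
            rw [← Real.rpow_add hτ0]
            exact h₃ R τ hR0 (by linarith) (by nlinarith)
          have e2 : ∫ s in (1 : ℝ)..τ, s ^ (-κ) ≤ ∫ s in (1 : ℝ)..((1 + c) * R), s ^ (-κ) :=
            integral_rpow_mono hτ1 (by nlinarith) _
          have e3 := integral_rpow_nonneg hτ1 (-κ)
          calc _ = C₁ ^ q * C₂ * ((τ ^ (-(m * q)) * τ ^ ((N : ℝ) - 1)) *
                ∫ s in (1 : ℝ)..τ, s ^ (-κ)) := by ring
            _ ≤ C₁ ^ q * C₂ * ((C₃ * R ^ (-(m * q) + ((N : ℝ) - 1))) *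
                ∫ s in (1 : ℝ)..((1 + c) * R), s ^ (-κ)) := by gcongr
            _ = _ := by ring
  · rw [← ENNReal.ofReal_mul hR0.le]
    refine ENNReal.ofReal_le_ofReal (le_of_eq ?_)
    have : R ^ ((N : ℝ) - m * q) = R * R ^ (-(m * q) + ((N : ℝ) - 1)) := by
      rw [show (N : ℝ) - m * q = 1 + (-(m * q) + ((N : ℝ) - 1)) by ring, Real.rpow_add hR0,
        Real.rpow_one]
    rw [this]; ring

theorem waveMean_zero (N : ℕ) (c : ℝ) (z : EuclideanSpace ℝ (Fin N) × ℝ) :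
    waveMean N 0 c z = sphereMeasure N univ := by
  simp [waveMean]

/-- In the cone, lowering the exponent of the spherical mean by one costs a factor of size `t`. -/
theorem waveMean_le_mul_waveMean_add_one {N : ℕ} [NeZero N] {r c : ℝ} (hr : 0 ≤ r)
    (hc : r + 2 ≤ c) {T : EReal} {R : ℝ} (hR : 1 ≤ R) {z : EuclideanSpace ℝ (Fin N) × ℝ}
    (hz : z ∈ coneSlab N r T R) (α : ℝ) :
    waveMean N α c z ≤ ENNReal.ofReal ((2 + c + r) * R) * waveMean N (α + 1) c z := by
  unfold waveMean
  rw [← lintegral_const_mul' _ _ ENNReal.ofReal_ne_top]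
  refine lintegral_mono_ae ?_
  filter_upwards [ae_norm_eq_one_sphereMeasure N] with θ hθ
  have h1 := phase_lower_bound hc hz.1 hθ
  have h2 := phase_upper_bound (c := c) hz.1 hθ
  have h3 : 0 < z.2 + c - inner ℝ z.1 θ := by linarith
  rw [← ENNReal.ofReal_mul (by nlinarith)]
  refine ENNReal.ofReal_le_ofReal ?_
  have h4 : (z.2 + c - inner ℝ z.1 θ) ^ (-α) =
      (z.2 + c - inner ℝ z.1 θ) * (z.2 + c - inner ℝ z.1 θ) ^ (-(α + 1)) := by
    rw [show -α = 1 + -(α + 1) by ring, Real.rpow_add h3, Real.rpow_one]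
  rw [h4]
  have h5 : z.2 ≤ R := hz.2.2
  gcongr
  nlinarith

/-- On the slab the phase is at most (2 + c + r)R in every direction. This crude bound loses nothing
but constants when the masses of dyadic slabs are summed with weights 2^(-jβ). -/
theorem le_waveMean {N : ℕ} [NeZero N] {r c : ℝ} (hr : 0 ≤ r)
    (hc : r + 2 ≤ c) {T : EReal} {R : ℝ} (hR : 1 ≤ R) {z : EuclideanSpace ℝ (Fin N) × ℝ}
    (hz : z ∈ coneSlab N r T R) {α : ℝ} (hα : 0 ≤ α) :
    ENNReal.ofReal (((2 + c + r) * R) ^ (-α)) * sphereMeasure N univ ≤ waveMean N α c z := by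
  unfold waveMean
  rw [← lintegral_const]
  refine lintegral_mono_ae ?_
  filter_upwards [ae_norm_eq_one_sphereMeasure N] with θ hθ
  have h1 := phase_lower_bound hc hz.1 hθ
  have h2 := phase_upper_bound (c := c) hz.1 hθ
  have h5 : z.2 ≤ R := hz.2.2
  exact ENNReal.ofReal_le_ofReal
    (Real.rpow_le_rpow_of_nonpos (by linarith) (by nlinarith) (by linarith))

/-! ### The three test exponents and the resulting bounds on the slab mass -/

/-- The integrand is dominated by G(u)/a, and G(u) is integrable. Finiteness is what permits
absorption of the mass into the left side. -/
theorem IsBlowupSetting.lintegral_rpow_ne_top {N : ℕ} {p a : ℝ} {G : ℝ → ℝ}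
    {f g : EuclideanSpace ℝ (Fin N) → ℝ} (S : IsBlowupSetting p a G f g) {ε : ℝ} {T : EReal}
    {u : EuclideanSpace ℝ (Fin N) → ℝ → ℝ} (h : IsWeakSolution G f g ε T u) (r : ℝ)
    {C R : ℝ} {η : ℝ → ℝ} (hη : IsTimeCutoff p C R η) :
    ∫⁻ z in coneRegion N r T, ‖u z.1 z.2‖ₑ ^ p * ENNReal.ofReal (η z.2) ≠ ⊤ := by
  have hp0 : 0 < p := by linarith [S.one_lt]
  have h1 : ∫⁻ z in univ ×ˢ timeInterval T, ENNReal.ofReal (G (u z.1 z.2)) < ⊤ :=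
    Integrable.lintegral_lt_top h.2.1
  have h2 : ENNReal.ofReal a *
      ∫⁻ z in coneRegion N r T, ‖u z.1 z.2‖ₑ ^ p * ENNReal.ofReal (η z.2) < ⊤ := by
    refine lt_of_le_of_lt ?_ h1
    rw [← lintegral_const_mul' _ _ ENNReal.ofReal_ne_top]
    refine le_trans (lintegral_mono fun z => ?_) (lintegral_mono_set (coneRegion_subset N r T))
    calc _ ≤ ENNReal.ofReal a * (‖u z.1 z.2‖ₑ ^ p * 1) := by
          gcongr
          exact ENNReal.ofReal_le_one.2 (hη.le_one _)
      _ = ENNReal.ofReal (a * |u z.1 z.2| ^ p) := by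
          rw [mul_one, ← ofReal_norm, ENNReal.ofReal_rpow_of_nonneg (norm_nonneg _) hp0.le,
            ← ENNReal.ofReal_mul S.pos.le, Real.norm_eq_abs]
      _ ≤ _ := ENNReal.ofReal_le_ofReal (S.le_nonlinearity _)
  intro htop
  rw [htop, ENNReal.mul_top (by simpa using S.pos)] at h2
  exact lt_irrefl _ h2

theorem slabMass_le {N : ℕ} (p r : ℝ) (T : EReal) (R : ℝ) (η : ℝ → ℝ)
    (u : EuclideanSpace ℝ (Fin N) → ℝ → ℝ) : slabMass p r T R η u ≤
      ∫⁻ z in coneRegion N r T, ‖u z.1 z.2‖ₑ ^ p * ENNReal.ofReal (η z.2) :=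
  lintegral_mono_set inter_subset_left

/-- The scalar absorption argument behind the test function estimate. -/
theorem le_of_le_mul_rpow {p q a J K ε b y : ℝ} (hpq : p.HolderConjugate q) (ha : 0 < a)
    (hJ : 0 < J) (hK : 0 < K) (hε : 0 < ε) (hb : 0 ≤ b) (hy : 0 < y)
    (h : ε * J + a * b ≤ K * b ^ (1 / p) * y ^ (1 / q)) :
    b ≤ (K / a) ^ q * y ∧ ε ≤ K * ((K / a) ^ q) ^ (1 / p) / J * y := by
  have hp0 : 0 < p := hpq.pos
  have hq0 : 0 < q := hpq.symm.pos
  have hsum : 1 / p + 1 / q = 1 := by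
    rw [one_div, one_div]; exact hpq.inv_add_inv_eq_one
  have hb0 : 0 < b := by
    refine lt_of_le_of_ne hb fun hb' => ?_
    rw [← hb', Real.zero_rpow (by positivity)] at h
    have := mul_pos hε hJ
    linarith
  -- Dropping εJ and dividing by b^(1/p) bounds b. Inserting this bound on the right and dropping a
  -- b then bounds ε.
  have h1 : b ≤ (K / a) ^ q * y := by
    have hbs : b = b ^ (1 / p) * b ^ (1 / q) := by
      rw [← Real.rpow_add hb0, hsum, Real.rpow_one]
    have hbp : 0 < b ^ (1 / p) := by positivity
    have h2 : b ^ (1 / q) ≤ K / a * y ^ (1 / q) := by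
      have : a * (b ^ (1 / p) * b ^ (1 / q)) ≤ K * b ^ (1 / p) * y ^ (1 / q) := by
        rw [← hbs]
        have := mul_pos hε hJ
        linarith
      rw [div_mul_eq_mul_div, le_div_iff₀ ha]
      refine le_of_mul_le_mul_left ?_ hbp
      linarith
    have h3 := Real.rpow_le_rpow (by positivity) h2 hq0.le
    rwa [Real.mul_rpow (by positivity) (by positivity), ← Real.rpow_mul hb, ← Real.rpow_mul hy.le,
      one_div_mul_cancel hq0.ne', Real.rpow_one, Real.rpow_one] at h3
  refine ⟨h1, ?_⟩
  rw [div_mul_eq_mul_div, le_div_iff₀ hJ]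
  calc ε * J ≤ K * b ^ (1 / p) * y ^ (1 / q) := by
        have := mul_pos ha hb0
        linarith
    _ ≤ K * ((K / a) ^ q * y) ^ (1 / p) * y ^ (1 / q) := by gcongr
    _ = K * ((K / a) ^ q) ^ (1 / p) * (y ^ (1 / p) * y ^ (1 / q)) := by
        rw [Real.mul_rpow (by positivity) hy.le]; ring
    _ = _ := by rw [← Real.rpow_add hy, hsum, Real.rpow_one]

/-- The estimate from testing with a function of time only. -/
theorem IsBlowupSetting.exists_time_test_bound {N : ℕ} [NeZero N] {p a : ℝ} {G : ℝ → ℝ}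
    {f g : EuclideanSpace ℝ (Fin N) → ℝ} (S : IsBlowupSetting p a G f g) {q : ℝ}
    (hpq : p.HolderConjugate q) {Cη : ℝ} (hCη : 0 < Cη) {η : ℝ → ℝ → ℝ}
    (hη : ∀ R > 0, IsTimeCutoff p Cη R (η R)) :
    ∃ K : ℝ, 0 < K ∧ ∀ (ε R : ℝ) (T : EReal) (u : EuclideanSpace ℝ (Fin N) → ℝ → ℝ), 0 < ε →
      1 ≤ R → (R : EReal) < T → IsWeakSolution G f g ε T u →
      SupportedInCone (dataRadius f g) T u →
      ε ≤ K * R ^ ((N : ℝ) + 1 - 2 * q) ∧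
      (slabMass p (dataRadius f g) T R (η R) u).toReal ≤ K * R ^ ((N : ℝ) + 1 - 2 * q) := by
  obtain ⟨c, hc, J, hJ0, hJ⟩ := exists_initial_plane_wave_pos S.continuous_f S.compact_f
    S.continuous_g S.compact_g S.integral_pos (le_refl (0 : ℝ))
  set r := dataRadius f g
  obtain ⟨V, hV, hvol⟩ := exists_volume_coneSlab_le N (dataRadius_nonneg f g)
  have hp0 : 0 < p := hpq.pos
  have hq0 : 0 < q := hpq.symm.pos
  set s := (sphereMeasure N univ).toReal with hs
  have hs0 : 0 < s := ENNReal.toReal_pos (sphereMeasure_univ_pos N).ne' (measure_ne_top _ _)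
  have hs' : sphereMeasure N univ = ENNReal.ofReal s := (ENNReal.ofReal_toReal (measure_ne_top _ _)).symm
  set K₀ : ℝ := Cη * V ^ (1 / q) with hK₀
  have hK₀0 : 0 < K₀ := by positivity
  have ha := S.pos
  refine ⟨(K₀ / a) ^ q + K₀ * ((K₀ / a) ^ q) ^ (1 / p) / J, by positivity,
    fun ε R T u hε hR hRT hu hsupp => ?_⟩
  have hR0 : 0 < R := by linarith
  have hRη := hη R hR0
  have key := S.waveMean_le_slabMass le_rfl hc hJ0.le hJ hRη hR0 hε hRT hu hsupp hpq
  have hfin := S.lintegral_rpow_ne_top hu r hRη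
  set b := (∫⁻ z in coneRegion N r T, ‖u z.1 z.2‖ₑ ^ p * ENNReal.ofReal (η R z.2)).toReal with hb
  have hb' : ∫⁻ z in coneRegion N r T, ‖u z.1 z.2‖ₑ ^ p * ENNReal.ofReal (η R z.2) =
    ENNReal.ofReal b := (ENNReal.ofReal_toReal hfin).symm
  have hb0 : 0 ≤ b := ENNReal.toReal_nonneg
  -- With α = 0 the mean is the constant s, and the term with the first derivative of the cut-off
  -- has coefficient 0. Only the factor R⁻² and the volume of the slab remain.
  simp only [waveMean_zero, mul_zero, zero_mul, ENNReal.ofReal_zero, add_zero] at key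
  rw [lintegral_mul_const' _ _ (measure_ne_top _ _), hb', hs', setLIntegral_const,
    ENNReal.mul_rpow_of_nonneg _ _ (by positivity), ← ENNReal.rpow_mul, mul_one_div,
    div_self hq0.ne', ENNReal.rpow_one] at key
  have hreal : ε * J * s + a * (b * s) ≤
      b ^ (1 / p) * (Cη * R⁻¹ ^ 2 * s * (V * R ^ ((N : ℝ) + 1)) ^ (1 / q)) := by
    rw [← ENNReal.ofReal_le_ofReal_iff (by positivity), ENNReal.ofReal_add (by positivity)
      (by positivity), ENNReal.ofReal_mul (by positivity), ENNReal.ofReal_mul ha.le,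
      ENNReal.ofReal_mul hb0]
    refine key.trans ?_
    rw [ENNReal.ofReal_mul (p := b ^ (1 / p)) (by positivity),
      ENNReal.ofReal_mul (p := Cη * R⁻¹ ^ 2 * s) (by positivity),
      ENNReal.ofReal_mul (p := Cη * R⁻¹ ^ 2) (by positivity),
      ← ENNReal.ofReal_rpow_of_nonneg hb0 (by positivity),
      ← ENNReal.ofReal_rpow_of_nonneg (by positivity) (by positivity)]
    gcongr
    · rw [← hb']; exact slabMass_le _ _ _ _ _ _
    · exact hvol T R hR
  -- The choice y = R^(N+1-2q) is dictated by y^(1/q) = R⁻² (R^(N+1))^(1/q).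
  have hy : (R ^ ((N : ℝ) + 1 - 2 * q)) ^ (1 / q) = R⁻¹ ^ 2 * (R ^ ((N : ℝ) + 1)) ^ (1 / q) := by
    rw [← Real.rpow_mul hR0.le, ← Real.rpow_mul hR0.le, ← Real.rpow_neg_one R, ← Real.rpow_natCast,
      ← Real.rpow_mul hR0.le, ← Real.rpow_add hR0]
    congr 1
    push_cast
    field_simp
    ring
  have hmain : ε * J + a * b ≤ K₀ * b ^ (1 / p) * (R ^ ((N : ℝ) + 1 - 2 * q)) ^ (1 / q) := by
    rw [hy]
    refine le_of_mul_le_mul_right ?_ hs0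
    rw [Real.mul_rpow hV.le (by positivity)] at hreal
    calc _ = ε * J * s + a * (b * s) := by ring
      _ ≤ _ := hreal
      _ = _ := by rw [hK₀]; ring
  obtain ⟨h1, h2⟩ := le_of_le_mul_rpow hpq ha hJ0 hK₀0 hε hb0 (by positivity) hmain
  have hy0 : 0 < R ^ ((N : ℝ) + 1 - 2 * q) := by positivity
  have q1 : 0 ≤ (K₀ / a) ^ q * R ^ ((N : ℝ) + 1 - 2 * q) := by positivity
  have q2 : 0 ≤ K₀ * ((K₀ / a) ^ q) ^ (1 / p) / J * R ^ ((N : ℝ) + 1 - 2 * q) := by positivity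
  refine ⟨by rw [add_mul]; linarith, ?_⟩
  have h3 : (slabMass p r T R (η R) u).toReal ≤ b := ENNReal.toReal_mono hfin (slabMass_le _ _ _ _ _ _)
  rw [add_mul]; linarith

/-- The estimate from testing with the spherical mean of plane waves of exponent `α`. -/
theorem IsBlowupSetting.exists_waveMean_test_bound {N : ℕ} [NeZero N] {p a : ℝ} {G : ℝ → ℝ}
    {f g : EuclideanSpace ℝ (Fin N) → ℝ} (S : IsBlowupSetting p a G f g) {q : ℝ}
    (hpq : p.HolderConjugate q) {Cη : ℝ} (hCη : 0 < Cη) {η : ℝ → ℝ → ℝ}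
    (hη : ∀ R > 0, IsTimeCutoff p Cη R (η R)) {α c J : ℝ} (hα : 0 ≤ α)
    (hαN : ((N : ℝ) - 1) / 2 < α + 1)
    (hc : dataRadius f g + 2 ≤ c) (hJ0 : 0 ≤ J)
    (hJ : ∀ θ : EuclideanSpace ℝ (Fin N), ‖θ‖ = 1 →
      J ≤ (∫ x, g x * regPow α (-inner ℝ x θ + c)) -
        ∫ x, f x * deriv (fun s => regPow α (s + c)) (-inner ℝ x θ)) :
    ∃ K : ℝ, 0 < K ∧ ∀ (ε R : ℝ) (T : EReal) (u : EuclideanSpace ℝ (Fin N) → ℝ → ℝ), 0 < ε →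
      1 ≤ R → (R : EReal) < T → IsWeakSolution G f g ε T u →
      SupportedInCone (dataRadius f g) T u →
      ENNReal.ofReal (ε * J) * sphereMeasure N univ +
        ENNReal.ofReal a * ∫⁻ z in coneRegion N (dataRadius f g) T,
          ‖u z.1 z.2‖ₑ ^ p * ENNReal.ofReal (η R z.2) * waveMean N α c z ≤
        ENNReal.ofReal ((slabMass p (dataRadius f g) T R (η R) u).toReal ^ (1 / p) *
          (K * R⁻¹ * (R ^ ((N : ℝ) - ((N : ℝ) - 1) / 2 * q) *
            ∫ s in (1 : ℝ)..((1 + c) * R), s ^ (-((α + 1 - ((N : ℝ) - 1) / 2) * q))) ^ (1 / q))) := by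
  have hr0 := dataRadius_nonneg f g
  set r := dataRadius f g
  have hp0 : 0 < p := hpq.pos
  have hq0 : 0 < q := hpq.symm.pos
  have hc0 : 0 ≤ c := by linarith
  obtain ⟨K₁, hK₁, hslab⟩ := exists_lintegral_coneSlab_waveMean_le N hαN hq0
    (by linarith : 2 ≤ c)
  -- On the slab W_α ≤ (2 + c + r) R W_{α+1}, so the term with R⁻² W_α has the same size R⁻¹ W_{α+1}
  -- as the other one.
  set K₂ : ℝ := Cη * (2 + c + r) + 2 * α * Cη with hK₂
  have hK₂0 : 0 < K₂ := by positivity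
  refine ⟨K₂ * K₁ ^ (1 / q), by positivity, fun ε R T u hε hR hRT hu hsupp => ?_⟩
  have hR0 : 0 < R := by linarith
  have hRi : 0 < R⁻¹ := inv_pos.2 hR0
  have hRη := hη R hR0
  refine (S.waveMean_le_slabMass hα hc hJ0 hJ hRη hR0 hε hRT hu hsupp hpq).trans ?_
  have hfin : slabMass p r T R (η R) u ≠ ⊤ :=
    ne_top_of_le_ne_top (S.lintegral_rpow_ne_top hu r hRη) (slabMass_le _ _ _ _ _ _)
  set L : ℝ := ∫ s in (1 : ℝ)..((1 + c) * R), s ^ (-((α + 1 - ((N : ℝ) - 1) / 2) * q)) with hL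
  have hL0 : 0 ≤ L := integral_rpow_nonneg (by nlinarith) _
  rw [ENNReal.ofReal_mul (Real.rpow_nonneg ENNReal.toReal_nonneg _),
    ← ENNReal.ofReal_rpow_of_nonneg ENNReal.toReal_nonneg (by positivity),
    ENNReal.ofReal_toReal hfin]
  refine mul_le_mul_right ?_ _
  calc _ ≤ (∫⁻ z in coneSlab N r T R, (ENNReal.ofReal (K₂ * R⁻¹) * waveMean N (α + 1) c z) ^ q) ^
          (1 / q) := by
        refine ENNReal.rpow_le_rpow ?_ (by positivity)
        refine setLIntegral_mono' (measurableSet_coneSlab N r T R) fun z hz => ?_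
        refine ENNReal.rpow_le_rpow ?_ hq0.le
        have h1 := waveMean_le_mul_waveMean_add_one hr0 hc hR hz α
        calc _ ≤ ENNReal.ofReal (Cη * R⁻¹ ^ 2) * (ENNReal.ofReal ((2 + c + r) * R) *
                waveMean N (α + 1) c z) +
              ENNReal.ofReal (2 * α * (Cη * R⁻¹)) * waveMean N (α + 1) c z := by gcongr
          _ = ENNReal.ofReal (Cη * R⁻¹ ^ 2 * ((2 + c + r) * R) + 2 * α * (Cη * R⁻¹)) *
                waveMean N (α + 1) c z := by
              rw [ENNReal.ofReal_add (by positivity) (by positivity),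
                ENNReal.ofReal_mul (by positivity : 0 ≤ Cη * R⁻¹ ^ 2)]
              ring
          _ = _ := by
              congr 2
              rw [hK₂]
              field_simp
    _ = ENNReal.ofReal (K₂ * R⁻¹) * (∫⁻ z in coneSlab N r T R, waveMean N (α + 1) c z ^ q) ^
          (1 / q) := by
        simp only [ENNReal.mul_rpow_of_nonneg _ _ hq0.le]
        rw [lintegral_const_mul' _ _ (ENNReal.rpow_ne_top_of_nonneg hq0.le ENNReal.ofReal_ne_top),
          ENNReal.mul_rpow_of_nonneg _ _ (by positivity), ← ENNReal.rpow_mul, mul_one_div,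
          div_self hq0.ne', ENNReal.rpow_one]
    _ ≤ ENNReal.ofReal (K₂ * R⁻¹) * (ENNReal.ofReal (K₁ * (R ^ ((N : ℝ) - ((N : ℝ) - 1) / 2 * q) *
          L))) ^ (1 / q) := by
        gcongr
        exact hslab T r R hc hR
    _ = _ := by
        rw [ENNReal.ofReal_rpow_of_nonneg (by positivity) (by positivity),
          ← ENNReal.ofReal_mul (by positivity), Real.mul_rpow hK₁.le (by positivity)]
        congr 1
        ring

theorem integral_rpow_le_one {X e : ℝ} (hX : 1 ≤ X) (he : e ≤ -2) :
    ∫ s in (1 : ℝ)..X, s ^ e ≤ 1 := by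
  rw [integral_rpow (Or.inr ⟨by linarith, fun h => by
    rw [uIcc_of_le hX] at h; linarith [h.1]⟩), Real.one_rpow, div_le_iff_of_neg (by linarith)]
  have : 0 ≤ X ^ (e + 1) := Real.rpow_nonneg (by linarith) _
  linarith

/-- With p/q = p - 1 and q(p - 1) = p, the power of R is -p + N(p-1) - (N-1)p/2 = -(N - (N-1)p/2),
and the mass appears to the first power. -/
theorem rpow_test_exponent {N p q : ℝ} (hpq : p.HolderConjugate q) {I K R L : ℝ} (hI : 0 ≤ I)
    (hK : 0 ≤ K) (hR : 0 < R) (hL : 0 ≤ L) :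
    (I ^ (1 / p) * (K * R⁻¹ * (R ^ (N - (N - 1) / 2 * q) * L) ^ (1 / q))) ^ p =
      K ^ p * R ^ (-(N - (N - 1) / 2 * p)) * L ^ (p - 1) * I := by
  have hp0 : 0 < p := hpq.pos
  have hq0 : 0 < q := hpq.symm.pos
  have hpq1 : 1 / q * p = p - 1 := by
    have h3 := hpq.inv_add_inv_eq_one
    have h4 : 1 / q = 1 - p⁻¹ := by rw [one_div]; linarith
    rw [h4, sub_mul, one_mul, inv_mul_cancel₀ hp0.ne']
  have hqp : q * (p - 1) = p := by
    rw [← hpq1]; field_simp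
  rw [Real.mul_rpow (by positivity) (by positivity), Real.mul_rpow (by positivity) (by positivity),
    Real.mul_rpow hK (by positivity), ← Real.rpow_mul hI, one_div_mul_cancel hp0.ne',
    Real.rpow_one, ← Real.rpow_mul (by positivity), hpq1, Real.mul_rpow (by positivity) hL,
    ← Real.rpow_mul hR.le, ← Real.rpow_neg_one R, ← Real.rpow_mul hR.le]
  have h1 : R ^ (-(N - (N - 1) / 2 * p)) =
      R ^ (-1 * p) * R ^ ((N - (N - 1) / 2 * q) * (p - 1)) := by
    rw [← Real.rpow_add hR]
    congr 1
    have : (N - (N - 1) / 2 * q) * (p - 1) = N * (p - 1) - (N - 1) / 2 * (q * (p - 1)) := by ring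
    rw [this, hqp]
    ring
  rw [h1]
  ring

/-- Lower bound for the mass of `|u|^p` in a slab of the cone. -/
theorem IsBlowupSetting.exists_le_slabMass {N : ℕ} [NeZero N] {p a : ℝ} {G : ℝ → ℝ}
    {f g : EuclideanSpace ℝ (Fin N) → ℝ} (S : IsBlowupSetting p a G f g) {Cη : ℝ} (hCη : 0 < Cη)
    {η : ℝ → ℝ → ℝ} (hη : ∀ R > 0, IsTimeCutoff p Cη R (η R)) :
    ∃ k : ℝ, 0 < k ∧ ∀ (ε R : ℝ) (T : EReal) (u : EuclideanSpace ℝ (Fin N) → ℝ → ℝ), 0 < ε →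
      1 ≤ R → (R : EReal) < T → IsWeakSolution G f g ε T u →
      SupportedInCone (dataRadius f g) T u →
      k * ε ^ p * R ^ ((N : ℝ) - ((N : ℝ) - 1) / 2 * p) ≤
        (slabMass p (dataRadius f g) T R (η R) u).toReal := by
  have hpq : p.HolderConjugate (p.conjExponent) := Real.HolderConjugate.conjExponent S.one_lt
  set q := p.conjExponent
  have hp0 : 0 < p := hpq.pos
  have hq1 : 1 < q := hpq.symm.lt
  -- For α = (N+1)/2 one has α + 1 - (N-1)/2 = 2, so the radial integral has exponent -2q ≤ -2 and
  -- stays bounded by 1.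
  have hα : (0 : ℝ) ≤ ((N : ℝ) + 1) / 2 := by positivity
  obtain ⟨c, hc, J, hJ0, hJ⟩ := exists_initial_plane_wave_pos S.continuous_f S.compact_f
    S.continuous_g S.compact_g S.integral_pos hα
  obtain ⟨K, hK, hbound⟩ := S.exists_waveMean_test_bound hpq hCη hη hα (by linarith) hc hJ0.le hJ
  have hr0 := dataRadius_nonneg f g
  set r := dataRadius f g
  set s := (sphereMeasure N univ).toReal with hs
  have hs0 : 0 < s := ENNReal.toReal_pos (sphereMeasure_univ_pos N).ne' (measure_ne_top _ _)
  have hs' : sphereMeasure N univ = ENNReal.ofReal s := (ENNReal.ofReal_toReal (measure_ne_top _ _)).symm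
  refine ⟨(J * s) ^ p / K ^ p, by positivity, fun ε R T u hε hR hRT hu hsupp => ?_⟩
  have hR0 : 0 < R := by linarith
  set I := (slabMass p r T R (η R) u).toReal
  have hI0 : 0 ≤ I := ENNReal.toReal_nonneg
  have hX : 1 ≤ (1 + c) * R := by nlinarith
  have h1 := le_self_add.trans (hbound ε R T u hε hR hRT hu hsupp)
  set L := ∫ s in (1 : ℝ)..((1 + c) * R), s ^ (-((((N : ℝ) + 1) / 2 + 1 - ((N : ℝ) - 1) / 2) * q))
  have hL0 : 0 ≤ L := integral_rpow_nonneg hX _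
  have hL1 : L ≤ 1 := integral_rpow_le_one hX (by nlinarith)
  rw [hs', ← ENNReal.ofReal_mul (by positivity), ENNReal.ofReal_le_ofReal_iff (by positivity)] at h1
  have h2 := Real.rpow_le_rpow (by positivity) h1 hp0.le
  rw [rpow_test_exponent hpq hI0 hK.le hR0 hL0, mul_assoc, Real.mul_rpow hε.le (by positivity),
    Real.rpow_neg hR0.le] at h2
  have hL2 : L ^ (p - 1) ≤ 1 := Real.rpow_le_one hL0 hL1 hpq.sub_one_pos.le
  set w := R ^ ((N : ℝ) - ((N : ℝ) - 1) / 2 * p)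
  have hw : 0 < w := by positivity
  have hKp : 0 < K ^ p := by positivity
  have h3 : ε ^ p * (J * s) ^ p ≤ K ^ p * w⁻¹ * 1 * I := h2.trans (by gcongr)
  calc (J * s) ^ p / K ^ p * ε ^ p * w = ε ^ p * (J * s) ^ p * (w / K ^ p) := by ring
    _ ≤ K ^ p * w⁻¹ * 1 * I * (w / K ^ p) := by gcongr
    _ = I := by field_simp

/-! ### Dyadic recursion at the critical exponent -/

theorem disjoint_coneSlab {N : ℕ} {r : ℝ} {T : EReal} {R R' : ℝ} (h : R ≤ R' / 2) :
    Disjoint (coneSlab N r T R) (coneSlab N r T R') := by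
  rw [Set.disjoint_left]
  intro z hz hz'
  have h1 : z.2 ≤ R := hz.2.2
  have h2 : R' / 2 < z.2 := hz'.2.1
  linarith

theorem two_pow_le_half {i j : ℕ} (h : i < j) : (2 : ℝ) ^ i ≤ 2 ^ j / 2 := by
  have : (2 : ℝ) ^ (i + 1) ≤ 2 ^ j := pow_le_pow_right₀ (by norm_num) h
  rw [pow_succ] at this
  linarith

/-- The masses in dyadic slabs, weighted by the size of the spherical mean, add up to at most the
weighted integral over the cone. -/
theorem sum_slabMass_le {N : ℕ} [NeZero N] {p c r : ℝ} (hr : 0 ≤ r) (hc : r + 2 ≤ c) {β : ℝ}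
    (hβ : 0 ≤ β) {Cη : ℝ} {η : ℝ → ℝ → ℝ} (hη : ∀ R > 0, IsTimeCutoff p Cη R (η R))
    (T : EReal) (u : EuclideanSpace ℝ (Fin N) → ℝ → ℝ) (n : ℕ) :
    ∑ j ∈ Finset.Icc 1 n, ENNReal.ofReal (((2 + c + r) * 2 ^ j) ^ (-β)) * sphereMeasure N univ *
      slabMass p r T (2 ^ j) (η (2 ^ j)) u ≤
    ∫⁻ z in coneRegion N r T, ‖u z.1 z.2‖ₑ ^ p * ENNReal.ofReal (η (2 ^ n) z.2) *
      waveMean N β c z := by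
  have hdisj : (↑(Finset.Icc 1 n) : Set ℕ).PairwiseDisjoint
      (fun j => coneSlab N r T (2 ^ j)) := by
    intro i _ j _ hij
    rcases lt_or_gt_of_ne hij with h | h
    · exact disjoint_coneSlab (two_pow_le_half h)
    · exact (disjoint_coneSlab (two_pow_le_half h)).symm
  have hsub : (⋃ j ∈ Finset.Icc 1 n, coneSlab N r T (2 ^ j)) ⊆ coneRegion N r T :=
    iUnion₂_subset fun j _ => inter_subset_left
  refine le_trans ?_ (lintegral_mono_set hsub)
  rw [lintegral_biUnion_finset hdisj fun j _ => measurableSet_coneSlab N r T _]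
  refine Finset.sum_le_sum fun j hj => ?_
  rw [Finset.mem_Icc] at hj
  rw [slabMass, ← lintegral_const_mul' _ _
    (ENNReal.mul_ne_top ENNReal.ofReal_ne_top (measure_ne_top _ _))]
  refine setLIntegral_mono' (measurableSet_coneSlab N r T _) fun z hz => ?_
  have h1 := le_waveMean hr hc (one_le_pow₀ (by norm_num)) hz hβ
  -- For j < n the slab at scale 2^j lies in t ≤ 2^n/2, where the larger cut-off equals 1.
  have h2 : η (2 ^ j) z.2 ≤ η (2 ^ n) z.2 := by
    rcases eq_or_lt_of_le hj.2 with rfl | hlt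
    · exact le_rfl
    · rw [(hη (2 ^ n) (by positivity)).eq_one z.2 ?_]
      · exact (hη (2 ^ j) (by positivity)).le_one _
      · have h3 : z.2 ≤ 2 ^ j := hz.2.2
        rw [abs_of_nonneg hz.1.1.1]
        exact h3.trans (two_pow_le_half hlt)
  rw [mul_comm]
  gcongr

/-- The recursive inequality between dyadic masses at the critical exponent. -/
theorem IsBlowupSetting.exists_critical_recursion {N : ℕ} [NeZero N] {p a : ℝ} {G : ℝ → ℝ}
    {f g : EuclideanSpace ℝ (Fin N) → ℝ} (S : IsBlowupSetting p a G f g) {Cη : ℝ} (hCη : 0 < Cη)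
    {η : ℝ → ℝ → ℝ} (hη : ∀ R > 0, IsTimeCutoff p Cη R (η R)) {β : ℝ} (hβ0 : 0 ≤ β)
    (hβ : β = ((N : ℝ) - 1) / 2 - 1 / p) (hβ' : β = (N : ℝ) - ((N : ℝ) - 1) / 2 * p) :
    ∃ K : ℝ, 0 < K ∧ ∀ (ε : ℝ) (n : ℕ) (T : EReal) (u : EuclideanSpace ℝ (Fin N) → ℝ → ℝ),
      0 < ε → 1 ≤ n → (((2 : ℝ) ^ n : ℝ) : EReal) < T → IsWeakSolution G f g ε T u →
      SupportedInCone (dataRadius f g) T u →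
      (∑ j ∈ Finset.Icc 1 n, ((2 : ℝ) ^ j) ^ (-β) *
        (slabMass p (dataRadius f g) T (2 ^ j) (η (2 ^ j)) u).toReal) ^ p ≤
      K * (n : ℝ) ^ (p - 1) * (((2 : ℝ) ^ n) ^ (-β) *
        (slabMass p (dataRadius f g) T (2 ^ n) (η (2 ^ n)) u).toReal) := by
  have hpq : p.HolderConjugate (p.conjExponent) := Real.HolderConjugate.conjExponent S.one_lt
  set q := p.conjExponent
  have hp0 : 0 < p := hpq.pos
  have hq0 : 0 < q := hpq.symm.pos
  obtain ⟨c, hc, J, hJ0, hJ⟩ := exists_initial_plane_wave_pos S.continuous_f S.compact_f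
    S.continuous_g S.compact_g S.integral_pos hβ0
  have hp1 : 1 / p < 1 := (div_lt_one hp0).2 S.one_lt
  obtain ⟨K, hK, hbound⟩ := S.exists_waveMean_test_bound hpq hCη hη hβ0 (by rw [hβ]; linarith) hc
    hJ0.le hJ
  have hr0 := dataRadius_nonneg f g
  set r := dataRadius f g
  set s := (sphereMeasure N univ).toReal with hs
  have hs0 : 0 < s := ENNReal.toReal_pos (sphereMeasure_univ_pos N).ne' (measure_ne_top _ _)
  have hs' : sphereMeasure N univ = ENNReal.ofReal s := (ENNReal.ofReal_toReal (measure_ne_top _ _)).symm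
  have ha := S.pos
  have hc0 : 0 < c := by linarith
  set k := a * s * (2 + c + r) ^ (-β) with hk
  have hk0 : 0 < k := by positivity
  have hlogc : 0 ≤ Real.log (1 + c) := Real.log_nonneg (by linarith)
  refine ⟨K ^ p * (Real.log (1 + c) + 1) ^ (p - 1) / k ^ p, by positivity,
    fun ε n T u hε hn hRT hu hsupp => ?_⟩
  set R : ℝ := 2 ^ n with hRdef
  have hR : 1 ≤ R := one_le_pow₀ (by norm_num)
  have hR0 : 0 < R := by linarith
  have h1 := (le_add_self).trans (hbound ε R T u hε hR hRT hu hsupp)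
  -- The exponent is (1 - 1/p)q = 1, so the radial integral is a logarithm: `log ((1+c) 2^n)`, which
  -- grows linearly in n.
  have hκ : -((β + 1 - ((N : ℝ) - 1) / 2) * q) = -1 := by
    rw [hβ]
    have h3 := hpq.inv_add_inv_eq_one
    have h4 : 1 - 1 / p = 1 / q := by rw [one_div, one_div]; linarith
    rw [show ((N : ℝ) - 1) / 2 - 1 / p + 1 - ((N : ℝ) - 1) / 2 = 1 - 1 / p by ring, h4,
      one_div_mul_cancel hq0.ne']
  have hX : 1 ≤ (1 + c) * R := by nlinarith
  set I : ℕ → ℝ := fun j => (slabMass p r T (2 ^ j) (η (2 ^ j)) u).toReal with hI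
  have hI0 : ∀ j, 0 ≤ I j := fun j => ENNReal.toReal_nonneg
  have hI' : ∀ j, slabMass p r T (2 ^ j) (η (2 ^ j)) u = ENNReal.ofReal (I j) := fun j =>
    (ENNReal.ofReal_toReal (ne_top_of_le_ne_top
      (S.lintegral_rpow_ne_top hu r (hη (2 ^ j) (by positivity))) (slabMass_le _ _ _ _ _ _))).symm
  rw [hκ] at h1
  set L := ∫ s in (1 : ℝ)..((1 + c) * R), s ^ (-1 : ℝ) with hL
  have hL0 : 0 ≤ L := integral_rpow_nonneg hX _
  have hn1 : (1 : ℝ) ≤ n := by exact_mod_cast hn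
  have hLn : L ≤ (Real.log (1 + c) + 1) * n := by
    have : L = Real.log ((1 + c) * R) := by
      rw [hL]
      simp only [Real.rpow_neg_one]
      rw [integral_inv_of_pos one_pos (by linarith), div_one]
    rw [this, Real.log_mul (by linarith) hR0.ne', hRdef, Real.log_pow]
    have := Real.log_two_lt_d9
    have h5 : Real.log (1 + c) ≤ Real.log (1 + c) * n := le_mul_of_one_le_right hlogc hn1
    nlinarith
  set A : ℕ → ℝ := fun j => ((2 : ℝ) ^ j) ^ (-β) * I j with hA
  have hA0 : ∀ j, 0 ≤ A j := fun j => mul_nonneg (by positivity) (hI0 j)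
  have hsum : ENNReal.ofReal (k * ∑ j ∈ Finset.Icc 1 n, A j) ≤
      ENNReal.ofReal (I n ^ (1 / p) * (K * R⁻¹ * (R ^ ((N : ℝ) - ((N : ℝ) - 1) / 2 * q) * L) ^
        (1 / q))) := by
    refine le_trans (le_of_eq ?_) ((mul_le_mul_right (sum_slabMass_le hr0 hc hβ0 hη T u n)
      (ENNReal.ofReal a)).trans h1)
    rw [Finset.mul_sum, Finset.mul_sum, ENNReal.ofReal_sum_of_nonneg
      (fun j _ => mul_nonneg hk0.le (hA0 j))]
    refine Finset.sum_congr rfl fun j _ => ?_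
    rw [hI' j, hs', ← ENNReal.ofReal_mul (by positivity), ← ENNReal.ofReal_mul (by positivity),
      ← ENNReal.ofReal_mul (by positivity)]
    congr 1
    rw [hk, hA, Real.mul_rpow (by positivity) (by positivity)]
    ring
  have hS0 : 0 ≤ ∑ j ∈ Finset.Icc 1 n, A j := Finset.sum_nonneg fun j _ => hA0 j
  have hIn := hI0 n
  rw [ENNReal.ofReal_le_ofReal_iff (by positivity)] at hsum
  have h2 := Real.rpow_le_rpow (by positivity) hsum hp0.le
  -- The second expression for β is the exponent of R here, so the current mass appears with the
  -- same weight R^(-β) as in the sum.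
  rw [rpow_test_exponent hpq hIn hK.le hR0 hL0, Real.mul_rpow hk0.le hS0, ← hβ'] at h2
  have hL2 : L ^ (p - 1) ≤ (Real.log (1 + c) + 1) ^ (p - 1) * (n : ℝ) ^ (p - 1) := by
    rw [← Real.mul_rpow (by positivity) (by positivity)]
    exact Real.rpow_le_rpow hL0 hLn hpq.sub_one_pos.le
  have hkp : 0 < k ^ p := by positivity
  change (∑ j ∈ Finset.Icc 1 n, A j) ^ p ≤ _ * (R ^ (-β) * I n)
  rw [div_mul_eq_mul_div, div_mul_eq_mul_div, le_div_iff₀ hkp, mul_comm]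
  calc _ ≤ _ := h2
    _ ≤ K ^ p * R ^ (-β) * ((Real.log (1 + c) + 1) ^ (p - 1) * (n : ℝ) ^ (p - 1)) * I n := by
        gcongr
    _ = _ := by ring

/-- The function s^(1-p) is convex on s > 0, so its value at x lies above its tangent line at y. -/
theorem rpow_sub_rpow_ge {p x y : ℝ} (hp : 1 < p) (hx : 0 < x) (hy : 0 < y) :
    (p - 1) * y ^ (-p) * (y - x) ≤ x ^ (1 - p) - y ^ (1 - p) := by
  have hv : 0 < x / y := div_pos hx hy
  have h1 : 1 + (1 - p) * (x / y - 1) ≤ (x / y) ^ (1 - p) := by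
    have h2 := Real.add_one_le_exp (Real.log (x / y) * (1 - p))
    rw [← Real.rpow_def_of_pos hv] at h2
    have h3 := Real.log_le_sub_one_of_pos hv
    nlinarith
  rw [Real.div_rpow hx.le hy.le, le_div_iff₀ (by positivity)] at h1
  have h4 : y ^ (1 - p) = y * y ^ (-p) := by
    rw [sub_eq_add_neg, Real.rpow_add hy, Real.rpow_one]
  have h5 : (1 + (1 - p) * (x / y - 1)) * y ^ (1 - p) =
      y ^ (1 - p) + (p - 1) * y ^ (-p) * (y - x) := by
    rw [h4]; field_simp; ring
  linarith

/-- A discrete differential inequality with a linear lower bound can hold only for a bounded number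
of steps. -/
theorem exists_length_le_of_recursion {p k K : ℝ} (hp : 1 < p) (hk : 0 < k) (hK : 0 < K) :
    ∃ C : ℝ, 0 < C ∧ ∀ (δ : ℝ) (M : ℕ) (A : ℕ → ℝ), 0 < δ →
      (∀ n, 1 ≤ n → n ≤ M → k * δ ≤ A n) →
      (∀ n, 1 ≤ n → n ≤ M → (∑ j ∈ Finset.Icc 1 n, A j) ^ p ≤ K * (n : ℝ) ^ (p - 1) * A n) →
      (M : ℝ) ≤ C * δ ^ (1 - p) + 1 := by
  have hp1 : 0 < p - 1 := by linarith
  set C₀ := k ^ (1 - p) * K * 2 ^ (p - 1) / (p - 1) with hC₀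
  have hC₀0 : 0 < C₀ := by positivity
  refine ⟨3 * C₀, by positivity, fun δ M A hδ hlow hrec => ?_⟩
  -- Up to step m the linear lower bound makes the partial sum σ at least m k δ. From m to 2m the
  -- recursion then lowers σ^(1-p), which must stay positive.
  set m := M / 2 with hm
  rcases Nat.eq_zero_or_pos m with h0 | hmpos
  · have hM : M ≤ 1 := by omega
    have : (M : ℝ) ≤ 1 := by exact_mod_cast hM
    have : 0 < 3 * C₀ * δ ^ (1 - p) := by positivity
    linarith
  have hm1 : (1 : ℝ) ≤ m := by exact_mod_cast hmpos
  have hm0 : (0 : ℝ) < m := by linarith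
  set σ : ℕ → ℝ := fun n => ∑ j ∈ Finset.Icc 1 n, A j with hσ
  have hstep : ∀ n, σ (n + 1) = σ n + A (n + 1) := fun n =>
    Finset.sum_Icc_succ_top (Nat.le_add_left 1 n) A
  have hσlow : ∀ n, n ≤ M → n * (k * δ) ≤ σ n := by
    intro n hn
    induction n with
    | zero => simp [hσ]
    | succ n ih =>
      have h1 := ih (by omega)
      have h2 := hlow (n + 1) (by omega) hn
      rw [hstep]; push_cast; linarith
  have hσpos : ∀ n, 1 ≤ n → n ≤ M → 0 < σ n := by
    intro n h1 h2
    have : (1 : ℝ) ≤ n := by exact_mod_cast h1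
    exact lt_of_lt_of_le (by positivity) (hσlow n h2)
  -- The least decrease of σ^(1-p) per step: (p-1) σ_n^(-p) A_n ≥ (p-1) K⁻¹ n^(1-p), and n ≤ 2m.
  set d := (p - 1) * K⁻¹ * (2 * (m : ℝ)) ^ (1 - p) with hd
  have hd0 : 0 < d := by positivity
  have hdec : ∀ i, i ≤ m → (i : ℝ) * d ≤ σ m ^ (1 - p) - σ (m + i) ^ (1 - p) := by
    intro i hi
    induction i with
    | zero => simp
    | succ i ih =>
      have h1 := ih (by omega)
      have hle : m + i + 1 ≤ M := by omega
      have hx := hσpos (m + i) (by omega) (by omega)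
      have hy := hσpos (m + i + 1) (by omega) hle
      have h2 := rpow_sub_rpow_ge hp hx hy
      have h3 := hrec (m + i + 1) (by omega) hle
      have hA : σ (m + i + 1) - σ (m + i) = A (m + i + 1) := by rw [hstep]; ring
      rw [hA] at h2
      have hcast : ((m + i + 1 : ℕ) : ℝ) ≤ 2 * m := by
        have : m + i + 1 ≤ 2 * m := by omega
        exact_mod_cast this
      have hcast0 : (0 : ℝ) < ((m + i + 1 : ℕ) : ℝ) := by positivity
      have h4 : d ≤ (p - 1) * σ (m + i + 1) ^ (-p) * A (m + i + 1) := by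
        have e1 : (2 * (m : ℝ)) ^ (1 - p) ≤ ((m + i + 1 : ℕ) : ℝ) ^ (1 - p) :=
          Real.rpow_le_rpow_of_nonpos hcast0 hcast (by linarith)
        have e2 : K⁻¹ * ((m + i + 1 : ℕ) : ℝ) ^ (1 - p) ≤
            σ (m + i + 1) ^ (-p) * A (m + i + 1) := by
          rw [Real.rpow_neg hy.le, show (1 - p) = -(p - 1) by ring, Real.rpow_neg hcast0.le,
            ← mul_inv, ← one_div, ← div_eq_inv_mul, div_le_div_iff₀ (by positivity) (by positivity)]
          linarith
        calc d ≤ (p - 1) * K⁻¹ * ((m + i + 1 : ℕ) : ℝ) ^ (1 - p) := by rw [hd]; gcongr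
          _ = (p - 1) * (K⁻¹ * ((m + i + 1 : ℕ) : ℝ) ^ (1 - p)) := by ring
          _ ≤ (p - 1) * (σ (m + i + 1) ^ (-p) * A (m + i + 1)) := by gcongr
          _ = _ := by ring
      rw [← add_assoc]
      push_cast
      linarith
  have hfin := hdec m le_rfl
  have hmm := hσpos m hmpos (by omega)
  have h2m : 0 ≤ σ (m + m) ^ (1 - p) := (Real.rpow_pos_of_pos (hσpos (m + m) (by omega) (by omega)) _).le
  have hup : σ m ^ (1 - p) ≤ (m * (k * δ)) ^ (1 - p) :=
    Real.rpow_le_rpow_of_nonpos (by positivity) (hσlow m (by omega)) (by linarith)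
  have hall : (m : ℝ) * d ≤ (m * (k * δ)) ^ (1 - p) := by linarith
  rw [hd, Real.mul_rpow (by norm_num) hm0.le, Real.mul_rpow hm0.le (by positivity),
    Real.mul_rpow hk.le hδ.le] at hall
  have hmp : 0 < (m : ℝ) ^ (1 - p) := by positivity
  have h2p : (2 : ℝ) ^ (1 - p) = ((2 : ℝ) ^ (p - 1))⁻¹ := by
    rw [show (1 - p) = -(p - 1) by ring, Real.rpow_neg (by norm_num)]
  -- The m steps give m d ≤ (m k δ)^(1-p). The factor m^(1-p) is common to both sides and cancels,
  -- leaving a bound for m itself.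
  have hmle : (m : ℝ) ≤ C₀ * δ ^ (1 - p) := by
    have h6 : (m : ℝ) * ((p - 1) * K⁻¹ * (2 : ℝ) ^ (1 - p)) ≤ k ^ (1 - p) * δ ^ (1 - p) := by
      refine le_of_mul_le_mul_right ?_ hmp
      linarith
    rw [h2p] at h6
    have h2pos : 0 < (2 : ℝ) ^ (p - 1) := by positivity
    calc (m : ℝ) = (m : ℝ) * ((p - 1) * K⁻¹ * ((2 : ℝ) ^ (p - 1))⁻¹) * (K * 2 ^ (p - 1) / (p - 1)) := by
          field_simp
      _ ≤ k ^ (1 - p) * δ ^ (1 - p) * (K * 2 ^ (p - 1) / (p - 1)) := by gcongr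
      _ = _ := by rw [hC₀]; ring
  have hM : (M : ℝ) ≤ 2 * m + 1 := by
    have : M ≤ 2 * m + 1 := by omega
    exact_mod_cast this
  have : 0 < C₀ * δ ^ (1 - p) := by positivity
  linarith

/-! ### Life span bounds -/

/-- The test function bounds hold for R ≥ 1 with R < T. Since B ≥ 1, a real number strictly between
B and T would be such an R, which also excludes T = ∞. -/
theorem EReal.le_coe_of_forall_lt {T : EReal} {B : ℝ} (hB : 1 ≤ B)
    (h : ∀ R : ℝ, 1 ≤ R → (R : EReal) < T → R ≤ B) : T ≤ (B : EReal) := by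
  by_contra hcon
  obtain ⟨R, h1, h2⟩ := EReal.lt_iff_exists_real_btwn.1 (not_le.1 hcon)
  have h3 : B < R := EReal.coe_lt_coe_iff.1 h1
  exact absurd (h R (hB.trans h3.le) h2) (not_le.2 h3)

theorem le_rpow_of_le_rpow_neg {ε K R e : ℝ} (hε : 0 < ε) (hR : 0 < R) (hK : 0 < K) (he : 0 < e)
    (h : ε ≤ K * R ^ (-e)) : R ≤ K ^ (1 / e) * ε ^ (-(1 / e)) := by
  rw [Real.rpow_neg hR.le, ← div_eq_mul_inv, le_div_iff₀ (by positivity)] at h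
  have h1 : R ^ e ≤ K / ε := by rw [le_div_iff₀ hε]; linarith
  have h2 := Real.rpow_le_rpow (by positivity) h1 (by positivity : 0 ≤ 1 / e)
  rwa [← Real.rpow_mul hR.le, mul_one_div_cancel he.ne', Real.rpow_one,
    Real.div_rpow hK.le hε.le, div_eq_mul_inv, ← Real.rpow_neg hε.le] at h2

theorem one_le_mul_rpow_neg {C ε e : ℝ} (hC : 1 ≤ C) (hε : 0 < ε) (hε1 : ε ≤ 1) (he : 0 ≤ e) :
    1 ≤ C * ε ^ (-e) :=
  one_le_mul_of_one_le_of_one_le hC (Real.one_le_rpow_of_pos_of_le_one_of_nonpos hε hε1 (by linarith))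

/-- Life span bound from the test function that depends on time only. -/
theorem IsBlowupSetting.exists_lifespan_le_of_time_test {N : ℕ} [NeZero N] {p a : ℝ} {G : ℝ → ℝ}
    {f g : EuclideanSpace ℝ (Fin N) → ℝ} (S : IsBlowupSetting p a G f g) {e : ℝ} (he : 0 < e)
    (hep : 1 / e = 2 * p / (p - 1) - ((N : ℝ) + 1)) :
    ∃ C : ℝ, 0 < C ∧ ∀ (ε : ℝ), 0 < ε → ε ≤ 1 → ∀ (T : EReal)
      (u : EuclideanSpace ℝ (Fin N) → ℝ → ℝ), IsWeakSolution G f g ε T u →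
      SupportedInCone (dataRadius f g) T u → T ≤ ((C * ε ^ (-e) : ℝ) : EReal) := by
  obtain ⟨Cη, hCη, η, hη⟩ := exists_isTimeCutoff S.one_lt
  have hpq : p.HolderConjugate (p.conjExponent) := Real.HolderConjugate.conjExponent S.one_lt
  obtain ⟨K, hK, hbound⟩ := S.exists_time_test_bound hpq hCη hη
  refine ⟨max 1 (K ^ e), by positivity, fun ε hε hε1 T u hu hsupp => ?_⟩
  refine EReal.le_coe_of_forall_lt (one_le_mul_rpow_neg (le_max_left _ _) hε hε1 he.le)
    fun R hR hRT => ?_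
  have h1 := (hbound ε R T u hε hR hRT hu hsupp).1
  have hexp : (N : ℝ) + 1 - 2 * p.conjExponent = -(1 / e) := by
    rw [hep, Real.conjExponent]; ring
  rw [hexp] at h1
  have h2 := le_rpow_of_le_rpow_neg hε (by linarith) hK (by positivity) h1
  rw [one_div_one_div] at h2
  refine h2.trans ?_
  gcongr
  exact le_max_right _ _

/-- Life span bound in the subcritical case. -/
theorem IsBlowupSetting.exists_lifespan_le_of_subcritical {N : ℕ} [NeZero N] {p a : ℝ} {G : ℝ → ℝ}
    {f g : EuclideanSpace ℝ (Fin N) → ℝ} (S : IsBlowupSetting p a G f g)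
    (hΓ : 0 < GammaS N p) :
    ∃ C : ℝ, 0 < C ∧ ∀ (ε : ℝ), 0 < ε → ε ≤ 1 → ∀ (T : EReal)
      (u : EuclideanSpace ℝ (Fin N) → ℝ → ℝ), IsWeakSolution G f g ε T u →
      SupportedInCone (dataRadius f g) T u → T ≤ ((C * ε ^ (-(GammaS N p)⁻¹) : ℝ) : EReal) := by
  obtain ⟨Cη, hCη, η, hη⟩ := exists_isTimeCutoff S.one_lt
  have hpq : p.HolderConjugate (p.conjExponent) := Real.HolderConjugate.conjExponent S.one_lt
  have hp0 : 0 < p := hpq.pos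
  have hp1 : p - 1 ≠ 0 := hpq.sub_one_pos.ne'
  obtain ⟨K, hK, hbound⟩ := S.exists_time_test_bound hpq hCη hη
  obtain ⟨k, hk, hlow⟩ := S.exists_le_slabMass hCη hη
  set Γ := GammaS N p with hΓdef
  refine ⟨max 1 ((K / k) ^ (1 / (p * Γ))), by positivity, fun ε hε hε1 T u hu hsupp => ?_⟩
  refine EReal.le_coe_of_forall_lt (one_le_mul_rpow_neg (le_max_left _ _) hε hε1
    (inv_nonneg.2 hΓ.le)) fun R hR hRT => ?_
  have hR0 : 0 < R := by linarith
  have h1 := (hlow ε R T u hε hR hRT hu hsupp).trans (hbound ε R T u hε hR hRT hu hsupp).2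
  -- The gap between the upper and lower exponents of the slab mass is exactly -pΓ_S.
  have hexp : (N : ℝ) + 1 - 2 * p.conjExponent =
      -(p * Γ) + ((N : ℝ) - ((N : ℝ) - 1) / 2 * p) := by
    rw [hΓdef, GammaS, Real.conjExponent]
    field_simp
    ring
  rw [hexp, Real.rpow_add hR0, ← mul_assoc] at h1
  have h2 := le_of_mul_le_mul_right h1 (by positivity)
  have h3 : ε ^ p ≤ K / k * R ^ (-(p * Γ)) := by
    rw [div_mul_eq_mul_div, le_div_iff₀ hk]; linarith
  have h4 := le_rpow_of_le_rpow_neg (by positivity) hR0 (by positivity) (by positivity) h3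
  rw [← Real.rpow_mul hε.le] at h4
  have h5 : p * -(1 / (p * Γ)) = -Γ⁻¹ := by field_simp
  rw [h5] at h4
  refine h4.trans ?_
  gcongr
  exact le_max_right _ _

/-- Life span bound in the critical case. -/
theorem IsBlowupSetting.exists_lifespan_le_of_critical {N : ℕ} [NeZero N] (hN : 2 ≤ N) {p a : ℝ}
    {G : ℝ → ℝ} {f g : EuclideanSpace ℝ (Fin N) → ℝ} (S : IsBlowupSetting p a G f g)
    (hγ : gammaS N p = 0) :
    ∃ C : ℝ, 0 < C ∧ ∀ (ε : ℝ), 0 < ε → ε ≤ 1 → ∀ (T : EReal)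
      (u : EuclideanSpace ℝ (Fin N) → ℝ → ℝ), IsWeakSolution G f g ε T u →
      SupportedInCone (dataRadius f g) T u →
      T ≤ ((Real.exp (C * ε ^ (-(p * (p - 1)))) : ℝ) : EReal) := by
  obtain ⟨Cη, hCη, η, hη⟩ := exists_isTimeCutoff S.one_lt
  have hp0 : 0 < p := by linarith [S.one_lt]
  have hp1 : 0 < p - 1 := by linarith [S.one_lt]
  have hN2 : (2 : ℝ) ≤ N := by exact_mod_cast hN
  unfold gammaS at hγ
  set β := ((N : ℝ) - 1) / 2 - 1 / p with hβ
  -- The difference of the two expressions for β is γ_S/(2p) up to sign, so they agree exactly at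
  -- the critical exponent.
  have hβ' : β = (N : ℝ) - ((N : ℝ) - 1) / 2 * p := by
    rw [hβ]; field_simp; linarith
  -- From (N-1)p² = 2 + (N+1)p follows (N-1)p ≥ N+1 ≥ 2, that is 1/p ≤ (N-1)/2.
  have hβ0 : 0 ≤ β := by
    have h1 : (N : ℝ) + 1 ≤ ((N : ℝ) - 1) * p := by
      refine le_of_mul_le_mul_right ?_ hp0
      linarith
    rw [hβ, sub_nonneg, div_le_div_iff₀ hp0 two_pos]
    linarith
  obtain ⟨k, hk, hlow⟩ := S.exists_le_slabMass hCη hη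
  obtain ⟨K, hK, hrec⟩ := S.exists_critical_recursion hCη hη hβ0 hβ hβ'
  obtain ⟨C, hC, hlen⟩ := exists_length_le_of_recursion S.one_lt hk hK
  -- With 2^n ≤ R < 2^(n+1), n is at most C ε^(-p(p-1)) + 1. The 2 absorbs this 1 and the one from
  -- 2^(n+1), since ε^(-p(p-1)) ≥ 1.
  refine ⟨C + 2, by positivity, fun ε hε hε1 T u hu hsupp => ?_⟩
  have hε2 : 1 ≤ ε ^ (-(p * (p - 1))) :=
    Real.one_le_rpow_of_pos_of_le_one_of_nonpos hε hε1 (by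
      have : 0 < p * (p - 1) := by positivity
      linarith)
  refine EReal.le_coe_of_forall_lt (Real.one_le_exp (by positivity)) fun R hR hRT => ?_
  obtain ⟨n, hn1, hn2⟩ := exists_nat_pow_near hR one_lt_two
  have hlt : ∀ j, j ≤ n → (((2 : ℝ) ^ j : ℝ) : EReal) < T := fun j hj =>
    (EReal.coe_le_coe_iff.2 ((pow_le_pow_right₀ (by norm_num) hj).trans hn1)).trans_lt hRT
  have hn := hlen (ε ^ p) n (fun j => ((2 : ℝ) ^ j) ^ (-β) *
      (slabMass p (dataRadius f g) T (2 ^ j) (η (2 ^ j)) u).toReal) (by positivity)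
    (fun j _ hj => by
      have h1 := hlow ε (2 ^ j) T u hε (one_le_pow₀ (by norm_num)) (hlt j hj) hu hsupp
      rw [← hβ'] at h1
      rw [Real.rpow_neg (by positivity), ← div_eq_inv_mul, le_div_iff₀ (by positivity)]
      exact h1)
    (fun j hj1 hj => hrec ε j T u hε hj1 (hlt j hj) hu hsupp)
  rw [← Real.rpow_mul hε.le, show p * (1 - p) = -(p * (p - 1)) by ring] at hn
  have h2e : (2 : ℝ) ≤ Real.exp 1 := by
    have := Real.add_one_le_exp (1 : ℝ)
    linarith
  calc R ≤ 2 ^ (n + 1) := hn2.le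
    _ ≤ Real.exp 1 ^ (n + 1) := by gcongr
    _ = Real.exp ((n : ℝ) + 1) := by rw [← Real.exp_nat_mul]; push_cast; ring_nf
    _ ≤ _ := by
      refine Real.exp_le_exp.2 ?_
      nlinarith

end

theorem mainTheorem3 (N : ℕ) (hN : 1 ≤ N) (p : ℝ) (hp : 1 < p) (hΓ : 0 ≤ GammaS N p)
    (a : ℝ) (ha : 0 < a) (G : ℝ → ℝ) (hG : ContDiff ℝ 1 G) (hG0 : G 0 = 0)
    (hGp : ∀ s : ℝ, a * |s| ^ p ≤ G s)
    (f g : EuclideanSpace ℝ (Fin N) → ℝ)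
    (hf : ContDiff ℝ ∞ f) (hfc : HasCompactSupport f)
    (hg : ContDiff ℝ ∞ g) (hgc : HasCompactSupport g)
    (hI : 0 < ∫ x, g x) :
    ∃ ε₀ > (0 : ℝ), ∃ C > (0 : ℝ), ∀ ε : ℝ, 0 < ε → ε ≤ ε₀ →
      ∀ (T : EReal), 0 < T → ∀ u : EuclideanSpace ℝ (Fin N) → ℝ → ℝ,
        IsWeakSolution G f g ε T u → SupportedInCone (dataRadius f g) T u →
          (N = 1 → T ≤ ((C * ε ^ (-((p - 1) / 2)) : ℝ) : EReal)) ∧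
          (N = 2 → p ≤ 2 → T ≤ ((C * ε ^ (-((p - 1) / (3 - p))) : ℝ) : EReal)) ∧
          (N = 2 → 2 < p → (p : EReal) < straussExponent 2 →
            T ≤ ((C * ε ^ (-(GammaS 2 p)⁻¹) : ℝ) : EReal)) ∧
          (3 ≤ N → (p : EReal) < straussExponent N →
            T ≤ ((C * ε ^ (-(GammaS N p)⁻¹) : ℝ) : EReal)) ∧
          (2 ≤ N → (p : EReal) = straussExponent N →
            T ≤ ((Real.exp (C * ε ^ (-(p * (p - 1)))) : ℝ) : EReal)) := by
  have : NeZero N := ⟨by omega⟩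
  have S : IsBlowupSetting p a G f g :=
    ⟨hp, ha, hGp, hf.continuous, hfc, hg.continuous, hgc, hI⟩
  have hp1 : 0 < p - 1 := by linarith
  have h1 : ∃ C : ℝ, 0 < C ∧ (N = 1 → ∀ ε : ℝ, 0 < ε → ε ≤ 1 → ∀ (T : EReal)
      (u : EuclideanSpace ℝ (Fin N) → ℝ → ℝ), IsWeakSolution G f g ε T u →
      SupportedInCone (dataRadius f g) T u →
      T ≤ ((C * ε ^ (-((p - 1) / 2)) : ℝ) : EReal)) := by
    by_cases h : N = 1
    · obtain ⟨C, hC, hB⟩ := S.exists_lifespan_le_of_time_test (e := (p - 1) / 2) (by positivity)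
        (by subst h; push_cast; field_simp; ring)
      exact ⟨C, hC, fun _ => hB⟩
    · exact ⟨1, one_pos, fun h' => absurd h' h⟩
  have h2 : ∃ C : ℝ, 0 < C ∧ (N = 2 → p ≤ 2 → ∀ ε : ℝ, 0 < ε → ε ≤ 1 → ∀ (T : EReal)
      (u : EuclideanSpace ℝ (Fin N) → ℝ → ℝ), IsWeakSolution G f g ε T u →
      SupportedInCone (dataRadius f g) T u →
      T ≤ ((C * ε ^ (-((p - 1) / (3 - p))) : ℝ) : EReal)) := by
    by_cases h : N = 2 ∧ p ≤ 2
    · have h3 : 0 < 3 - p := by linarith [h.2]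
      obtain ⟨C, hC, hB⟩ := S.exists_lifespan_le_of_time_test (e := (p - 1) / (3 - p))
        (by positivity) (by rw [h.1]; push_cast; field_simp; ring)
      exact ⟨C, hC, fun _ _ => hB⟩
    · exact ⟨1, one_pos, fun h' h'' => absurd ⟨h', h''⟩ h⟩
  have h3 : ∃ C : ℝ, 0 < C ∧ ((p : EReal) < straussExponent N → ∀ ε : ℝ, 0 < ε → ε ≤ 1 →
      ∀ (T : EReal) (u : EuclideanSpace ℝ (Fin N) → ℝ → ℝ), IsWeakSolution G f g ε T u →
      SupportedInCone (dataRadius f g) T u →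
      T ≤ ((C * ε ^ (-(GammaS N p)⁻¹) : ℝ) : EReal)) := by
    by_cases h : (p : EReal) < straussExponent N
    · obtain ⟨C, hC, hB⟩ := S.exists_lifespan_le_of_subcritical
        (GammaS_pos_of_lt_straussExponent N hN hp h)
      exact ⟨C, hC, fun _ => hB⟩
    · exact ⟨1, one_pos, fun h' => absurd h' h⟩
  have h4 : ∃ C : ℝ, 0 < C ∧ (2 ≤ N → (p : EReal) = straussExponent N → ∀ ε : ℝ, 0 < ε → ε ≤ 1 →
      ∀ (T : EReal) (u : EuclideanSpace ℝ (Fin N) → ℝ → ℝ), IsWeakSolution G f g ε T u →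
      SupportedInCone (dataRadius f g) T u →
      T ≤ ((Real.exp (C * ε ^ (-(p * (p - 1)))) : ℝ) : EReal)) := by
    by_cases h : 2 ≤ N ∧ (p : EReal) = straussExponent N
    · obtain ⟨C, hC, hB⟩ := S.exists_lifespan_le_of_critical h.1
        (gammaS_eq_zero_of_eq_straussExponent N hp hΓ h.2)
      exact ⟨C, hC, fun _ _ => hB⟩
    · exact ⟨1, one_pos, fun h' h'' => absurd ⟨h', h''⟩ h⟩
  obtain ⟨C₁, hC₁, h1⟩ := h1
  obtain ⟨C₂, hC₂, h2⟩ := h2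
  obtain ⟨C₃, hC₃, h3⟩ := h3
  obtain ⟨C₄, hC₄, h4⟩ := h4
  have hmono : ∀ {C C' x : ℝ}, C ≤ C' → 0 ≤ x → ((C * x : ℝ) : EReal) ≤ ((C' * x : ℝ) : EReal) :=
    fun hle hx => EReal.coe_le_coe_iff.2 (mul_le_mul_of_nonneg_right hle hx)
  -- Every bound is increasing in its constant, so the sum serves all regimes.
  refine ⟨1, one_pos, C₁ + C₂ + C₃ + C₄, by positivity, fun ε hε hε1 T _ u hu hsupp =>
    ⟨fun hN1 => ?_, fun hN2 hp2 => ?_, fun hN2 _ hps => ?_, fun _ hps => ?_, fun hN2 hps => ?_⟩⟩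
  · exact (h1 hN1 ε hε hε1 T u hu hsupp).trans (hmono (by linarith) (by positivity))
  · exact (h2 hN2 hp2 ε hε hε1 T u hu hsupp).trans (hmono (by linarith) (by positivity))
  · rw [← hN2] at hps
    have h := h3 hps ε hε hε1 T u hu hsupp
    rw [hN2] at h
    exact h.trans (hmono (by linarith) (by positivity))
  · exact (h3 hps ε hε hε1 T u hu hsupp).trans (hmono (by linarith) (by positivity))
  · refine (h4 hN2 hps ε hε hε1 T u hu hsupp).trans (EReal.coe_le_coe_iff.2 (Real.exp_le_exp.2 ?_))
    have : 0 ≤ ε ^ (-(p * (p - 1))) := by positivity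
    nlinarith
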